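/- Let $q_{\sf pre}$ be a probability measure on $\mathbb{R}^d$ ($d\ge 1$) supported in the origin-centered closed ball of radius $R>0$. For $T>0$ and $0\le t<T$ let $\sigma_t=\sqrt{1-e^{-2(T-t)}}$ and let $q_t$ be the law of $e^{-(T-t)}\bar X+\sigma_t\xi$, where $\bar X\sim q_{\sf pre}$ and $\xi\sim\mathcal N(0,I_d)$ are independent (identified with its smooth positive density). The probability flow ODE is $$\frac{\mathrm{d}}{\mathrm{d}t} y_t = y_t+\nabla\log q_t(y_t),\qquad t\in[0,T).$$ There is an absolute constant $C>0$ such that the following holds for all integers $d,k\ge 1$ and all reals $R>0$, $\delta_2\in(0,1)$. For $\sigma>0$ write $$B(\sigma)=R\Big(\frac{k}{\sigma^2}\Big)^k\Big(\frac{R}{\sigma}\Big)^{2k}+\Big(k\log\frac{74kd}{\delta_2}\Big)^{2k}.$$ (i) There is $\delta_0>0$, depending only on $d,k,R,\delta_2$, such that for every $q_{\sf pre}$ as above, every $T$, every window $[t_0,t_0+h]\subseteq[0,T-1]$ with $0\le h\le 1$, every $\delta\in(0,1)$ with $\delta\le\delta_0$, and every probability measure $\nu$ on $\mathbb{R}^d$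 with $W_2(\nu,q_0)\le\delta$: if $(\tilde y_t)_{t\in[0,T)}$ solves the probability flow ODE from $\tilde y_0\sim\nu$, then with probability at least $1-\delta_2$ over $\tilde y_0$, the function $t\mapsto \tilde y_t+\nabla\log q_t(\tilde y_t)$ is $k$ times continuously differentiable on $[0,T)$ and $$\big\|\partial_t^k\big(\tilde y_t+\nabla\log q_t(\tilde y_t)\big)\big\|_\infty\le C\,B(\sigma_t)\qquad\text{for all } t\in[t_0,t_0+h].$$ (ii) The same conclusion holds under the following explicit closeness condition instead of the one on $W_2(\nu,q_0)$. Put $\epsilon_1=\delta_2/(d(60k)^k)$, $\ell=\ln(1/\epsilon_1)$, and $$\tilde\delta=\min\Big\{R,\ \frac{1}{\big(\sqrt d+\sqrt{\ell}\big)\big(\sqrt{2\ell d}/(R\sqrt k)+1\big)^{\ell/k}}\Big\}.$$ The condition is that $y_0\sim q_0$ and $\tilde y_0\sim\nu$ can be coupled so that, almost surely, the solutions of the probability flow ODE started from them satisfy $\sup_{t\in[t_0,t_0+h]}\|y_t-\tilde y_t\|\le\tilde\delta$. Here $\|v\|_\infty=\max_i|v_i|$, $\|\cdot\|$ is the Euclidean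 norm and $W_2$ is the 2-Wasserstein distance. -/

import Mathlib

open MeasureTheory ProbabilityTheory Set
open scoped ENNReal Topology ContDiff

noncomputable section

namespace ProbabilityFlow

/-- The space `ℝ^d` with its Euclidean norm. -/
abbrev Vec (d : ℕ) : Type := EuclideanSpace ℝ (Fin d)

/-- The noise schedule `σ_t = √(1 - e^{-2(T-t)})`. -/
def sigma (T t : ℝ) : ℝ := √(1 - Real.exp (-2 * (T - t)))

/-- `q_t`: the law of `e^{-(T-t)} X + σ_t ξ` for independent `X ∼ qpre`, `ξ ∼ N(0, I_d)`,
that is, the law at time `T - t` of the Ornstein-Uhlenbeck process started from `qpre`. -/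
def marginal {d : ℕ} (qpre : Measure (Vec d)) (T t : ℝ) : Measure (Vec d) :=
  (qpre.prod (stdGaussian (Vec d))).map
    (fun p => Real.exp (-(T - t)) • p.1 + sigma T t • p.2)

/-- The continuous Lebesgue density of `q_t`, for `t < T`
(see `marginal_eq_withDensity`). -/
def density {d : ℕ} (qpre : Measure (Vec d)) (T t : ℝ) (y : Vec d) : ℝ :=
  ∫ x, (√(2 * Real.pi) * sigma T t)⁻¹ ^ d *
    Real.exp (-‖y - Real.exp (-(T - t)) • x‖ ^ 2 / (2 * sigma T t ^ 2)) ∂qpre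

theorem stdGaussian_eq_withDensity (d : ℕ) :
    stdGaussian (Vec d) = (volume : Measure (Vec d)).withDensity
      (fun z => ENNReal.ofReal ((√(2 * Real.pi))⁻¹ ^ d * Real.exp (-‖z‖ ^ 2 / 2))) := by
  have hs : (0 : ℝ) < √(2 * Real.pi) := by positivity
  have hint : ∫ z : Vec d, Real.exp (-‖z‖ ^ 2 / 2) = √(2 * Real.pi) ^ d := by
    have h := GaussianFourier.integral_rexp_neg_mul_sq_norm (V := Vec d) (b := 1 / 2) (by norm_num)
    have h2 : (fun z : Vec d => Real.exp (-(1 / 2) * ‖z‖ ^ 2))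
        = fun z => Real.exp (-‖z‖ ^ 2 / 2) := by
      ext z; congr 1; ring
    rw [h2] at h
    rw [h, finrank_euclideanSpace_fin, Real.sqrt_eq_rpow, ← Real.rpow_natCast,
      ← Real.rpow_mul (by positivity)]
    congr 1 <;> ring
  have hI : Integrable (fun z : Vec d => Real.exp (-‖z‖ ^ 2 / 2)) := by
    by_contra hne
    rw [integral_undef hne] at hint
    exact (pow_pos hs d).ne hint
  have hI' := hI.const_mul ((√(2 * Real.pi))⁻¹ ^ d)
  have hm : Measurable fun z : Vec d => (√(2 * Real.pi))⁻¹ ^ d * Real.exp (-‖z‖ ^ 2 / 2) := by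
    fun_prop
  have : IsFiniteMeasure ((volume : Measure (Vec d)).withDensity
      (fun z => ENNReal.ofReal ((√(2 * Real.pi))⁻¹ ^ d * Real.exp (-‖z‖ ^ 2 / 2)))) :=
    isFiniteMeasure_withDensity_ofReal hI'.2
  apply Measure.ext_of_charFun
  ext w
  rw [charFun_stdGaussian, charFun_apply,
    integral_withDensity_eq_integral_toReal_smul (by fun_prop) (by simp)]
  have h := GaussianFourier.integral_cexp_neg_mul_sq_norm_add (V := Vec d) (b := 1 / 2)
    (by norm_num) Complex.I w
  have e : ∀ z : Vec d,
      (ENNReal.ofReal ((√(2 * Real.pi))⁻¹ ^ d * Real.exp (-‖z‖ ^ 2 / 2))).toReal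
        • Complex.exp (inner ℝ z w * Complex.I)
      = ((√(2 * Real.pi))⁻¹ ^ d : ℝ) *
        Complex.exp (-(1 / 2 : ℂ) * ‖z‖ ^ 2 + Complex.I * inner ℝ w z) := by
    intro z
    rw [ENNReal.toReal_ofReal (by positivity), Complex.real_smul, real_inner_comm, Complex.exp_add]
    push_cast
    rw [mul_assoc]
    congr 2
    · congr 1; ring
    · congr 1; ring
  simp_rw [e]
  rw [integral_const_mul, h]
  have h3 : ((Real.pi : ℂ) / (1 / 2)) ^ ((Module.finrank ℝ (Vec d) : ℂ) / 2)
      = ((√(2 * Real.pi) ^ d : ℝ) : ℂ) := by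
    rw [finrank_euclideanSpace_fin, Real.sqrt_eq_rpow, ← Real.rpow_natCast,
      ← Real.rpow_mul (by positivity), Complex.ofReal_cpow (by positivity)]
    push_cast
    congr 1 <;> ring
  rw [h3, ← mul_assoc, ← Complex.ofReal_mul, ← mul_pow, inv_mul_cancel₀ hs.ne']
  simp only [one_pow, Complex.ofReal_one, one_mul]
  congr 1
  rw [Complex.I_sq]; ring

/-- `density` is the Lebesgue density of the law `q_t`. -/
theorem marginal_eq_withDensity {d : ℕ} (qpre : Measure (Vec d)) [IsProbabilityMeasure qpre]
    {T t : ℝ} (ht : t < T) :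
    marginal qpre T t = (volume : Measure (Vec d)).withDensity
      (fun y => ENNReal.ofReal (density qpre T t y)) := by
  set a := Real.exp (-(T - t)) with ha
  set s := sigma T t with hs_def
  have hs : 0 < s := by
    rw [hs_def, sigma]
    apply Real.sqrt_pos.2
    have : Real.exp (-2 * (T - t)) < 1 := by
      rw [← Real.exp_zero]; exact Real.exp_lt_exp.2 (by linarith)
    linarith
  let φ : Vec d → ℝ := fun z => (√(2 * Real.pi))⁻¹ ^ d * Real.exp (-‖z‖ ^ 2 / 2)
  have hφ : Measurable φ := by fun_prop
  let K : Vec d → Vec d → ℝ := fun y x => (√(2 * Real.pi) * s)⁻¹ ^ d *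
    Real.exp (-‖y - a • x‖ ^ 2 / (2 * s ^ 2))
  have hK0 : ∀ y x, 0 ≤ K y x := fun y x => by positivity
  have hKm : Measurable (fun p : Vec d × Vec d => K p.1 p.2) := by fun_prop
  have hdens : ∀ y, ENNReal.ofReal (density qpre T t y) = ∫⁻ x, ENNReal.ofReal (K y x) ∂qpre := by
    intro y
    rw [density, ← hs_def, ← ha]
    apply ofReal_integral_eq_lintegral_ofReal
    · apply Integrable.of_bound (C := (√(2 * Real.pi) * s)⁻¹ ^ d) (by fun_prop)
      refine Filter.Eventually.of_forall fun x => ?_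
      rw [Real.norm_of_nonneg (hK0 y x)]
      apply mul_le_of_le_one_right (by positivity)
      apply Real.exp_le_one_iff.2
      rw [neg_div]
      exact neg_nonpos.2 (by positivity)
    · exact Filter.Eventually.of_forall fun x => hK0 y x
  simp_rw [hdens]
  apply Measure.ext_of_lintegral
  intro f hf
  have hmap : Measurable (fun p : Vec d × Vec d => a • p.1 + s • p.2) := by fun_prop
  rw [marginal, ← hs_def, ← ha, lintegral_map hf hmap,
    lintegral_prod (fun p : Vec d × Vec d => f (a • p.1 + s • p.2))
      (hf.comp hmap).aemeasurable,
    lintegral_withDensity_eq_lintegral_mul _ (Measurable.lintegral_prod_right'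
      (f := fun p : Vec d × Vec d => ENNReal.ofReal (K p.1 p.2)) hKm.ennreal_ofReal) hf]
  have key : ∀ x, ∫⁻ z, f (a • x + s • z) ∂(stdGaussian (Vec d))
      = ∫⁻ y, ENNReal.ofReal (K y x) * f y := by
    intro x
    rw [stdGaussian_eq_withDensity, lintegral_withDensity_eq_lintegral_mul _ hφ.ennreal_ofReal
      (g := fun z => f (a • x + s • z)) (hf.comp (by fun_prop))]
    let G : Vec d → ℝ≥0∞ := fun w => ENNReal.ofReal (φ (s⁻¹ • w)) * f (a • x + w)
    have hG : Measurable G := by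
      apply Measurable.mul
      · exact (hφ.comp (by fun_prop)).ennreal_ofReal
      · exact hf.comp (by fun_prop)
    have h1 : ∀ z, ((fun z => ENNReal.ofReal (φ z)) * fun z => f (a • x + s • z)) z
        = G (s • z) := by
      intro z
      simp only [G, Pi.mul_apply, smul_smul, inv_mul_cancel₀ hs.ne', one_smul]
    rw [lintegral_congr h1, ← lintegral_map (f := G) (g := fun z => s • z) hG (by fun_prop),
      Measure.map_addHaar_smul _ hs.ne', lintegral_smul_measure, smul_eq_mul,
      ← lintegral_const_mul _ hG, ← lintegral_sub_right_eq_self _ (a • x)]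
    apply lintegral_congr
    intro y
    simp only [G, φ, K, add_sub_cancel, finrank_euclideanSpace_fin]
    rw [← mul_assoc, ← ENNReal.ofReal_mul (by positivity)]
    congr 2
    have he : -(s⁻¹ * ‖y - a • x‖) ^ 2 / 2 = -‖y - a • x‖ ^ 2 / (2 * s ^ 2) := by
      field_simp
    rw [abs_of_nonneg (by positivity), norm_smul, Real.norm_of_nonneg (by positivity), he,
      mul_inv, mul_pow, ← inv_pow]
    ring
  simp_rw [key]
  rw [lintegral_lintegral_swap]
  · apply lintegral_congr
    intro y
    simp only [Pi.mul_apply]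
    rw [lintegral_mul_const]
    exact (hKm.comp (by fun_prop : Measurable fun x : Vec d => (y, x))).ennreal_ofReal
  · apply Measurable.aemeasurable
    apply Measurable.mul
    · exact (hKm.comp measurable_swap).ennreal_ofReal
    · exact hf.comp measurable_snd

/-- The score `∇ log q_t (y)`. -/
def score {d : ℕ} (qpre : Measure (Vec d)) (T t : ℝ) (y : Vec d) : Vec d :=
  gradient (fun z => Real.log (density qpre T t z)) y

/-- The vector field `y + ∇ log q_t (y)` of the probability flow ODE. -/
def field {d : ℕ} (qpre : Measure (Vec d)) (T t : ℝ) (y : Vec d) : Vec d :=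
  y + score qpre T t y

/-- `Φ x` is the solution on `[0, T)` of the probability flow ODE
`d y_t = (y_t + ∇ log q_t (y_t)) dt` with initial value `y_0 = x`. -/
structure IsProbabilityFlow {d : ℕ} (qpre : Measure (Vec d)) (T : ℝ)
    (Φ : Vec d → ℝ → Vec d) : Prop where
  init : ∀ x, Φ x 0 = x
  ode : ∀ x, ∀ t ∈ Ico 0 T,
    HasDerivWithinAt (Φ x) (field qpre T t (Φ x t)) (Ico 0 T) t

/-- `π` is a coupling of `μ` and `ν`. -/
def IsCoupling {d : ℕ} (μ ν : Measure (Vec d)) (π : Measure (Vec d × Vec d)) : Prop :=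
  π.map Prod.fst = μ ∧ π.map Prod.snd = ν

/-- The Wasserstein distance `W₂`. -/
def wassersteinTwo {d : ℕ} (μ ν : Measure (Vec d)) : ℝ≥0∞ :=
  (⨅ (π : Measure (Vec d × Vec d)) (_ : IsCoupling μ ν π),
    ∫⁻ p, edist p.1 p.2 ^ 2 ∂π) ^ (1 / 2 : ℝ)

/-- `t ↦ y_t + ∇ log q_t (y_t)` along the trajectory started from `x`. -/
def fieldAlong {d : ℕ} (qpre : Measure (Vec d)) (T : ℝ) (Φ : Vec d → ℝ → Vec d) (x : Vec d)
    (t : ℝ) : Vec d :=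
  field qpre T t (Φ x t)

/-- `R (k/σ²)^k (R/σ)^{2k} + (k log(74kd/δ₂))^{2k}`. -/
def derivBound (d k : ℕ) (R δ₂ σ : ℝ) : ℝ :=
  R * (k / σ ^ 2) ^ k * (R / σ) ^ (2 * k) + (k * Real.log (74 * k * d / δ₂)) ^ (2 * k)

/-- The `k`-th time derivative of `t ↦ y_t + ∇ log q_t (y_t)` along the trajectory started from
`x` exists (and is continuous) on `[0, T)`, and for all `t` in the window `[t₀, t₀ + h]` its
sup-norm `‖v‖_∞ = max_i |v_i|` is at most `C` times `derivBound`. -/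
def DerivBoundOn {d : ℕ} (qpre : Measure (Vec d)) (T : ℝ) (Φ : Vec d → ℝ → Vec d)
    (C : ℝ) (k : ℕ) (R δ₂ t₀ h : ℝ) (x : Vec d) : Prop :=
  ContDiffOn ℝ k (fieldAlong qpre T Φ x) (Ico 0 T) ∧
  ∀ t ∈ Icc t₀ (t₀ + h),
    ‖(iteratedDerivWithin k (fieldAlong qpre T Φ x) (Ico 0 T) t).ofLp‖
      ≤ C * derivBound d k R δ₂ (sigma T t)

/-- With `ℓ = log (1/ε)`, the threshold
`min R (1 / ((√d + √ℓ) (√(2ℓd) / (R√k) + 1)^{ℓ/k}))`. -/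
def closeness (d k : ℕ) (R ε : ℝ) : ℝ :=
  min R (1 / ((√d + √(Real.log (1 / ε))) *
    (√(2 * Real.log (1 / ε) * d) / (R * √k) + 1) ^ (Real.log (1 / ε) / k)))

end ProbabilityFlow

end

open ProbabilityFlow

/-! Put η_t = y_t/σ_t and let w_t = e^{-(T-t)}/σ_t be the signal-to-noise ratio. The probability
flow ODE becomes η' = w' m(w, η), where m(w, η) is the mean of the posterior with density
proportional to exp(w⟨η,x⟩ - w²‖x‖²/2) with respect to q_pre
(`IsProbabilityFlow.hasDerivWithinAt_normTraj`). In the variable w this reads dη/dw = m(w, η), with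
an analytic right side bounded by R. Time derivatives of high order are then a matter of Cauchy's
estimate, and the question is on how large a complex disc the solution stays under control.

Replace w by w(1+κ) and η by η+v. The posterior weights are multiplied, up to a constant, by the
exponential of κγ(x) plus terms of order κw²R², where γ is the logarithm of the posterior density.
If |κ| ≤ κ₀ and κ₀ is small against an exponential-moment bound for γ plus w²R² (`CBound`), the
complexified partition function stays at least 1/2 in modulus and the complexified mean stays below
3R. This closes a Picard iteration on the disc of radius κ₀. No limit is taken: a finite iterate
agrees with the trajectory to any prescribed order at the base time, and Cauchy's estimate is
applied to that iterate (`IsProbabilityFlow.abs_iteratedDerivWithin_fieldAlong_le`).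

Randomness enters through the exponential moment of γ under the posterior, which is controlled by
the integral `renyi` of the posterior density to the power 5/4. If y_0 has law q_0, Liouville's
theorem gives the law of η_t (`IsProbabilityFlow.marginal_preimage_le`). Under it `renyi` has mean
at most exp(5w²R²/8), free of the dimension (`lintegral_renyi_partZ_le`). Markov's inequality on a
finite net of times follows, and the size of the net enters only through its logarithm.

A start from ν is compared with a coupled start from q_0: trajectories at distance at most 1 have
comparable `renyi`. In (ii) this distance bound holds because the threshold is at most 1. In (i) it
follows from a Lipschitz bound 2e^{R²} for the flow, uniform in T, and Markov's inequality for the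
squared distance.

The constant C is absolute because e^{-2(T-t)} ≤ 17/125 on the window. The leading coefficient is
therefore at most 11/4 · 151/25 · 17/125 < 12/5 < e, and (k+1)! A^k ≤ C k^k holds whenever A < e
(`exists_numeric_bound`). -/

noncomputable section

namespace ProbabilityFlow

/-! ### Exponential integrals over a compactly supported prior; posterior mean and covariance. -/

section ExponentialFamily

theorem ae_norm_le {d : ℕ} {q : Measure (Vec d)} {R : ℝ} (hq : q (Metric.closedBall 0 R)ᶜ = 0) :
    ∀ᵐ x ∂q, ‖x‖ ≤ R := by
  have h : ∀ᵐ x ∂q, x ∈ Metric.closedBall (0 : Vec d) R := hq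
  filter_upwards [h] with x hx
  simpa using hx

theorem integrable_of_continuous {d : ℕ} {E : Type} [NormedAddCommGroup E] {q : Measure (Vec d)} [IsFiniteMeasure q] {R : ℝ}
    (hq : q (Metric.closedBall 0 R)ᶜ = 0) {g : Vec d → E} (hg : Continuous g) :
    Integrable g q := by
  obtain ⟨C, hC⟩ := (isCompact_closedBall (0 : Vec d) R).exists_bound_of_continuousOn
    hg.continuousOn
  refine Integrable.of_bound hg.aestronglyMeasurable C ?_
  filter_upwards [ae_norm_le hq] with x hx
  exact hC x (by simpa using hx)

variable {d : ℕ} {E : Type} [NormedAddCommGroup E] [NormedSpace ℝ E]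

/-- The linear functional `(θ, s) ↦ ⟪θ, x⟫ - s ‖x‖² / 2`. -/
def expo (x : Vec d) : Vec d × ℝ →L[ℝ] ℝ :=
  (innerSL ℝ x).comp (ContinuousLinearMap.fst ℝ _ _) -
    (‖x‖ ^ 2 / 2) • ContinuousLinearMap.snd ℝ _ _

theorem expo_apply (x : Vec d) (p : Vec d × ℝ) :
    expo x p = inner ℝ p.1 x - p.2 * ‖x‖ ^ 2 / 2 := by
  simp [expo, real_inner_comm]
  ring

theorem continuous_expo : Continuous (expo : Vec d → Vec d × ℝ →L[ℝ] ℝ) := by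
  unfold expo
  fun_prop

/-- `∫ exp (⟪θ, x⟫ - s ‖x‖² / 2) g(x) dq(x)` as a function of `(θ, s)`. -/
def expInt (q : Measure (Vec d)) (g : Vec d → E) (p : Vec d × ℝ) : E :=
  ∫ x, Real.exp (expo x p) • g x ∂q

theorem hasFDerivAt_expInt {q : Measure (Vec d)} [IsFiniteMeasure q] {R : ℝ}
    (hq : q (Metric.closedBall 0 R)ᶜ = 0) {g : Vec d → E} (hg : Continuous g)
    (p : Vec d × ℝ) :
    HasFDerivAt (expInt q g) (expInt q (fun x => (expo x).smulRight (g x)) p) p := by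
  have hcont : Continuous fun z : (Vec d × ℝ) × Vec d =>
      Real.exp (expo z.2 z.1) • (expo z.2).smulRight (g z.2) := by
    have h1 : Continuous fun z : (Vec d × ℝ) × Vec d => expo z.2 z.1 :=
      (continuous_expo.comp continuous_snd).clm_apply continuous_fst
    have h2 : Continuous fun z : (Vec d × ℝ) × Vec d =>
        (ContinuousLinearMap.smulRightL ℝ (Vec d × ℝ) E (expo z.2)) (g z.2) :=
      ((ContinuousLinearMap.smulRightL ℝ (Vec d × ℝ) E).continuous.comp
        (continuous_expo.comp continuous_snd)).clm_apply (hg.comp continuous_snd)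
    exact (Real.continuous_exp.comp h1).smul h2
  -- The derivative is jointly continuous, hence bounded on a unit ball of parameters times the
  -- support ball; this constant dominates.
  obtain ⟨C, hC⟩ := ((isCompact_closedBall p 1).prod
    (isCompact_closedBall (0 : Vec d) R)).exists_bound_of_continuousOn hcont.continuousOn
  refine hasFDerivAt_integral_of_dominated_of_fderiv_le (𝕜 := ℝ) (μ := q)
    (F := fun p x => Real.exp (expo x p) • g x)
    (F' := fun p x => Real.exp (expo x p) • (expo x).smulRight (g x)) (bound := fun _ => C)
    (Metric.ball_mem_nhds p one_pos) ?_ ?_ ?_ ?_ ?_ ?_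
  · refine Filter.Eventually.of_forall fun p' => Continuous.aestronglyMeasurable ?_
    exact (Real.continuous_exp.comp (continuous_expo.clm_apply continuous_const)).smul hg
  · refine integrable_of_continuous hq ?_
    exact (Real.continuous_exp.comp (continuous_expo.clm_apply continuous_const)).smul hg
  · exact (hcont.comp (by fun_prop : Continuous fun x : Vec d => (p, x))).aestronglyMeasurable
  · filter_upwards [ae_norm_le hq] with x hx p' hp'
    exact hC (p', x) ⟨Metric.ball_subset_closedBall hp', by simpa using hx⟩
  · exact integrable_const C
  · refine Filter.Eventually.of_forall fun x p' _ => ?_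
    have h := ((expo x).hasFDerivAt (x := p')).exp.smul_const (g x)
    refine h.congr_fderiv ?_
    ext v <;> simp [mul_smul]

/-- Differentiation only replaces `g` by `x ↦ (expo x).smulRight (g x)`, again continuous, so the
induction runs over all target spaces at once. -/
theorem contDiff_expInt {q : Measure (Vec d)} [IsFiniteMeasure q] {R : ℝ}
    (hq : q (Metric.closedBall 0 R)ᶜ = 0) {g : Vec d → E} (hg : Continuous g) (n : ℕ) :
    ContDiff ℝ n (expInt q g) := by
  induction n generalizing E with
  | zero =>
    rw [Nat.cast_zero, contDiff_zero]
    exact continuous_iff_continuousAt.2 fun p => (hasFDerivAt_expInt hq hg p).continuousAt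
  | succ n ih =>
    rw [Nat.cast_succ, contDiff_succ_iff_hasFDerivAt]
    refine ⟨expInt q fun x => (expo x).smulRight (g x), ih ?_, hasFDerivAt_expInt hq hg⟩
    exact ((ContinuousLinearMap.smulRightL ℝ (Vec d × ℝ) E).continuous.comp
      continuous_expo).clm_apply hg

/-- The partition function. -/
def partZ (q : Measure (Vec d)) (p : Vec d × ℝ) : ℝ := expInt q (fun _ => (1 : ℝ)) p

/-- The posterior mean with signal strength `w` and observation `η`. -/
def postMean (q : Measure (Vec d)) (w : ℝ) (η : Vec d) : Vec d :=
  (partZ q (w • η, w ^ 2))⁻¹ • expInt q (fun x => x) (w • η, w ^ 2)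

theorem integrable_exp_expo_smul {q : Measure (Vec d)} [IsFiniteMeasure q] {R : ℝ}
    (hq : q (Metric.closedBall 0 R)ᶜ = 0) {g : Vec d → E} (hg : Continuous g)
    (p : Vec d × ℝ) : Integrable (fun x => Real.exp (expo x p) • g x) q :=
  integrable_of_continuous hq
    ((Real.continuous_exp.comp (continuous_expo.clm_apply continuous_const)).smul hg)

theorem integrable_exp_expo {q : Measure (Vec d)} [IsFiniteMeasure q] {R : ℝ}
    (hq : q (Metric.closedBall 0 R)ᶜ = 0) (p : Vec d × ℝ) :
    Integrable (fun x => Real.exp (expo x p)) q :=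
  integrable_of_continuous hq
    (Real.continuous_exp.comp (continuous_expo.clm_apply continuous_const))

theorem partZ_eq (q : Measure (Vec d)) (p : Vec d × ℝ) :
    partZ q p = ∫ x, Real.exp (expo x p) ∂q := by
  simp [partZ, expInt]

theorem partZ_pos {q : Measure (Vec d)} [IsProbabilityMeasure q] {R : ℝ}
    (hq : q (Metric.closedBall 0 R)ᶜ = 0) (p : Vec d × ℝ) : 0 < partZ q p := by
  rw [partZ_eq]
  exact integral_exp_pos (integrable_exp_expo hq p)

theorem norm_expInt_le {q : Measure (Vec d)} [IsProbabilityMeasure q] {R C : ℝ}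
    (hq : q (Metric.closedBall 0 R)ᶜ = 0) {g : Vec d → E}
    (hC : ∀ x, ‖x‖ ≤ R → ‖g x‖ ≤ C) (p : Vec d × ℝ) :
    ‖expInt q g p‖ ≤ C * partZ q p := by
  rw [partZ_eq, ← integral_const_mul]
  refine norm_integral_le_of_norm_le ((integrable_exp_expo hq p).const_mul C) ?_
  filter_upwards [ae_norm_le hq] with x hx
  rw [norm_smul, Real.norm_of_nonneg (Real.exp_pos _).le, mul_comm]
  exact mul_le_mul_of_nonneg_right (hC x hx) (Real.exp_pos _).le

theorem norm_postMean_le {q : Measure (Vec d)} [IsProbabilityMeasure q] {R : ℝ}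
    (hq : q (Metric.closedBall 0 R)ᶜ = 0) (w : ℝ) (η : Vec d) : ‖postMean q w η‖ ≤ R := by
  have hZ := partZ_pos hq (w • η, w ^ 2)
  rw [postMean, norm_smul, norm_inv, Real.norm_of_nonneg hZ.le, inv_mul_le_iff₀ hZ, mul_comm]
  exact norm_expInt_le hq (fun x hx => hx) _

theorem contDiff_postMean {q : Measure (Vec d)} [IsProbabilityMeasure q] {R : ℝ}
    (hq : q (Metric.closedBall 0 R)ᶜ = 0) (n : ℕ) :
    ContDiff ℝ n fun z : ℝ × Vec d => postMean q z.1 z.2 := by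
  unfold postMean
  have hp : ContDiff ℝ n fun z : ℝ × Vec d => ((z.1 • z.2, z.1 ^ 2) : Vec d × ℝ) := by fun_prop
  refine ContDiff.smul (ContDiff.inv ?_ fun z => (partZ_pos hq _).ne') ?_
  · exact (contDiff_expInt hq continuous_const n).comp hp
  · exact (contDiff_expInt hq continuous_id n).comp hp

/-- The posterior covariance. -/
def postCov (q : Measure (Vec d)) (w : ℝ) (η : Vec d) : Vec d →L[ℝ] Vec d :=
  (partZ q (w • η, w ^ 2))⁻¹ • expInt q (fun x => (innerSL ℝ x).smulRight x) (w • η, w ^ 2) -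
    (innerSL ℝ (postMean q w η)).smulRight (postMean q w η)

theorem expInt_clm {F : Type} [NormedAddCommGroup F] [NormedSpace ℝ F] [CompleteSpace E]
    [CompleteSpace F]
    {q : Measure (Vec d)} [IsFiniteMeasure q] {R : ℝ}
    (hq : q (Metric.closedBall 0 R)ᶜ = 0) {g : Vec d → E} (hg : Continuous g) (L : E →L[ℝ] F)
    (p : Vec d × ℝ) : L (expInt q g p) = expInt q (fun x => L (g x)) p := by
  rw [expInt, ← L.integral_comp_comm (integrable_exp_expo_smul hq hg p)]
  simp [expInt]

theorem fderiv_expInt_apply {q : Measure (Vec d)} [IsFiniteMeasure q] {R : ℝ} [CompleteSpace E]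
    (hq : q (Metric.closedBall 0 R)ᶜ = 0) {g : Vec d → E} (hg : Continuous g)
    (p v : Vec d × ℝ) :
    expInt q (fun x => (expo x).smulRight (g x)) p v = expInt q (fun x => expo x v • g x) p := by
  have hc : Continuous fun x => (expo x).smulRight (g x) :=
    ((ContinuousLinearMap.smulRightL ℝ (Vec d × ℝ) E).continuous.comp
      continuous_expo).clm_apply hg
  have h := expInt_clm hq hc (ContinuousLinearMap.apply ℝ E v) p
  simpa using h

theorem continuous_innerSL_smulRight :
    Continuous fun x : Vec d => (innerSL ℝ x).smulRight x :=
  ((ContinuousLinearMap.smulRightL ℝ (Vec d) (Vec d)).continuous.comp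
      (innerSL ℝ).continuous).clm_apply continuous_id

theorem hasFDerivAt_partZ_snd {q : Measure (Vec d)} [IsProbabilityMeasure q] {R : ℝ}
    (hq : q (Metric.closedBall 0 R)ᶜ = 0) (w : ℝ) (η : Vec d) :
    HasFDerivAt (fun η => partZ q (w • η, w ^ 2))
      (w • innerSL ℝ (expInt q (fun x => x) (w • η, w ^ 2))) η := by
  have hlin : HasFDerivAt (fun η : Vec d => ((w • η, w ^ 2) : Vec d × ℝ))
      ((w • ContinuousLinearMap.id ℝ (Vec d)).prod 0) η :=
    ((hasFDerivAt_id η).const_smul w).prodMk (hasFDerivAt_const _ _)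
  refine ((hasFDerivAt_expInt hq continuous_const _).comp η hlin).congr_fderiv ?_
  ext v
  have h := expInt_clm hq continuous_id (innerSL ℝ v) (w • η, w ^ 2)
  simp only [id, innerSL_apply_apply] at h
  rw [ContinuousLinearMap.comp_apply, fderiv_expInt_apply hq continuous_const]
  simp only [expInt, smul_apply, innerSL_apply_apply, smul_eq_mul]
  rw [real_inner_comm]
  simp only [expInt, id] at h
  rw [h, ← integral_const_mul]
  congr 1 with x
  simp [expo_apply, inner_smul_left]
  ring

/-- In an exponential family the derivative of the mean in the natural parameter is the covariance;
the factor `w` comes from θ = wη. -/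
theorem hasFDerivAt_postMean {q : Measure (Vec d)} [IsProbabilityMeasure q] {R : ℝ}
    (hq : q (Metric.closedBall 0 R)ᶜ = 0) (w : ℝ) (η : Vec d) :
    HasFDerivAt (postMean q w) (w • postCov q w η) η := by
  have hZ := partZ_pos hq (w • η, w ^ 2)
  have hlin : HasFDerivAt (fun η : Vec d => ((w • η, w ^ 2) : Vec d × ℝ))
      ((w • ContinuousLinearMap.id ℝ (Vec d)).prod 0) η :=
    ((hasFDerivAt_id η).const_smul w).prodMk (hasFDerivAt_const _ _)
  have h1 := hasFDerivAt_partZ_snd hq w η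
  have h2 := (hasFDerivAt_expInt hq continuous_id _).comp η hlin
  have h1' : HasFDerivAt (fun η => (partZ q (w • η, w ^ 2))⁻¹) _ η :=
    (hasDerivAt_inv hZ.ne').comp_hasFDerivAt η h1
  refine (h1'.smul h2).congr_fderiv ?_
  ext1 v
  have e1 : expInt q (fun x : Vec d => expo x (w • v, 0) • x) (w • η, w ^ 2)
      = w • expInt q (fun x => (innerSL ℝ x).smulRight x) (w • η, w ^ 2) v := by
    have h := expInt_clm hq continuous_innerSL_smulRight
      (ContinuousLinearMap.apply ℝ (Vec d) v) (w • η, w ^ 2)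
    simp only [ContinuousLinearMap.apply_apply] at h
    rw [h, expInt, expInt, ← integral_smul]
    congr 1 with x
    simp [expo_apply, inner_smul_left, real_inner_comm]
    ring
  have e2 := fderiv_expInt_apply hq continuous_id (w • η, w ^ 2) (w • v, 0)
  simp only [id] at e2
  simp only [add_apply, smul_apply,
    ContinuousLinearMap.comp_apply, ContinuousLinearMap.smulRight_apply, postCov,
    sub_apply, ContinuousLinearMap.prod_apply, Function.comp_apply,
    zero_apply, ContinuousLinearMap.id_apply, innerSL_apply_apply, id]
  rw [e2, e1]
  simp only [postMean, inner_smul_left, smul_sub, smul_smul, smul_eq_mul, conj_trivial]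
  rw [sub_eq_add_neg, ← neg_smul]
  congr 2
  · ring
  · ring

theorem norm_postCov_le {q : Measure (Vec d)} [IsProbabilityMeasure q] {R : ℝ}
    (hq : q (Metric.closedBall 0 R)ᶜ = 0) (w : ℝ) (η : Vec d) :
    ‖postCov q w η‖ ≤ 2 * R ^ 2 := by
  have hZ := partZ_pos hq (w • η, w ^ 2)
  have hm := norm_postMean_le hq w η
  have h1 : ‖(partZ q (w • η, w ^ 2))⁻¹ •
      expInt q (fun x => (innerSL ℝ x).smulRight x) (w • η, w ^ 2)‖ ≤ R ^ 2 := by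
    rw [norm_smul, norm_inv, Real.norm_of_nonneg hZ.le, inv_mul_le_iff₀ hZ, mul_comm]
    refine norm_expInt_le hq (fun x hx => ?_) _
    rw [ContinuousLinearMap.norm_smulRight_apply, innerSL_apply_norm, sq]
    exact mul_self_le_mul_self (norm_nonneg _) hx
  have h2 : ‖(innerSL ℝ (postMean q w η)).smulRight (postMean q w η)‖ ≤ R ^ 2 := by
    rw [ContinuousLinearMap.norm_smulRight_apply, innerSL_apply_norm, sq]
    exact mul_self_le_mul_self (norm_nonneg _) hm
  calc _ ≤ _ := norm_sub_le _ _
    _ ≤ 2 * R ^ 2 := by linarith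

theorem norm_postMean_sub_le {q : Measure (Vec d)} [IsProbabilityMeasure q] {R : ℝ}
    (hq : q (Metric.closedBall 0 R)ᶜ = 0) (w : ℝ) (η η' : Vec d) :
    ‖postMean q w η - postMean q w η'‖ ≤ |w| * (2 * R ^ 2) * ‖η - η'‖ := by
  refine convex_univ.norm_image_sub_le_of_norm_hasFDerivWithin_le (𝕜 := ℝ)
    (fun x _ => (hasFDerivAt_postMean hq w x).hasFDerivWithinAt) (fun x _ => ?_)
    (mem_univ _) (mem_univ _)
  rw [norm_smul, Real.norm_eq_abs]
  exact mul_le_mul_of_nonneg_left (norm_postCov_le hq w x) (abs_nonneg _)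

end ExponentialFamily

/-! ### Noise level and signal-to-noise ratio. -/

section Schedule

/-- The signal-to-noise ratio `e^{-(T-t)} / σ_t`. -/
def snr (T t : ℝ) : ℝ := Real.exp (-(T - t)) / sigma T t

variable {T t : ℝ}

theorem exp_two_mul_sub (T t : ℝ) : Real.exp (-2 * (T - t)) = Real.exp (-(T - t)) ^ 2 := by
  rw [← Real.exp_nat_mul]; push_cast; ring_nf

theorem sigma_radicand_pos (ht : t < T) : 0 < 1 - Real.exp (-2 * (T - t)) := by
  have : Real.exp (-2 * (T - t)) < 1 := by
    rw [Real.exp_lt_one_iff]; linarith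
  linarith

theorem sigma_pos (ht : t < T) : 0 < sigma T t := Real.sqrt_pos.2 (sigma_radicand_pos ht)

theorem sigma_sq (ht : t < T) : sigma T t ^ 2 = 1 - Real.exp (-(T - t)) ^ 2 := by
  rw [sigma, Real.sq_sqrt (sigma_radicand_pos ht).le, exp_two_mul_sub]

theorem sigma_le_one (T t : ℝ) : sigma T t ≤ 1 := by
  rw [sigma, Real.sqrt_le_iff]
  constructor <;> linarith [Real.exp_pos (-2 * (T - t))]

theorem snr_pos (ht : t < T) : 0 < snr T t := div_pos (Real.exp_pos _) (sigma_pos ht)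

theorem hasDerivAt_exp_sub (T t : ℝ) :
    HasDerivAt (fun t => Real.exp (-(T - t))) (Real.exp (-(T - t))) t := by
  simpa using ((hasDerivAt_id t).const_sub T).neg.exp

theorem hasDerivAt_sigma (ht : t < T) :
    HasDerivAt (sigma T) (-Real.exp (-(T - t)) ^ 2 / sigma T t) t := by
  have h0 : HasDerivAt (fun t => 1 - Real.exp (-2 * (T - t)))
      (-(2 * Real.exp (-(T - t)) ^ 2)) t := by
    have h := (((hasDerivAt_id t).const_sub T).const_mul (-2)).exp.const_sub 1
    refine h.congr_deriv ?_
    simp only [id, exp_two_mul_sub]; ring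
  refine (h0.sqrt (sigma_radicand_pos ht).ne').congr_deriv ?_
  have := sigma_pos ht
  change _ / (2 * sigma T t) = _
  field_simp

theorem hasDerivAt_snr (ht : t < T) : HasDerivAt (snr T) (snr T t / sigma T t ^ 2) t := by
  have hs := sigma_pos ht
  refine ((hasDerivAt_exp_sub T t).div (hasDerivAt_sigma ht) hs.ne').congr_deriv ?_
  have h2 := sigma_sq ht
  rw [snr]
  field_simp
  linear_combination h2

theorem contDiffAt_sigma (ht : t < T) {n : ℕ∞ω} : ContDiffAt ℝ n (sigma T) t := by
  unfold sigma
  exact ContDiffAt.sqrt (by fun_prop) (sigma_radicand_pos ht).ne'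

theorem contDiffAt_snr (ht : t < T) {n : ℕ∞ω} : ContDiffAt ℝ n (snr T) t := by
  unfold snr
  exact ContDiffAt.div (by fun_prop) (contDiffAt_sigma ht) (sigma_pos ht).ne'

end Schedule

/-! ### The score through the posterior mean, the normalised flow, regularity in time. -/

section Field

variable {d : ℕ} {q : Measure (Vec d)} [IsProbabilityMeasure q] {R T t : ℝ}

/-- Expanding the square in the Gaussian kernel, the cross term is w⟨y/σ, x⟩ and the term in ‖x‖² is
-w²‖x‖²/2. -/
theorem density_eq_partZ {q : Measure (Vec d)} (ht : t < T) (y : Vec d) :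
    density q T t y = (√(2 * Real.pi) * sigma T t)⁻¹ ^ d *
      Real.exp (-‖(sigma T t)⁻¹ • y‖ ^ 2 / 2) *
        partZ q (snr T t • (sigma T t)⁻¹ • y, snr T t ^ 2) := by
  have hs := sigma_pos ht
  rw [density, partZ_eq, ← integral_const_mul]
  congr 1 with x
  rw [mul_assoc, ← Real.exp_add]
  congr 2
  rw [expo_apply, norm_smul, @norm_sub_sq_real, inner_smul_left, inner_smul_left,
    inner_smul_right, norm_smul, snr, norm_inv, Real.norm_of_nonneg hs.le,
    Real.norm_of_nonneg (Real.exp_pos _).le]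
  simp only [conj_trivial]
  field_simp
  ring

/-- Tweedie's formula, from the logarithm of the factorisation `density_eq_partZ`. -/
theorem score_eq (hq : q (Metric.closedBall 0 R)ᶜ = 0) (ht : t < T) (y : Vec d) :
    score q T t y = (sigma T t ^ 2)⁻¹ •
      (Real.exp (-(T - t)) • postMean q (snr T t) ((sigma T t)⁻¹ • y) - y) := by
  have hs := sigma_pos ht
  have hZ := partZ_pos hq
  have hC : (0 : ℝ) < (√(2 * Real.pi) * sigma T t)⁻¹ ^ d := by positivity
  have hlog : (fun z => Real.log (density q T t z)) = fun z =>
      Real.log ((√(2 * Real.pi) * sigma T t)⁻¹ ^ d) + (-‖(sigma T t)⁻¹ • z‖ ^ 2 / 2) +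
        Real.log (partZ q (snr T t • (sigma T t)⁻¹ • z, snr T t ^ 2)) := by
    ext z
    rw [density_eq_partZ ht, Real.log_mul (by positivity) (hZ _).ne',
      Real.log_mul hC.ne' (Real.exp_pos _).ne', Real.log_exp]
  have hlin : HasFDerivAt (fun z : Vec d => (sigma T t)⁻¹ • z)
      ((sigma T t)⁻¹ • ContinuousLinearMap.id ℝ (Vec d)) y :=
    ((sigma T t)⁻¹ • ContinuousLinearMap.id ℝ (Vec d)).hasFDerivAt
  have h1 := ((hasStrictFDerivAt_norm_sq ((sigma T t)⁻¹ • y)).hasFDerivAt.comp y hlin).neg.const_mul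
    (1 / 2)
  have h2 := ((hasFDerivAt_partZ_snd hq (snr T t) ((sigma T t)⁻¹ • y)).log (hZ _).ne').comp y hlin
  have h := (h1.const_add (Real.log ((√(2 * Real.pi) * sigma T t)⁻¹ ^ d))).add h2
  rw [score, gradient, hlog]
  have hf := h.fderiv
  have hfun : ((fun x => Real.log ((√(2 * Real.pi) * sigma T t)⁻¹ ^ d) +
      1 / 2 * (-((fun x => ‖x‖ ^ 2) ∘ fun z => (sigma T t)⁻¹ • z)) x) +
      (fun x => Real.log (partZ q (snr T t • x, snr T t ^ 2))) ∘ fun z => (sigma T t)⁻¹ • z)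
      = fun z => Real.log ((√(2 * Real.pi) * sigma T t)⁻¹ ^ d) +
        (-‖(sigma T t)⁻¹ • z‖ ^ 2 / 2) +
        Real.log (partZ q (snr T t • (sigma T t)⁻¹ • z, snr T t ^ 2)) := by
    ext z
    simp only [Pi.add_apply, Pi.neg_apply, Function.comp_apply]
    ring
  rw [hfun] at hf
  rw [hf]
  apply (InnerProductSpace.toDual ℝ (Vec d)).injective
  rw [LinearIsometryEquiv.apply_symm_apply]
  ext v
  simp only [InnerProductSpace.toDual_apply_apply, add_apply, smul_apply, neg_apply,
    ContinuousLinearMap.comp_apply, ContinuousLinearMap.id_apply, innerSL_apply_apply, postMean,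
    inner_smul_left, inner_smul_right, inner_sub_left, conj_trivial, smul_eq_mul, nsmul_eq_mul]
  rw [snr]
  push_cast
  field_simp
  ring

theorem field_eq (hq : q (Metric.closedBall 0 R)ᶜ = 0) (ht : t < T) (y : Vec d) :
    field q T t y = (sigma T t ^ 2)⁻¹ •
      (Real.exp (-(T - t)) • postMean q (snr T t) ((sigma T t)⁻¹ • y) -
        Real.exp (-(T - t)) ^ 2 • y) := by
  have hs := sigma_pos ht
  have h2 := sigma_sq ht
  rw [field, score_eq hq ht]
  simp only [smul_sub, smul_smul]
  have : y = ((sigma T t ^ 2)⁻¹ * sigma T t ^ 2) • y := by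
    rw [inv_mul_cancel₀ (by positivity), one_smul]
  nth_rewrite 1 [this]
  rw [h2]
  module

/-- The trajectory divided by the noise level. -/
def normTraj (T : ℝ) (Φ : Vec d → ℝ → Vec d) (x : Vec d) (t : ℝ) : Vec d :=
  (sigma T t)⁻¹ • Φ x t

/-- The vector field of the normalised flow. -/
def normField (q : Measure (Vec d)) (T t : ℝ) (η : Vec d) : Vec d :=
  (snr T t / sigma T t ^ 2) • postMean q (snr T t) η

/-- The derivative of 1/σ cancels the linear part of the field exactly, since σ' = -e^{-2(T-t)}/σ.
What remains is a multiple of the bounded posterior mean. -/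
theorem IsProbabilityFlow.hasDerivWithinAt_normTraj (hq : q (Metric.closedBall 0 R)ᶜ = 0)
    {Φ : Vec d → ℝ → Vec d} (hΦ : IsProbabilityFlow q T Φ) (x : Vec d) (ht : t ∈ Ico 0 T) :
    HasDerivWithinAt (normTraj T Φ x) (normField q T t (normTraj T Φ x t)) (Ico 0 T) t := by
  have hs := sigma_pos ht.2
  have h1 : HasDerivWithinAt (fun t => (sigma T t)⁻¹) _ (Ico 0 T) t :=
    ((hasDerivAt_sigma ht.2).inv hs.ne').hasDerivWithinAt
  refine (h1.smul (hΦ.ode x t ht)).congr_deriv ?_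
  rw [field_eq hq ht.2, normField, normTraj, snr]
  simp only [smul_sub, smul_smul]
  rw [sub_add_eq_add_sub, sub_eq_iff_eq_add]
  congr 2
  · field_simp
  · field_simp

theorem contDiffOn_field (hq : q (Metric.closedBall 0 R)ᶜ = 0) {n : ℕ} {y : ℝ → Vec d}
    {s : Set ℝ} (hs : s ⊆ Iio T) (hy : ContDiffOn ℝ n y s) :
    ContDiffOn ℝ n (fun t => field q T t (y t)) s := by
  have hσ : ContDiffOn ℝ n (sigma T) s := fun t ht => (contDiffAt_sigma (hs ht)).contDiffWithinAt
  have hw : ContDiffOn ℝ n (snr T) s := fun t ht => (contDiffAt_snr (hs ht)).contDiffWithinAt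
  have hσ0 : ∀ t ∈ s, sigma T t ≠ 0 := fun t ht => (sigma_pos (hs ht)).ne'
  have h : ContDiffOn ℝ n (fun t => (sigma T t ^ 2)⁻¹ •
      (Real.exp (-(T - t)) • postMean q (snr T t) ((sigma T t)⁻¹ • y t) -
        Real.exp (-(T - t)) ^ 2 • y t)) s := by
    have he : ContDiffOn ℝ n (fun t => Real.exp (-(T - t))) s := by fun_prop
    have hp : ContDiffOn ℝ n (fun t => (snr T t, (sigma T t)⁻¹ • y t)) s :=
      hw.prodMk ((hσ.inv hσ0).smul hy)
    have hm : ContDiffOn ℝ n (fun t => postMean q (snr T t) ((sigma T t)⁻¹ • y t)) s :=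
      by
        have h0 := contDiff_postMean hq n
        generalize postMean q = m at h0 ⊢
        exact h0.comp_contDiffOn hp
    exact ((hσ.pow 2).inv fun t ht => pow_ne_zero 2 (hσ0 t ht)).smul
      ((he.smul hm).sub ((he.pow 2).smul hy))
  exact h.congr fun t ht => field_eq hq (hs ht) _

/-- Bootstrap: the field is smooth in time and space together, so the ODE gains one order of
regularity at each step. -/
theorem IsProbabilityFlow.contDiffOn (hq : q (Metric.closedBall 0 R)ᶜ = 0)
    {Φ : Vec d → ℝ → Vec d} (hΦ : IsProbabilityFlow q T Φ) (x : Vec d) (n : ℕ) :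
    ContDiffOn ℝ n (Φ x) (Ico 0 T) := by
  induction n with
  | zero =>
    rw [Nat.cast_zero, contDiffOn_zero]
    exact fun t ht => (hΦ.ode x t ht).continuousWithinAt
  | succ n ih =>
    rw [Nat.cast_succ, contDiffOn_succ_iff_derivWithin (uniqueDiffOn_Ico 0 T)]
    refine ⟨fun t ht => (hΦ.ode x t ht).differentiableWithinAt, by simp, ?_⟩
    refine (contDiffOn_field hq (fun t ht => ht.2) ih).congr fun t ht => ?_
    exact (hΦ.ode x t ht).derivWithin (uniqueDiffOn_Ico 0 T t ht)

theorem IsProbabilityFlow.contDiffOn_fieldAlong (hq : q (Metric.closedBall 0 R)ᶜ = 0)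
    {Φ : Vec d → ℝ → Vec d} (hΦ : IsProbabilityFlow q T Φ) (x : Vec d) (n : ℕ) :
    ContDiffOn ℝ n (fieldAlong q T Φ x) (Ico 0 T) :=
  contDiffOn_field hq (fun _ ht => ht.2) (hΦ.contDiffOn hq x n)

theorem IsProbabilityFlow.iteratedDerivWithin_fieldAlong {q : Measure (Vec d)}
    {Φ : Vec d → ℝ → Vec d} (hΦ : IsProbabilityFlow q T Φ) (x : Vec d) (k : ℕ)
    (ht : t ∈ Ico 0 T) :
    iteratedDerivWithin k (fieldAlong q T Φ x) (Ico 0 T) t =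
      iteratedDerivWithin (k + 1) (Φ x) (Ico 0 T) t := by
  rw [iteratedDerivWithin_succ']
  refine iteratedDerivWithin_congr (fun s hs => ?_) ht
  exact ((hΦ.ode x s hs).derivWithin (uniqueDiffOn_Ico 0 T s hs)).symm

end Field

/-! ### Linear equations with bounded coefficients on a whole interval. -/

section LinearODE

variable {V : Type*} [NormedAddCommGroup V] [NormedSpace ℝ V]

theorem exists_linear_ode_short [CompleteSpace V] {A : ℝ → V →L[ℝ] V} {K a b : ℝ} (hK : 0 < K)
    (hab : a ≤ b) (hA : ContinuousOn A (Icc a b)) (hAK : ∀ t ∈ Icc a b, ‖A t‖ ≤ K)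
    (hlen : K * (b - a) ≤ 1 / 2) (x₀ : V) :
    ∃ α : ℝ → V, α a = x₀ ∧
      ∀ t ∈ Icc a b, HasDerivWithinAt α (A t (α t)) (Icc a b) t := by
  -- On the ball of radius ‖x₀‖ + 1 about `x₀` the field is at most 2K(‖x₀‖ + 1), so a solution
  -- cannot leave the ball within time 1/(2K).
  have hpl : IsPicardLindelof (fun t x => A t x) (⟨a, left_mem_Icc.2 hab⟩ : Icc a b) x₀
      (‖x₀‖₊ + 1) 0 (K.toNNReal * (2 * (‖x₀‖₊ + 1))) K.toNNReal := by
    refine ⟨fun t ht => ?_, fun x _ => hA.clm_apply continuousOn_const, fun t ht x hx => ?_, ?_⟩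
    · refine ((A t).lipschitz.weaken ?_).lipschitzOnWith
      rw [← NNReal.coe_le_coe, Real.coe_toNNReal _ hK.le]
      exact hAK t ht
    · have hx' : ‖x‖ ≤ 2 * (‖x₀‖ + 1) := by
        have h1 := norm_le_norm_add_norm_sub' x x₀
        have h2 : ‖x - x₀‖ ≤ ‖x₀‖ + 1 := by simpa [dist_eq_norm] using hx
        linarith
      push_cast
      rw [Real.coe_toNNReal _ hK.le]
      calc ‖A t x‖ ≤ ‖A t‖ * ‖x‖ := (A t).le_opNorm x
        _ ≤ _ := mul_le_mul (hAK t ht) hx' (norm_nonneg _) hK.le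
    · simp only [sub_self]
      rw [max_eq_left (by linarith)]
      push_cast
      rw [Real.coe_toNNReal _ hK.le]
      nlinarith [norm_nonneg x₀]
  exact hpl.exists_eq_forall_mem_Icc_hasDerivWithinAt₀

theorem hasDerivWithinAt_ite {α β : ℝ → V} {α' β' : V} {a b c t : ℝ}
    (hab : a ≤ b) (hbc : b ≤ c) {γ' : V}
    (hα : t ≤ b → HasDerivWithinAt α α' (Icc a b) t) (hα' : t ≤ b → γ' = α')
    (hβ : b ≤ t → HasDerivWithinAt β β' (Icc b c) t) (hβ' : b ≤ t → γ' = β')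
    (h : α b = β b) :
    HasDerivWithinAt (fun t => if t ≤ b then α t else β t) γ' (Icc a c) t := by
  rw [← Icc_union_Icc_eq_Icc hab hbc]
  apply HasDerivWithinAt.union
  · by_cases htb : t ≤ b
    · rw [hα' htb]
      refine (hα htb).congr (fun s hs => if_pos hs.2) (if_pos htb)
    · refine HasFDerivWithinAt.of_notMem_closure ?_
      rw [isClosed_Icc.closure_eq]
      exact fun h => htb h.2
  · by_cases htb : b ≤ t
    · rw [hβ' htb]
      have e : ∀ s, b ≤ s → (if s ≤ b then α s else β s) = β s := by
        intro s hs
        split_ifs with hs'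
        · rw [le_antisymm hs' hs, h]
        · rfl
      exact (hβ htb).congr (fun s hs => e s hs.1) (e t htb)
    · refine HasFDerivWithinAt.of_notMem_closure ?_
      rw [isClosed_Icc.closure_eq]
      exact fun h => htb h.1

/-- The admissible step length depends on the bound for `A` and not on the initial value, so
finitely many steps of length 1/(2L) cover the interval. Taking L = K + 1 keeps it positive. -/
theorem exists_linear_ode [CompleteSpace V] {A : ℝ → V →L[ℝ] V} {K b : ℝ} (hb : 0 ≤ b)
    (hA : ContinuousOn A (Icc 0 b)) (hAK : ∀ t ∈ Icc 0 b, ‖A t‖ ≤ K) (x₀ : V) :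
    ∃ α : ℝ → V, α 0 = x₀ ∧
      ∀ t ∈ Icc 0 b, HasDerivWithinAt α (A t (α t)) (Icc 0 b) t := by
  have hK0 : 0 ≤ K := (norm_nonneg _).trans (hAK 0 (left_mem_Icc.2 hb))
  set L := K + 1 with hL
  have hLp : 0 < L := by linarith
  suffices H : ∀ n : ℕ, ∀ c ∈ Icc 0 b, c ≤ n * (1 / (2 * L)) → ∃ α : ℝ → V, α 0 = x₀ ∧
      ∀ t ∈ Icc 0 c, HasDerivWithinAt α (A t (α t)) (Icc 0 c) t by
    obtain ⟨n, hn⟩ := exists_nat_ge (b * (2 * L))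
    refine H n b (right_mem_Icc.2 hb) ?_
    rw [mul_one_div, le_div_iff₀ (by positivity)]
    exact hn
  intro n
  induction n with
  | zero =>
    intro c hc hc0
    have : c = 0 := le_antisymm (by simpa using hc0) hc.1
    subst this
    refine ⟨fun _ => x₀, rfl, fun t ht => ?_⟩
    rw [Icc_self] at ht ⊢
    rw [mem_singleton_iff.1 ht]
    exact HasFDerivWithinAt.of_subsingleton subsingleton_singleton
  | succ n ih =>
    intro c hc hcn
    by_cases hcase : c ≤ n * (1 / (2 * L))
    · exact ih c hc hcase
    push Not at hcase
    set c' := n * (1 / (2 * L)) with hc'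
    have hc'0 : 0 ≤ c' := by positivity
    obtain ⟨α, hα0, hα⟩ := ih c' ⟨hc'0, hcase.le.trans hc.2⟩ le_rfl
    have hsub : Icc c' c ⊆ Icc 0 b := Icc_subset_Icc hc'0 hc.2
    obtain ⟨β, hβ0, hβ⟩ := exists_linear_ode_short hLp hcase.le (hA.mono hsub)
      (fun t ht => (hAK t (hsub ht)).trans (by linarith)) (by
        have h1 : c - c' ≤ 1 / (2 * L) := by
          push_cast at hcn; rw [hc']; linarith
        calc L * (c - c') ≤ L * (1 / (2 * L)) := by gcongr
          _ = 1 / 2 := by field_simp) (α c')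
    refine ⟨fun t => if t ≤ c' then α t else β t, by simp [hc'0, hα0], fun t ht => ?_⟩
    refine hasDerivWithinAt_ite hc'0 hcase.le (fun h => hα t ⟨ht.1, h⟩) (fun h => ?_)
      (fun h => hβ t ⟨h, ht.2⟩) (fun h => ?_) hβ0.symm
    · simp only [h, if_true]
    · dsimp only
      split_ifs with h'
      · rw [le_antisymm h' h, hβ0]
      · rfl

end LinearODE

/-! ### Jacobi's formula for the determinant. -/

section Liouville

variable {E : Type*} [NormedAddCommGroup E] [NormedSpace ℝ E] [FiniteDimensional ℝ E]

theorem contDiff_clm_det : ContDiff ℝ 1 fun A : E →L[ℝ] E => A.det := by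
  let b := Module.finBasis ℝ E
  have h : ∀ A : E →L[ℝ] E, A.det = (LinearMap.toMatrix b b (A : E →ₗ[ℝ] E)).det := fun A => by
    rw [LinearMap.det_toMatrix]
  simp_rw [h, Matrix.det_apply]
  refine ContDiff.sum fun σ _ => ContDiff.const_smul _ (contDiff_prod fun i _ => ?_)
  let L : (E →L[ℝ] E) →ₗ[ℝ] ℝ :=
    (Matrix.entryLinearMap ℝ ℝ (σ i) i) ∘ₗ (LinearMap.toMatrix b b).toLinearMap ∘ₗ
      (ContinuousLinearMap.coeLM ℝ)
  exact (LinearMap.toContinuousLinearMap L).contDiff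

/-- Along J + rAJ the determinant factors as det(1 + rA) det J, and the first factor has derivative
tr A at 0. Invertibility of `J` plays no role. -/
theorem fderiv_clm_det_apply (A J : E →L[ℝ] E) :
    fderiv ℝ (fun A : E →L[ℝ] E => A.det) J (A ∘L J) =
      LinearMap.trace ℝ E (A : E →ₗ[ℝ] E) * J.det := by
  let b := Module.finBasis ℝ E
  have hd : HasFDerivAt (fun A : E →L[ℝ] E => A.det)
      (fderiv ℝ (fun A : E →L[ℝ] E => A.det) J) J :=
    (contDiff_clm_det.differentiable one_ne_zero).differentiableAt.hasFDerivAt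
  have hl : HasDerivAt (fun r : ℝ => J + r • (A ∘L J)) (A ∘L J) 0 := by
    simpa using ((hasDerivAt_id (0 : ℝ)).smul_const (A ∘L J)).const_add J
  have h1 : HasDerivAt ((fun A : E →L[ℝ] E => A.det) ∘ fun r : ℝ => J + r • (A ∘L J))
      (fderiv ℝ (fun A : E →L[ℝ] E => A.det) J (A ∘L J)) 0 :=
    HasFDerivAt.comp_hasDerivAt 0 (by rw [zero_smul, add_zero]; exact hd) hl
  set M := LinearMap.toMatrix b b (A : E →ₗ[ℝ] E) with hM
  have hdet : ∀ r : ℝ, (J + r • (A ∘L J)).det = (1 + r • M).det * J.det := by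
    intro r
    have e : (J + r • (A ∘L J)) = (1 + r • A) ∘L J := by ext; simp
    have e2 : ((1 + r • A) ∘L J).det = (1 + r • A).det * J.det := by
      change LinearMap.det (((1 + r • A : E →L[ℝ] E) : E →ₗ[ℝ] E) ∘ₗ (J : E →ₗ[ℝ] E)) = _
      rw [LinearMap.det_comp]
    rw [e, e2]
    congr 1
    change LinearMap.det ((1 + r • A : E →L[ℝ] E) : E →ₗ[ℝ] E) = _
    rw [← LinearMap.det_toMatrix b]
    congr 1
    rw [hM, ← map_smul]
    have : LinearMap.toMatrix b b (1 : E →ₗ[ℝ] E) = 1 := LinearMap.toMatrix_one b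
    rw [← this, ← map_add]
    rfl
  have h2 : HasDerivAt (fun r : ℝ => (1 + r • M).det * J.det) (M.trace * J.det) 0 := by
    refine HasDerivAt.mul_const ?_ _
    rw [funext fun r : ℝ => Matrix.det_one_add_smul r M]
    set P := (Matrix.det (1 + (Polynomial.X : Polynomial ℝ) •
      M.map ⇑Polynomial.C)).divX.divX
    have h3 : HasDerivAt (fun r : ℝ => 1 + M.trace * r + P.eval r * r ^ 2) _ 0 :=
      (((hasDerivAt_id (0 : ℝ)).const_mul M.trace).const_add 1).add
        ((P.hasDerivAt 0).mul (hasDerivAt_pow 2 (0 : ℝ)))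
    refine h3.congr_deriv ?_
    simp
  rw [show ((fun A : E →L[ℝ] E => A.det) ∘ fun r : ℝ => J + r • (A ∘L J)) = _ from
    funext hdet] at h1
  rw [h1.unique h2, hM, ← LinearMap.trace_eq_matrix_trace]

theorem hasDerivWithinAt_det_of_linear_ode {J : ℝ → E →L[ℝ] E} {A : E →L[ℝ] E} {s : Set ℝ} {t : ℝ}
    (hJ : HasDerivWithinAt J (A ∘L J t) s t) :
    HasDerivWithinAt (fun t => (J t).det) (LinearMap.trace ℝ E (A : E →ₗ[ℝ] E) * (J t).det) s t := by
  rw [← fderiv_clm_det_apply]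
  exact ((contDiff_clm_det.differentiable one_ne_zero).differentiableAt.hasFDerivAt
    (x := J t)).comp_hasDerivWithinAt t hJ

end Liouville

/-! ### Differentiability of a flow in its initial value. -/

section FlowDerivative

variable {E : Type*} [NormedAddCommGroup E] [NormedSpace ℝ E] [FiniteDimensional ℝ E]

theorem HasDerivWithinAt.Ici_of_Icc {E : Type*} [NormedAddCommGroup E] [NormedSpace ℝ E]
    {f : ℝ → E} {f' : E} {a b t : ℝ}
    (h : HasDerivWithinAt f f' (Icc a b) t) (ht : t ∈ Ico a b) :
    HasDerivWithinAt f f' (Ici t) t :=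
  h.mono_of_mem_nhdsWithin (Icc_mem_nhdsGE_of_mem ht)

/-- Differentiability of a flow with respect to the initial value; the derivative solves the
linearised equation. -/
theorem hasFDerivAt_flow {b : ℝ → E → E} {b' : ℝ → E → E →L[ℝ] E} {Y : E → ℝ → E} {τ K c : ℝ}
    (hτ : 0 ≤ τ) (hK : 0 < K)
    (hb : ∀ t ∈ Icc 0 τ, ∀ η, HasFDerivAt (b t) (b' t η) η)
    (hcont : ContinuousOn (fun z : ℝ × E => b' z.1 z.2) (Icc 0 τ ×ˢ univ))
    (hb' : ∀ t ∈ Icc 0 τ, ∀ η, ‖b' t η‖ ≤ K)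
    (hY0 : ∀ x, Y x 0 = c • x)
    (hY : ∀ x, ∀ t ∈ Icc 0 τ, HasDerivWithinAt (Y x) (b t (Y x t)) (Icc 0 τ) t)
    (x : E) {J : ℝ → E →L[ℝ] E} (hJ0 : J 0 = c • ContinuousLinearMap.id ℝ E)
    (hJ : ∀ t ∈ Icc 0 τ, HasDerivWithinAt J (b' t (Y x t) ∘L J t) (Icc 0 τ) t) :
    HasFDerivAt (fun x => Y x τ) (J τ) x := by
  have hYc : ∀ x, ContinuousOn (Y x) (Icc 0 τ) := fun x t ht => (hY x t ht).continuousWithinAt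
  have hLip : ∀ x', ∀ t ∈ Icc 0 τ, ‖Y x' t - Y x t‖ ≤ |c| * Real.exp (K * τ) * ‖x' - x‖ := by
    intro x' t ht
    have h := dist_le_of_trajectories_ODE_of_mem (v := b) (s := fun _ => univ) (K := K.toNNReal)
      (a := 0) (b := τ) (δ := |c| * ‖x' - x‖)
      (fun t ht => LipschitzWith.lipschitzOnWith ?_) (hYc x')
      (fun t ht => (hY x' t (Ico_subset_Icc_self ht)).Ici_of_Icc ht)
      (fun _ _ => mem_univ _) (hYc x)
      (fun t ht => (hY x t (Ico_subset_Icc_self ht)).Ici_of_Icc ht) (fun _ _ => mem_univ _)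
      (by rw [dist_eq_norm, hY0, hY0, ← smul_sub, norm_smul, Real.norm_eq_abs]) t ht
    · rw [dist_eq_norm, Real.coe_toNNReal _ hK.le, sub_zero] at h
      calc _ ≤ _ := h
        _ ≤ |c| * ‖x' - x‖ * Real.exp (K * τ) := by
          have := ht.2
          gcongr
        _ = _ := by ring
    · refine lipschitzWith_of_nnnorm_fderiv_le (𝕜 := ℝ)
        (fun η => (hb t (Ico_subset_Icc_self ht) η).differentiableAt) fun η => ?_
      rw [(hb t (Ico_subset_Icc_self ht) η).fderiv, ← NNReal.coe_le_coe,
        Real.coe_toNNReal _ hK.le]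
      exact hb' t (Ico_subset_Icc_self ht) η
  set C := |c| * Real.exp (K * τ) with hC
  have hC0 : 0 ≤ C := by positivity
  obtain ⟨ρ, hρ⟩ := isCompact_Icc.exists_bound_of_continuousOn (hYc x)
  set G := Real.exp (K * τ) / K with hG
  have hG0 : 0 < G := by positivity
  rw [hasFDerivAt_iff_isLittleO_nhds_zero, Asymptotics.isLittleO_iff]
  intro ε hε
  have hunif := ((isCompact_Icc (a := (0 : ℝ)) (b := τ)).prod
    (isCompact_closedBall (0 : E) (ρ + 1))).uniformContinuousOn_of_continuous
    (hcont.mono (prod_mono_right (subset_univ _)))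
  obtain ⟨ε', hε', hεε⟩ : ∃ ε' > 0, ε' * C * G ≤ ε := by
    refine ⟨ε / (C * G + 1), by positivity, ?_⟩
    rw [mul_assoc, div_mul_eq_mul_div, div_le_iff₀ (by positivity)]
    nlinarith
  obtain ⟨δ, hδ, hδu⟩ := Metric.uniformContinuousOn_iff.1 hunif ε' hε'
  have hsmall : ∀ᶠ h : E in 𝓝 0, C * ‖h‖ < min δ 1 := by
    have : Filter.Tendsto (fun h : E => C * ‖h‖) (𝓝 0) (𝓝 0) := by
      have hc : Continuous fun h : E => C * ‖h‖ := by fun_prop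
      simpa using hc.tendsto 0
    exact this.eventually_lt_const (lt_min hδ one_pos)
  filter_upwards [hsmall] with h hh
  have hclose : ∀ t ∈ Icc 0 τ, ‖Y (x + h) t - Y x t‖ ≤ C * ‖h‖ := fun t ht => by
    simpa using hLip (x + h) t ht
  -- Taylor remainder of the field between the two trajectories, small by uniform continuity of `b'`
  -- on a compact neighbourhood of the reference trajectory.
  have hrem : ∀ t ∈ Icc 0 τ, ‖b t (Y (x + h) t) - b t (Y x t) -
      b' t (Y x t) (Y (x + h) t - Y x t)‖ ≤ ε' * (C * ‖h‖) := by
    intro t ht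
    have hseg : ∀ ζ ∈ segment ℝ (Y x t) (Y (x + h) t), ‖b' t ζ - b' t (Y x t)‖ ≤ ε' := by
      intro ζ hζ
      have hd : ‖ζ - Y x t‖ ≤ C * ‖h‖ := by
        obtain ⟨s, hs, rfl⟩ := (segment_eq_image' ℝ (Y x t) (Y (x + h) t)) ▸ hζ
        rw [add_sub_cancel_left, norm_smul, Real.norm_of_nonneg hs.1]
        exact (mul_le_of_le_one_left (norm_nonneg _) hs.2).trans (hclose t ht)
      have hY1 := hρ t ht
      have h2 : ‖ζ‖ ≤ ρ + 1 := by
        have := norm_le_norm_add_norm_sub' ζ (Y x t)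
        have := hh.trans_le (min_le_right _ _)
        linarith
      have h3 := hδu (t, ζ) ⟨ht, by simpa using h2⟩ (t, Y x t) ⟨ht, by
        simpa using hY1.trans (by linarith)⟩ (by
          rw [dist_prod_same_left, dist_eq_norm]
          exact hd.trans_lt (hh.trans_le (min_le_left _ _)))
      rw [dist_eq_norm] at h3
      exact h3.le
    refine ((convex_segment _ _).norm_image_sub_le_of_norm_hasFDerivWithin_le' (𝕜 := ℝ)
      (fun ζ _ => (hb t ht ζ).hasFDerivWithinAt) hseg (left_mem_segment _ _ _)
      (right_mem_segment _ _ _)).trans ?_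
    exact mul_le_mul_of_nonneg_left (hclose t ht) hε'.le
  -- The error of the linear prediction starts at 0 and solves the linearised equation with the
  -- Taylor remainder as forcing. Grönwall's inequality then makes it o(‖h‖).
  have hr : ∀ t ∈ Icc 0 τ, HasDerivWithinAt (fun t => Y (x + h) t - Y x t - J t h)
      (b t (Y (x + h) t) - b t (Y x t) - b' t (Y x t) (J t h)) (Icc 0 τ) t := by
    intro t ht
    refine ((hY _ t ht).sub (hY _ t ht)).sub ?_
    simpa using (hJ t ht).clm_apply (hasDerivWithinAt_const t (Icc 0 τ) h)
  have hgr := norm_le_gronwallBound_of_norm_deriv_right_le (δ := 0) (K := K)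
    (ε := ε' * (C * ‖h‖)) (fun t ht => (hr t ht).continuousWithinAt)
    (fun t ht => (hr t (Ico_subset_Icc_self ht)).Ici_of_Icc ht)
    (by simp [hY0, hJ0]) (fun t ht => by
      have ht' := Ico_subset_Icc_self ht
      have e : b t (Y (x + h) t) - b t (Y x t) - b' t (Y x t) (J t h) =
        b' t (Y x t) (Y (x + h) t - Y x t - J t h) +
        (b t (Y (x + h) t) - b t (Y x t) - b' t (Y x t) (Y (x + h) t - Y x t)) := by
        rw [map_sub (b' t (Y x t)) (Y (x + h) t - Y x t) (J t h)]; abel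
      rw [e]
      refine (norm_add_le _ _).trans (add_le_add ?_ (hrem t ht'))
      exact ((b' t (Y x t)).le_opNorm _).trans
        (mul_le_mul_of_nonneg_right (hb' t ht' _) (norm_nonneg _))) τ (right_mem_Icc.2 hτ)
  refine hgr.trans ?_
  rw [gronwallBound_of_K_ne_0 hK.ne', sub_zero]
  simp only [zero_mul, zero_add]
  calc ε' * (C * ‖h‖) / K * (Real.exp (K * τ) - 1)
      ≤ ε' * (C * ‖h‖) / K * Real.exp (K * τ) := by
        gcongr
        linarith
    _ = ε' * C * G * ‖h‖ := by rw [hG]; ring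
    _ ≤ ε * ‖h‖ := by gcongr

end FlowDerivative

/-! ### Transport of q_0 by the normalised flow. -/

section Pushforward

variable {d : ℕ} {q : Measure (Vec d)} [IsProbabilityMeasure q] {R T : ℝ}

theorem trace_innerSL_smulRight (x : Vec d) :
    LinearMap.trace ℝ (Vec d) ((innerSL ℝ x).smulRight x : Vec d →L[ℝ] Vec d) = ‖x‖ ^ 2 := by
  have h : (((innerSL ℝ x).smulRight x : Vec d →L[ℝ] Vec d) : Vec d →ₗ[ℝ] Vec d) =
      LinearMap.smulRight ((innerSL ℝ x : Vec d →L[ℝ] ℝ) : Vec d →ₗ[ℝ] ℝ) x := rfl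
  rw [h, LinearMap.trace_smulRight]
  simp

theorem trace_postCov (hq : q (Metric.closedBall 0 R)ᶜ = 0) (w : ℝ) (η : Vec d) :
    LinearMap.trace ℝ (Vec d) (postCov q w η : Vec d →ₗ[ℝ] Vec d) =
      (partZ q (w • η, w ^ 2))⁻¹ * expInt q (fun x => ‖x‖ ^ 2) (w • η, w ^ 2) -
        ‖postMean q w η‖ ^ 2 := by
  let L : (Vec d →L[ℝ] Vec d) →L[ℝ] ℝ := LinearMap.toContinuousLinearMap
    ((LinearMap.trace ℝ (Vec d)) ∘ₗ (ContinuousLinearMap.coeLM ℝ))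
  have hL : ∀ B : Vec d →L[ℝ] Vec d, L B = LinearMap.trace ℝ (Vec d) (B : Vec d →ₗ[ℝ] Vec d) :=
    fun B => rfl
  rw [← hL, postCov, map_sub, map_smul, expInt_clm hq continuous_innerSL_smulRight]
  simp_rw [hL, trace_innerSL_smulRight]
  rfl

theorem continuous_postCov (hq : q (Metric.closedBall 0 R)ᶜ = 0) :
    Continuous fun z : ℝ × Vec d => postCov q z.1 z.2 := by
  have hp : Continuous fun z : ℝ × Vec d => ((z.1 • z.2, z.1 ^ 2) : Vec d × ℝ) := by fun_prop
  have hm : Continuous fun z : ℝ × Vec d => postMean q z.1 z.2 :=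
    (contDiff_postMean hq 0).continuous
  have hZ : Continuous fun z : ℝ × Vec d => partZ q (z.1 • z.2, z.1 ^ 2) :=
    (contDiff_expInt hq continuous_const 0).continuous.comp hp
  have hN : Continuous fun z : ℝ × Vec d => expInt q (fun x => (innerSL ℝ x).smulRight x)
      (z.1 • z.2, z.1 ^ 2) :=
    (contDiff_expInt hq continuous_innerSL_smulRight 0).continuous.comp hp
  exact ((hZ.inv₀ fun z => (partZ_pos hq _).ne').smul hN).sub
    (continuous_innerSL_smulRight.comp hm)

/-- The density of the normalised marginal with signal strength `w`, up to a constant. -/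
def normDensity (q : Measure (Vec d)) (w : ℝ) (η : Vec d) : ℝ :=
  Real.exp (-‖η‖ ^ 2 / 2) * partZ q (w • η, w ^ 2)

/-- The continuity equation along a trajectory. -/
theorem hasDerivWithinAt_normDensity (hq : q (Metric.closedBall 0 R)ᶜ = 0) {y : ℝ → Vec d}
    {s : Set ℝ} {t : ℝ} (ht : t < T) (hy : HasDerivWithinAt y (normField q T t (y t)) s t) :
    HasDerivWithinAt (fun t => normDensity q (snr T t) (y t))
      (-(snr T t / sigma T t ^ 2 * snr T t * LinearMap.trace ℝ (Vec d)
        (postCov q (snr T t) (y t) : Vec d →ₗ[ℝ] Vec d) * normDensity q (snr T t) (y t))) s t := by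
  have hZ := partZ_pos hq (snr T t • y t, snr T t ^ 2)
  have hw := (hasDerivAt_snr ht).hasDerivWithinAt (s := s)
  have h1 := ((hy.norm_sq).neg.div_const 2).exp
  have h2 : HasDerivWithinAt (fun t => ((snr T t • y t, snr T t ^ 2) : Vec d × ℝ)) _ s t :=
    (hw.smul hy).prodMk (hw.pow 2)
  have h3 : HasDerivWithinAt (fun t => partZ q (snr T t • y t, snr T t ^ 2)) _ s t :=
    (hasFDerivAt_expInt hq continuous_const _).comp_hasDerivWithinAt t h2
  refine (h1.mul h3).congr_deriv ?_
  rw [fderiv_expInt_apply hq continuous_const, trace_postCov hq]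
  set w := snr T t
  set w' := snr T t / sigma T t ^ 2 with hw'
  set p : Vec d × ℝ := (w • y t, w ^ 2) with hp
  have hN : expInt q (fun x => x) p = partZ q p • postMean q w (y t) := by
    rw [postMean, smul_inv_smul₀ hZ.ne']
  have hlin : expInt q (fun x => expo x (w • normField q T t (y t) + w' • y t,
      ((2 : ℕ) : ℝ) * w ^ (2 - 1) * w') • (1 : ℝ)) p =
      inner ℝ (w • normField q T t (y t) + w' • y t) (expInt q (fun x => x) p) -
        w * w' * expInt q (fun x => ‖x‖ ^ 2) p := by
    have e := expInt_clm hq continuous_id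
      (innerSL ℝ (w • normField q T t (y t) + w' • y t)) p
    simp only [id, innerSL_apply_apply] at e
    change inner ℝ _ (expInt q (fun x => x) p) = _ at e
    rw [e]
    simp only [expInt]
    rw [← integral_const_mul, ← integral_sub]
    · congr 1 with x
      rw [expo_apply x (w • normField q T t (y t) + w' • y t, _)]
      simp
      ring
    · exact integrable_exp_expo_smul hq (by fun_prop) p
    · exact (integrable_exp_expo_smul hq (by fun_prop) p).const_mul _
  have hF : normField q T t (y t) = w' • postMean q w (y t) := rfl
  -- The Gaussian factor contributes -w'⟨η, m⟩ and the motion of w inside the partition function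
  -- +w'⟨η, m⟩. These cancel, and -ww' times the posterior variance E‖x‖² - ‖m‖² is left.
  rw [hlin, hN, normDensity, hF, ← hp]
  simp only [inner_add_left, inner_smul_left, inner_smul_right, conj_trivial,
    real_inner_self_eq_norm_sq, Pi.neg_apply]
  field_simp
  rw [real_inner_comm]
  ring

theorem IsProbabilityFlow.normTraj_zero {q : Measure (Vec d)} {Φ : Vec d → ℝ → Vec d} (hΦ : IsProbabilityFlow q T Φ)
    (x : Vec d) : normTraj T Φ x 0 = (sigma T 0)⁻¹ • x := by
  rw [normTraj, hΦ.init]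

theorem continuousOn_snr_div {τ : ℝ} (hτ : τ < T) :
    ContinuousOn (fun t => snr T t / sigma T t ^ 2 * snr T t) (Icc 0 τ) := by
  intro t ht
  have htT : t < T := ht.2.trans_lt hτ
  have h1 := (hasDerivAt_snr htT).continuousAt
  have h2 := (hasDerivAt_sigma htT).continuousAt
  exact ((h1.div (h2.pow 2) (pow_ne_zero 2 (sigma_pos htT).ne')).mul h1).continuousWithinAt

/-- The spatial derivative of `normField`. -/
def normFieldDeriv (q : Measure (Vec d)) (T t : ℝ) (η : Vec d) : Vec d →L[ℝ] Vec d :=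
  (snr T t / sigma T t ^ 2 * snr T t) • postCov q (snr T t) η

theorem hasFDerivAt_normField (hq : q (Metric.closedBall 0 R)ᶜ = 0) (t : ℝ) (η : Vec d) :
    HasFDerivAt (normField q T t) (normFieldDeriv q T t η) η := by
  rw [normFieldDeriv, mul_smul]
  exact (hasFDerivAt_postMean hq (snr T t) η).const_smul (snr T t / sigma T t ^ 2)

theorem continuousOn_normFieldDeriv (hq : q (Metric.closedBall 0 R)ᶜ = 0) {τ : ℝ} (hτ : τ < T) :
    ContinuousOn (fun z : ℝ × Vec d => normFieldDeriv q T z.1 z.2) (Icc 0 τ ×ˢ univ) := by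
  have hsnr : ContinuousOn (snr T) (Icc 0 τ) := fun t ht =>
    (hasDerivAt_snr (ht.2.trans_lt hτ)).continuousAt.continuousWithinAt
  refine ContinuousOn.smul ((continuousOn_snr_div hτ).comp continuousOn_fst fun z hz => hz.1) ?_
  have hp : ContinuousOn (fun z : ℝ × Vec d => (snr T z.1, z.2)) (Icc 0 τ ×ˢ univ) :=
    (hsnr.comp continuousOn_fst fun z hz => hz.1).prodMk continuousOn_snd
  have h0 := continuous_postCov hq
  generalize postCov q = Γ at h0 ⊢
  exact h0.comp_continuousOn hp

theorem exists_bound_normFieldDeriv (hq : q (Metric.closedBall 0 R)ᶜ = 0) {τ : ℝ} (hτ0 : 0 ≤ τ)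
    (hτ : τ < T) : ∃ K : ℝ, 0 < K ∧ ∀ t ∈ Icc 0 τ, ∀ η, ‖normFieldDeriv q T t η‖ ≤ K := by
  obtain ⟨K₀, hK₀⟩ := isCompact_Icc.exists_bound_of_continuousOn (continuousOn_snr_div hτ)
  have hK₀0 : 0 ≤ K₀ := (norm_nonneg _).trans (hK₀ 0 (left_mem_Icc.2 hτ0))
  refine ⟨K₀ * (2 * R ^ 2) + 1, by positivity, fun t ht η => ?_⟩
  rw [normFieldDeriv, norm_smul]
  have := mul_le_mul (hK₀ t ht) (norm_postCov_le hq (snr T t) η) (norm_nonneg _) hK₀0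
  linarith

theorem exists_linear_ode_comp {A : ℝ → Vec d →L[ℝ] Vec d} {K b : ℝ} (hb : 0 ≤ b)
    (hA : ContinuousOn A (Icc 0 b)) (hAK : ∀ t ∈ Icc 0 b, ‖A t‖ ≤ K) (J₀ : Vec d →L[ℝ] Vec d) :
    ∃ J : ℝ → Vec d →L[ℝ] Vec d, J 0 = J₀ ∧
      ∀ t ∈ Icc 0 b, HasDerivWithinAt J (A t ∘L J t) (Icc 0 b) t := by
  obtain ⟨J, hJ0, hJ⟩ := exists_linear_ode (V := Vec d →L[ℝ] Vec d) hb
    (A := fun t => ContinuousLinearMap.compL ℝ (Vec d) (Vec d) (Vec d) (A t)) (K := K)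
    ((ContinuousLinearMap.compL ℝ (Vec d) (Vec d) (Vec d)).continuous.comp_continuousOn hA)
    (fun t ht => (by
      refine ((ContinuousLinearMap.compL ℝ (Vec d) (Vec d) (Vec d)).le_opNorm _).trans ?_
      exact (mul_le_of_le_one_left (norm_nonneg _)
        (ContinuousLinearMap.norm_compL_le ℝ (Vec d) (Vec d) (Vec d))).trans (hAK t ht))) J₀
  exact ⟨J, hJ0, hJ⟩

theorem IsProbabilityFlow.hasDerivWithinAt_Icc (hq : q (Metric.closedBall 0 R)ᶜ = 0)
    {Φ : Vec d → ℝ → Vec d} (hΦ : IsProbabilityFlow q T Φ) {τ : ℝ} (hτ : τ < T)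
    (x : Vec d) {t : ℝ} (ht : t ∈ Icc 0 τ) :
    HasDerivWithinAt (normTraj T Φ x) (normField q T t (normTraj T Φ x t)) (Icc 0 τ) t :=
  (hΦ.hasDerivWithinAt_normTraj hq x ⟨ht.1, ht.2.trans_lt hτ⟩).mono
    fun _ hs => ⟨hs.1, hs.2.trans_lt hτ⟩

/-- The differential of the normalised flow and its determinant. -/
theorem IsProbabilityFlow.exists_hasFDerivAt (hq : q (Metric.closedBall 0 R)ᶜ = 0)
    {Φ : Vec d → ℝ → Vec d} (hΦ : IsProbabilityFlow q T Φ) {τ : ℝ} (hτ0 : 0 ≤ τ) (hτ : τ < T)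
    (x : Vec d) :
    ∃ J : Vec d →L[ℝ] Vec d, HasFDerivAt (fun x => normTraj T Φ x τ) J x ∧
      normDensity q (snr T τ) (normTraj T Φ x τ) * J.det =
        normDensity q (snr T 0) ((sigma T 0)⁻¹ • x) * (sigma T 0)⁻¹ ^ d := by
  obtain ⟨K, hK, hb'⟩ := exists_bound_normFieldDeriv hq hτ0 hτ
  have hY : ∀ x, ∀ t ∈ Icc 0 τ, HasDerivWithinAt (normTraj T Φ x)
      (normField q T t (normTraj T Φ x t)) (Icc 0 τ) t := fun x t ht =>
    hΦ.hasDerivWithinAt_Icc hq hτ x ht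
  have hYc : ContinuousOn (normTraj T Φ x) (Icc 0 τ) := fun t ht =>
    (hY x t ht).continuousWithinAt
  have hcont := continuousOn_normFieldDeriv hq hτ
  obtain ⟨J, hJ0, hJ⟩ := exists_linear_ode_comp hτ0
    (hcont.comp (continuousOn_id.prodMk hYc) fun t ht => ⟨ht, mem_univ _⟩)
    (fun t ht => hb' t ht _) ((sigma T 0)⁻¹ • ContinuousLinearMap.id ℝ (Vec d))
  refine ⟨J τ, hasFDerivAt_flow hτ0 hK (fun t _ η => hasFDerivAt_normField hq t η) hcont hb'
    hΦ.normTraj_zero hY x hJ0 hJ, ?_⟩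
  -- Mass conservation: the density falls at the rate of the divergence of the field, and the
  -- Jacobian determinant grows at the same rate.
  have hder : ∀ t ∈ Icc 0 τ, HasDerivWithinAt
      (fun t => normDensity q (snr T t) (normTraj T Φ x t) * (J t).det) 0 (Icc 0 τ) t := by
    intro t ht
    have h1 := hasDerivWithinAt_normDensity hq (ht.2.trans_lt hτ) (hY x t ht)
    have h2 := hasDerivWithinAt_det_of_linear_ode (hJ t ht)
    refine (h1.mul h2).congr_deriv ?_
    simp only [Function.comp_apply, id, normFieldDeriv, ContinuousLinearMap.toLinearMap_smul, map_smul,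
      smul_eq_mul]
    ring
  have hc := constant_of_has_deriv_right_zero (fun t ht => (hder t ht).continuousWithinAt)
    (fun t ht => (hder t (Ico_subset_Icc_self ht)).Ici_of_Icc ht) τ (right_mem_Icc.2 hτ0)
  rw [hc, hJ0, hΦ.normTraj_zero]
  congr 1
  change LinearMap.det ((sigma T 0)⁻¹ • (LinearMap.id : Vec d →ₗ[ℝ] Vec d)) = _
  rw [LinearMap.det_smul, LinearMap.det_id, mul_one, finrank_euclideanSpace_fin]

theorem lipschitzWith_normField (hq : q (Metric.closedBall 0 R)ᶜ = 0) {t K : ℝ}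
    (ht : t < T) (hK : snr T t / sigma T t ^ 2 * snr T t * (2 * R ^ 2) ≤ K) :
    LipschitzWith K.toNNReal (normField q T t) := by
  have hw := snr_pos ht
  have hs := sigma_pos ht
  refine LipschitzWith.of_dist_le_mul fun η η' => ?_
  rw [dist_eq_norm, dist_eq_norm, normField, normField, ← smul_sub, norm_smul,
    Real.norm_of_nonneg (by positivity),
    Real.coe_toNNReal K (le_trans (by positivity) hK)]
  calc _ ≤ snr T t / sigma T t ^ 2 * (|snr T t| * (2 * R ^ 2) * ‖η - η'‖) := by
        gcongr
        exact norm_postMean_sub_le hq _ _ _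
    _ = snr T t / sigma T t ^ 2 * snr T t * (2 * R ^ 2) * ‖η - η'‖ := by
        rw [abs_of_pos hw]; ring
    _ ≤ _ := by gcongr

/-- Backward uniqueness: two solutions of a Lipschitz equation that meet at time `τ` agree back to
time 0. -/
theorem IsProbabilityFlow.injective (hq : q (Metric.closedBall 0 R)ᶜ = 0)
    {Φ : Vec d → ℝ → Vec d} (hΦ : IsProbabilityFlow q T Φ) {τ : ℝ} (hτ0 : 0 ≤ τ) (hτ : τ < T) :
    Function.Injective fun x => normTraj T Φ x τ := by
  intro x x' hxx'
  obtain ⟨K₀, hK₀⟩ := isCompact_Icc.exists_bound_of_continuousOn (continuousOn_snr_div hτ)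
  have hY : ∀ x, ∀ t ∈ Icc 0 τ, HasDerivWithinAt (normTraj T Φ x)
      (normField q T t (normTraj T Φ x t)) (Icc 0 τ) t := fun x t ht =>
    hΦ.hasDerivWithinAt_Icc hq hτ x ht
  have hleft : ∀ x, ∀ t ∈ Ioc 0 τ, HasDerivWithinAt (normTraj T Φ x)
      (normField q T t (normTraj T Φ x t)) (Iic t) t := fun x t ht =>
    (hY x t (Ioc_subset_Icc_self ht)).mono_of_mem_nhdsWithin (Icc_mem_nhdsLE_of_mem ht)
  have h := ODE_solution_unique_of_mem_Icc_left (v := normField q T) (s := fun _ => univ)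
    (K := (K₀ * (2 * R ^ 2)).toNNReal) (fun t ht => (lipschitzWith_normField hq
      (ht.2.trans_lt hτ) ?_).lipschitzOnWith)
    (fun t ht => (hY x t ht).continuousWithinAt) (hleft x) (fun _ _ => mem_univ _)
    (fun t ht => (hY x' t ht).continuousWithinAt) (hleft x') (fun _ _ => mem_univ _) hxx'
  · have h0 := h (left_mem_Icc.2 hτ0)
    rw [hΦ.normTraj_zero, hΦ.normTraj_zero] at h0
    exact smul_right_injective _ (inv_ne_zero (sigma_pos (hτ0.trans_lt hτ)).ne') h0
  · gcongr
    exact (le_abs_self _).trans (hK₀ t (Ioc_subset_Icc_self ht))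

/-- The normalised flow transports `q_0` to the law with density `normDensity`. -/
theorem IsProbabilityFlow.marginal_preimage_le (hq : q (Metric.closedBall 0 R)ᶜ = 0)
    {Φ : Vec d → ℝ → Vec d} (hΦ : IsProbabilityFlow q T Φ) {τ : ℝ} (hτ0 : 0 ≤ τ) (hτ : τ < T)
    {A : Set (Vec d)} (hA : MeasurableSet A) :
    marginal q T 0 {x | normTraj T Φ x τ ∈ A} ≤
      ∫⁻ η in A, ENNReal.ofReal (partZ q (snr T τ • η, snr T τ ^ 2)) ∂(stdGaussian (Vec d)) := by
  choose J hJ hdet using hΦ.exists_hasFDerivAt hq hτ0 hτ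
  have hT : 0 < T := hτ0.trans_lt hτ
  have hcont : Continuous fun x => normTraj T Φ x τ :=
    continuous_iff_continuousAt.2 fun x => (hJ x).continuousAt
  have hS : MeasurableSet {x | normTraj T Φ x τ ∈ A} := hcont.measurable hA
  have hnd : ∀ w (η : Vec d), 0 < normDensity q w η := fun w η =>
    mul_pos (Real.exp_pos _) (partZ_pos hq _)
  have hJpos : ∀ x, 0 < (J x).det := by
    intro x
    have h1 : 0 < normDensity q (snr T 0) ((sigma T 0)⁻¹ • x) * (sigma T 0)⁻¹ ^ d :=
      mul_pos (hnd _ _) (pow_pos (inv_pos.2 (sigma_pos hT)) d)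
    rw [← hdet x] at h1
    exact pos_of_mul_pos_right h1 (hnd _ _).le
  have hZm : Measurable fun η => ENNReal.ofReal (partZ q (snr T τ • η, snr T τ ^ 2)) := by
    refine ENNReal.measurable_ofReal.comp (Continuous.measurable ?_)
    exact (contDiff_expInt hq continuous_const 0).continuous.comp (by fun_prop)
  rw [marginal_eq_withDensity q hT, withDensity_apply _ hS, stdGaussian_eq_withDensity,
    setLIntegral_withDensity_eq_setLIntegral_mul _ (by fun_prop) hZm hA]
  have hg : ∀ x, ENNReal.ofReal (density q T 0 x) = ENNReal.ofReal |(J x).det| *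
      ((fun z : Vec d => ENNReal.ofReal ((√(2 * Real.pi))⁻¹ ^ d * Real.exp (-‖z‖ ^ 2 / 2))) *
        fun η => ENNReal.ofReal (partZ q (snr T τ • η, snr T τ ^ 2))) (normTraj T Φ x τ) := by
    intro x
    rw [Pi.mul_apply, ← ENNReal.ofReal_mul (by positivity), ← ENNReal.ofReal_mul (abs_nonneg _),
      abs_of_pos (hJpos x), density_eq_partZ hT]
    congr 1
    have h := hdet x
    rw [normDensity, normDensity] at h
    rw [mul_inv, mul_pow]
    linear_combination (-(√(2 * Real.pi))⁻¹ ^ d) * h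
  simp_rw [hg]
  rw [← lintegral_image_eq_lintegral_abs_det_fderiv_mul volume hS
    (fun x _ => (hJ x).hasFDerivWithinAt) ((hΦ.injective hq hτ0 hτ).injOn)]
  -- The image of the event lies in `A`. Only this inclusion is needed, so surjectivity of the flow
  -- never comes up.
  refine lintegral_mono_set ?_
  rintro _ ⟨x, hx, rfl⟩
  exact hx

end Pushforward

/-! ### Moments of the Rényi integral and of the coordinates under the transported law. -/

section TailBounds

variable {d : ℕ}

theorem lintegral_exp_inner_stdGaussian (c : Vec d) :
    ∫⁻ η, ENNReal.ofReal (Real.exp (inner ℝ η c)) ∂(stdGaussian (Vec d)) =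
      ENNReal.ofReal (Real.exp (‖c‖ ^ 2 / 2)) := by
  have hmap := IsGaussian.map_eq_gaussianReal (μ := stdGaussian (Vec d)) (innerSL ℝ c)
  rw [integral_strongDual_stdGaussian, variance_dual_stdGaussian, innerSL_apply_norm] at hmap
  have h := mgf_gaussianReal hmap 1
  rw [mgf] at h
  have e : ∀ η : Vec d, Real.exp (1 * innerSL ℝ c η) = Real.exp (inner ℝ η c) := fun η => by
    rw [one_mul, innerSL_apply_apply, real_inner_comm]
  simp_rw [e] at h
  rw [Real.coe_toNNReal _ (by positivity)] at h
  have hint : Integrable (fun η : Vec d => Real.exp (inner ℝ η c)) (stdGaussian (Vec d)) := by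
    by_contra hne
    rw [integral_undef hne] at h
    exact (Real.exp_pos _).ne h
  rw [← ofReal_integral_eq_lintegral_ofReal hint
    (Filter.Eventually.of_forall fun η => (Real.exp_pos _).le), h]
  congr 2
  ring

variable {q : Measure (Vec d)} [IsProbabilityMeasure q] {R : ℝ}

/-- After Tonelli, the integral over η for fixed x is a Gaussian Laplace transform, equal to exp(‖c
x‖²/2 + k x). -/
theorem lintegral_exp_affine_le (hq : q (Metric.closedBall 0 R)ᶜ = 0) {c : Vec d → Vec d}
    {k : Vec d → ℝ} (hc : Continuous c) (hk : Continuous k) {B : ℝ}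
    (hB : ∀ x, ‖x‖ ≤ R → ‖c x‖ ^ 2 / 2 + k x ≤ B) :
    ∫⁻ η, ENNReal.ofReal (∫ x, Real.exp (inner ℝ η (c x) + k x) ∂q) ∂(stdGaussian (Vec d)) ≤
      ENNReal.ofReal (Real.exp B) := by
  have h1 : ∀ η : Vec d, ENNReal.ofReal (∫ x, Real.exp (inner ℝ η (c x) + k x) ∂q) =
      ∫⁻ x, ENNReal.ofReal (Real.exp (inner ℝ η (c x) + k x)) ∂q := fun η =>
    ofReal_integral_eq_lintegral_ofReal (integrable_of_continuous hq (by fun_prop))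
      (Filter.Eventually.of_forall fun x => (Real.exp_pos _).le)
  simp_rw [h1]
  rw [lintegral_lintegral_swap (by fun_prop)]
  calc _ ≤ ∫⁻ _, ENNReal.ofReal (Real.exp B) ∂q := by
        refine lintegral_mono_ae ?_
        filter_upwards [ae_norm_le hq] with x hx
        have h2 : ∀ η : Vec d, ENNReal.ofReal (Real.exp (inner ℝ η (c x) + k x)) =
            ENNReal.ofReal (Real.exp (k x)) * ENNReal.ofReal (Real.exp (inner ℝ η (c x))) :=
          fun η => by
            rw [← ENNReal.ofReal_mul (Real.exp_pos _).le, ← Real.exp_add, add_comm]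
        simp_rw [h2]
        rw [lintegral_const_mul _ (by fun_prop), lintegral_exp_inner_stdGaussian,
          ← ENNReal.ofReal_mul (Real.exp_pos _).le, ← Real.exp_add]
        refine ENNReal.ofReal_le_ofReal (Real.exp_le_exp.2 ?_)
        linarith [hB x hx]
    _ = _ := by simp

theorem lintegral_exp_inner_partZ_le (hq : q (Metric.closedBall 0 R)ᶜ = 0) {w : ℝ} (hw : 0 ≤ w)
    (c : Vec d) :
    ∫⁻ η, ENNReal.ofReal (Real.exp (inner ℝ η c)) *
      ENNReal.ofReal (partZ q (w • η, w ^ 2)) ∂(stdGaussian (Vec d)) ≤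
      ENNReal.ofReal (Real.exp (‖c‖ ^ 2 / 2 + w * ‖c‖ * R)) := by
  have h := lintegral_exp_affine_le hq (c := fun x => c + w • x)
    (k := fun x => -(w ^ 2 * ‖x‖ ^ 2 / 2)) (by fun_prop) (by fun_prop)
    (B := ‖c‖ ^ 2 / 2 + w * ‖c‖ * R) (fun x hx => by
      rw [norm_add_sq_real, norm_smul, inner_smul_right, Real.norm_of_nonneg hw]
      have h1 := real_inner_le_norm c x
      have h2 : w * inner ℝ c x ≤ w * (‖c‖ * R) := by
        refine mul_le_mul_of_nonneg_left (h1.trans ?_) hw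
        exact mul_le_mul_of_nonneg_left hx (norm_nonneg _)
      linarith)
  refine le_trans (le_of_eq ?_) h
  refine lintegral_congr fun η => ?_
  rw [← ENNReal.ofReal_mul (Real.exp_pos _).le, partZ_eq, ← integral_const_mul]
  congr 2 with x
  rw [← Real.exp_add, expo_apply, inner_add_right, inner_smul_left, inner_smul_right]
  simp only [conj_trivial]
  congr 1
  ring

/-- The integral `∫ ρ^{5/4} dq`, where `ρ` is the posterior density with respect to `q`, at the
natural parameter `p`. -/
def renyi (q : Measure (Vec d)) (p : Vec d × ℝ) : ℝ :=
  partZ q ((5 / 4 : ℝ) • p) * Real.exp (-(5 / 4) * Real.log (partZ q p))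

theorem continuous_partZ (hq : q (Metric.closedBall 0 R)ᶜ = 0) : Continuous (partZ q) :=
  (contDiff_expInt hq continuous_const 0).continuous

theorem continuous_renyi (hq : q (Metric.closedBall 0 R)ᶜ = 0) : Continuous (renyi q) := by
  have h := continuous_partZ hq
  exact (h.comp (by fun_prop)).mul (Real.continuous_exp.comp
    (continuous_const.mul (h.log fun p => (partZ_pos hq p).ne')))

theorem renyi_pos (hq : q (Metric.closedBall 0 R)ᶜ = 0) (p : Vec d × ℝ) : 0 < renyi q p :=
  mul_pos (partZ_pos hq _) (Real.exp_pos _)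

theorem integral_expo_le_log_partZ (hq : q (Metric.closedBall 0 R)ᶜ = 0) (p : Vec d × ℝ) :
    ∫ x, expo x p ∂q ≤ Real.log (partZ q p) := by
  rw [Real.le_log_iff_exp_le (partZ_pos hq p), partZ_eq]
  exact convexOn_exp.map_integral_le Real.continuous_exp.continuousOn isClosed_univ
    (Filter.Eventually.of_forall fun _ => mem_univ _)
    (integrable_of_continuous hq (continuous_expo.clm_apply continuous_const))
    (integrable_exp_expo hq p)

theorem integral_expo (hq : q (Metric.closedBall 0 R)ᶜ = 0) (p : Vec d × ℝ) :
    ∫ x, expo x p ∂q = inner ℝ p.1 (∫ x, x ∂q) - p.2 * (∫ x, ‖x‖ ^ 2 ∂q) / 2 := by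
  have h1 : Integrable (fun x : Vec d => x) q := integrable_of_continuous hq continuous_id
  have h2 : Integrable (fun x : Vec d => ‖x‖ ^ 2) q := integrable_of_continuous hq (by fun_prop)
  simp_rw [expo_apply]
  rw [integral_sub (integrable_of_continuous hq (by fun_prop))
    (integrable_of_continuous hq (by fun_prop)), integral_div, integral_const_mul]
  congr 1
  exact integral_inner h1 p.1

/-- The weight Z turns Z^{-5/4} into Z^{-1/4}. Jensen's inequality log Z ≥ ∫ expo dq bounds this by
the exponential of an affine function of η, so only a Gaussian Laplace transform remains. Neither
the dimension nor the size of η enters the result. -/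
theorem lintegral_renyi_partZ_le (hq : q (Metric.closedBall 0 R)ᶜ = 0) (w : ℝ) :
    ∫⁻ η, ENNReal.ofReal (renyi q (w • η, w ^ 2)) *
      ENNReal.ofReal (partZ q (w • η, w ^ 2)) ∂(stdGaussian (Vec d)) ≤
      ENNReal.ofReal (Real.exp (5 / 8 * (w ^ 2 * R ^ 2))) := by
  set m := ∫ x, x ∂q with hm
  set M := ∫ x, ‖x‖ ^ 2 ∂q with hM
  have hmR : ‖m‖ ≤ R := by
    have h := norm_integral_le_of_norm_le_const (ae_norm_le hq)
    simpa using h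
  have hR : 0 ≤ R := (norm_nonneg _).trans hmR
  have hMR : M ≤ R ^ 2 := by
    have h : M ≤ ∫ _, R ^ 2 ∂q := integral_mono_ae (integrable_of_continuous hq (by fun_prop))
      (integrable_const _) (by
        filter_upwards [ae_norm_le hq] with x hx
        exact pow_le_pow_left₀ (norm_nonneg _) hx 2)
    simpa using h
  have h := lintegral_exp_affine_le hq (c := fun x => (5 / 4 * w) • x - (w / 4) • m)
    (k := fun x => -(5 / 8 * (w ^ 2 * ‖x‖ ^ 2)) + w ^ 2 * M / 8) (by fun_prop) (by fun_prop)
    (B := 5 / 8 * (w ^ 2 * R ^ 2)) (fun x hx => by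
      rw [norm_sub_sq_real, norm_smul, norm_smul, inner_smul_right, inner_smul_left, mul_pow,
        mul_pow, Real.norm_eq_abs, Real.norm_eq_abs, sq_abs, sq_abs]
      simp only [conj_trivial]
      have h1 := neg_le_of_abs_le (abs_real_inner_le_norm x m)
      have h2 : ‖x‖ * ‖m‖ ≤ R ^ 2 := by
        rw [sq]; exact mul_le_mul hx hmR (norm_nonneg _) hR
      have h3 : ‖x‖ ^ 2 ≤ R ^ 2 := pow_le_pow_left₀ (norm_nonneg _) hx 2
      have h4 : ‖m‖ ^ 2 ≤ R ^ 2 := pow_le_pow_left₀ (norm_nonneg _) hmR 2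
      -- The four terms contribute 5/32 + 5/16 + 1/32 + 1/8 = 5/8.
      have h5 : 5 / 32 * ‖x‖ ^ 2 - 5 / 16 * inner ℝ x m + 1 / 32 * ‖m‖ ^ 2 + M / 8
          ≤ 5 / 8 * R ^ 2 := by linarith
      nlinarith [mul_le_mul_of_nonneg_left h5 (sq_nonneg w)])
  refine (lintegral_mono fun η => ?_).trans h
  set p : Vec d × ℝ := (w • η, w ^ 2) with hp
  have hZ := partZ_pos hq p
  rw [← ENNReal.ofReal_mul (renyi_pos hq p).le]
  refine ENNReal.ofReal_le_ofReal ?_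
  have hcomb : renyi q p * partZ q p =
      partZ q ((5 / 4 : ℝ) • p) * Real.exp (-(1 / 4) * Real.log (partZ q p)) := by
    rw [renyi, mul_assoc]
    congr 1
    nth_rewrite 2 [← Real.exp_log hZ]
    rw [← Real.exp_add]
    congr 1; ring
  rw [hcomb]
  have hlog := integral_expo_le_log_partZ hq p
  rw [integral_expo hq] at hlog
  calc _ ≤ partZ q ((5 / 4 : ℝ) • p) *
        Real.exp (-(1 / 4) * (inner ℝ p.1 m - p.2 * M / 2)) := by
        refine mul_le_mul_of_nonneg_left (Real.exp_le_exp.2 ?_) (partZ_pos hq _).le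
        linarith
    _ = _ := by
        rw [partZ_eq, ← integral_mul_const]
        congr 1 with x
        rw [← Real.exp_add, map_smul, expo_apply, hp]
        congr 1
        simp only [inner_smul_left, inner_sub_right, inner_smul_right, conj_trivial, smul_eq_mul]
        ring

theorem setLIntegral_renyi_le (hq : q (Metric.closedBall 0 R)ᶜ = 0) (w : ℝ) {ε : ℝ}
    (hε : 0 < ε) :
    ∫⁻ η in {η | Real.exp (5 / 8 * (w ^ 2 * R ^ 2)) / ε < renyi q (w • η, w ^ 2)},
      ENNReal.ofReal (partZ q (w • η, w ^ 2)) ∂(stdGaussian (Vec d)) ≤ ENNReal.ofReal ε := by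
  set E := Real.exp (5 / 8 * (w ^ 2 * R ^ 2)) with hE
  have hEpos : 0 < E := Real.exp_pos _
  have hZm : Measurable fun η : Vec d => ENNReal.ofReal (partZ q (w • η, w ^ 2)) :=
    ENNReal.measurable_ofReal.comp
      ((continuous_partZ hq).comp (by fun_prop : Continuous fun η : Vec d => (w • η, w ^ 2))).measurable
  have hHm : Measurable fun η : Vec d => renyi q (w • η, w ^ 2) :=
    ((continuous_renyi hq).comp (by fun_prop : Continuous fun η : Vec d => (w • η, w ^ 2))).measurable
  calc _ ≤ ∫⁻ η in {η | E / ε < renyi q (w • η, w ^ 2)}, ENNReal.ofReal (ε / E) *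
        (ENNReal.ofReal (renyi q (w • η, w ^ 2)) *
          ENNReal.ofReal (partZ q (w • η, w ^ 2))) ∂(stdGaussian (Vec d)) := by
        refine setLIntegral_mono_ae ?_ ?_
        · exact (measurable_const.mul (hHm.ennreal_ofReal.mul hZm)).aemeasurable
        · refine Filter.Eventually.of_forall fun η hη => ?_
          rw [← mul_assoc, ← ENNReal.ofReal_mul (by positivity)]
          refine le_mul_of_one_le_left zero_le ?_
          rw [ENNReal.one_le_ofReal, div_mul_eq_mul_div, le_div_iff₀ hEpos, one_mul]
          have := (div_lt_iff₀ hε).1 hη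
          linarith
    _ ≤ ∫⁻ η, ENNReal.ofReal (ε / E) * (ENNReal.ofReal (renyi q (w • η, w ^ 2)) *
          ENNReal.ofReal (partZ q (w • η, w ^ 2))) ∂(stdGaussian (Vec d)) :=
        setLIntegral_le_lintegral _ _
    _ = ENNReal.ofReal (ε / E) * ∫⁻ η, (ENNReal.ofReal (renyi q (w • η, w ^ 2)) *
          ENNReal.ofReal (partZ q (w • η, w ^ 2))) ∂(stdGaussian (Vec d)) :=
        lintegral_const_mul _ (hHm.ennreal_ofReal.mul hZm)
    _ ≤ ENNReal.ofReal (ε / E) * ENNReal.ofReal E := by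
        gcongr
        exact lintegral_renyi_partZ_le hq w
    _ = ENNReal.ofReal ε := by
        rw [← ENNReal.ofReal_mul (by positivity), div_mul_cancel₀ _ hEpos.ne']

/-- Chernoff bound with exponent 1 in the directions ±e_i. The tail e^{-r} is far from Gaussian, but
it only costs log(d/δ₂) in the radius, which the final bound can afford. -/
theorem setLIntegral_coord_le (hq : q (Metric.closedBall 0 R)ᶜ = 0) {w : ℝ} (hw : 0 ≤ w)
    (i : Fin d) (r : ℝ) :
    ∫⁻ η in {η : Vec d | r < |η i|},
      ENNReal.ofReal (partZ q (w • η, w ^ 2)) ∂(stdGaussian (Vec d)) ≤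
        ENNReal.ofReal (2 * Real.exp (1 / 2 + w * R - r)) := by
  set e : Vec d := EuclideanSpace.single i 1 with he
  have hin : ∀ η : Vec d, inner ℝ η e = η i := fun η => by
    rw [he, EuclideanSpace.inner_single_right]; simp
  have hen : ‖e‖ = 1 := by simp [he]
  have hb := lintegral_exp_inner_partZ_le hq hw e
  have hb' := lintegral_exp_inner_partZ_le hq hw (-e)
  rw [norm_neg] at hb'
  simp only [inner_neg_right, hin, hen] at hb hb'
  have hZm : Measurable fun η : Vec d => ENNReal.ofReal (partZ q (w • η, w ^ 2)) :=
    ENNReal.measurable_ofReal.comp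
      ((continuous_partZ hq).comp (by fun_prop : Continuous fun η : Vec d => (w • η, w ^ 2))).measurable
  have hm1 : Measurable fun η : Vec d => ENNReal.ofReal (Real.exp (η i)) := by fun_prop
  have hm2 : Measurable fun η : Vec d => ENNReal.ofReal (Real.exp (-η i)) := by fun_prop
  calc _ ≤ ∫⁻ η in {η : Vec d | r < |η i|}, ENNReal.ofReal (Real.exp (-r)) *
        (ENNReal.ofReal (Real.exp (η i)) * ENNReal.ofReal (partZ q (w • η, w ^ 2)) +
        ENNReal.ofReal (Real.exp (-η i)) * ENNReal.ofReal (partZ q (w • η, w ^ 2)))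
        ∂(stdGaussian (Vec d)) := by
        refine setLIntegral_mono_ae ?_ ?_
        · exact (measurable_const.mul ((hm1.mul hZm).add (hm2.mul hZm))).aemeasurable
        · refine Filter.Eventually.of_forall fun η hη => ?_
          rw [← add_mul, ← mul_assoc]
          refine le_mul_of_one_le_left zero_le ?_
          rw [← ENNReal.ofReal_add (Real.exp_pos _).le (Real.exp_pos _).le,
            ← ENNReal.ofReal_mul (Real.exp_pos _).le, ENNReal.one_le_ofReal, mul_add,
            ← Real.exp_add, ← Real.exp_add]
          have hη' : r < |η i| := hη
          rcases lt_abs.1 hη' with h | h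
          · have h1 : 1 ≤ Real.exp (-r + η i) := Real.one_le_exp (by linarith)
            linarith [Real.exp_pos (-r + -η i)]
          · have h1 : 1 ≤ Real.exp (-r + -η i) := Real.one_le_exp (by linarith)
            linarith [Real.exp_pos (-r + η i)]
    _ ≤ ∫⁻ η, ENNReal.ofReal (Real.exp (-r)) *
        (ENNReal.ofReal (Real.exp (η i)) * ENNReal.ofReal (partZ q (w • η, w ^ 2)) +
        ENNReal.ofReal (Real.exp (-η i)) * ENNReal.ofReal (partZ q (w • η, w ^ 2)))
        ∂(stdGaussian (Vec d)) := setLIntegral_le_lintegral _ _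
    _ ≤ ENNReal.ofReal (Real.exp (-r)) *
        (ENNReal.ofReal (Real.exp (1 ^ 2 / 2 + w * 1 * R)) +
          ENNReal.ofReal (Real.exp (1 ^ 2 / 2 + w * 1 * R))) := by
        have hsum : Measurable fun η : Vec d =>
            ENNReal.ofReal (Real.exp (η i)) * ENNReal.ofReal (partZ q (w • η, w ^ 2)) +
            ENNReal.ofReal (Real.exp (-η i)) * ENNReal.ofReal (partZ q (w • η, w ^ 2)) :=
          (hm1.mul hZm).add (hm2.mul hZm)
        have hm1Z : Measurable fun η : Vec d =>
            ENNReal.ofReal (Real.exp (η i)) * ENNReal.ofReal (partZ q (w • η, w ^ 2)) :=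
          hm1.mul hZm
        rw [lintegral_const_mul _ hsum, lintegral_add_left hm1Z]
        gcongr
    _ = _ := by
        rw [← ENNReal.ofReal_add (Real.exp_pos _).le (Real.exp_pos _).le,
          ← ENNReal.ofReal_mul (Real.exp_pos _).le, ← two_mul, mul_left_comm, ← Real.exp_add]
        congr 3
        ring

theorem partZ_le_exp_mul (hq : q (Metric.closedBall 0 R)ᶜ = 0) {p p' : Vec d × ℝ} {b : ℝ}
    (h : ∀ x, ‖x‖ ≤ R → expo x p' ≤ expo x p + b) :
    partZ q p' ≤ Real.exp b * partZ q p := by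
  rw [partZ_eq, partZ_eq, ← integral_const_mul]
  refine integral_mono_ae (integrable_exp_expo hq _) ((integrable_exp_expo hq _).const_mul _) ?_
  filter_upwards [ae_norm_le hq] with x hx
  rw [← Real.exp_add]
  exact Real.exp_le_exp.2 (by linarith [h x hx])

/-- Both the partition function at 5/4 of the parameter and the power -5/4 of the partition function
move by at most e^{5b/4}. -/
theorem renyi_le_exp_mul (hq : q (Metric.closedBall 0 R)ᶜ = 0) {p p' : Vec d × ℝ} {b : ℝ}
    (h : ∀ x, ‖x‖ ≤ R → |expo x p' - expo x p| ≤ b) :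
    renyi q p' ≤ Real.exp (5 / 2 * b) * renyi q p := by
  have h1 := partZ_le_exp_mul hq (p := (5 / 4 : ℝ) • p) (p' := (5 / 4 : ℝ) • p') (b := 5 / 4 * b)
    (fun x hx => by
      rw [map_smul, map_smul, smul_eq_mul, smul_eq_mul]
      linarith [(abs_le.1 (h x hx)).2])
  have h2 := partZ_le_exp_mul hq (p := p') (p' := p) (b := b)
    (fun x hx => by linarith [(abs_le.1 (h x hx)).1])
  have hlog : Real.log (partZ q p) ≤ b + Real.log (partZ q p') := by
    have := Real.log_le_log (partZ_pos hq p) h2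
    rwa [Real.log_mul (Real.exp_pos _).ne' (partZ_pos hq p').ne', Real.log_exp] at this
  calc renyi q p' ≤ (Real.exp (5 / 4 * b) * partZ q ((5 / 4 : ℝ) • p)) *
        Real.exp (5 / 4 * b + -(5 / 4) * Real.log (partZ q p)) := by
        refine mul_le_mul h1 (Real.exp_le_exp.2 (by linarith)) (Real.exp_pos _).le ?_
        exact mul_nonneg (Real.exp_pos _).le (partZ_pos hq _).le
    _ = _ := by
        rw [renyi, Real.exp_add, show 5 / 2 * b = 5 / 4 * b + 5 / 4 * b by ring, Real.exp_add]
        ring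

/-- The logarithm of the posterior density with respect to `q`. -/
def logPost (q : Measure (Vec d)) (p : Vec d × ℝ) (x : Vec d) : ℝ :=
  expo x p - Real.log (partZ q p)

/-- The posterior measure. -/
def posterior (q : Measure (Vec d)) (p : Vec d × ℝ) : Measure (Vec d) :=
  q.tilted fun x => expo x p

theorem isProbabilityMeasure_posterior (hq : q (Metric.closedBall 0 R)ᶜ = 0) (p : Vec d × ℝ) :
    IsProbabilityMeasure (posterior q p) :=
  isProbabilityMeasure_tilted (integrable_exp_expo hq p)

theorem posterior_compl_eq_zero {q : Measure (Vec d)} (hq : q (Metric.closedBall 0 R)ᶜ = 0) (p : Vec d × ℝ) :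
    posterior q p (Metric.closedBall 0 R)ᶜ = 0 :=
  tilted_absolutelyContinuous q _ hq

theorem integral_posterior {E : Type} [NormedAddCommGroup E] [NormedSpace ℝ E]
    (hq : q (Metric.closedBall 0 R)ᶜ = 0) (p : Vec d × ℝ) (f : Vec d → E) :
    ∫ x, f x ∂(posterior q p) = ∫ x, Real.exp (logPost q p x) • f x ∂q := by
  rw [posterior, integral_tilted]
  congr 1 with x
  rw [logPost, Real.exp_sub, Real.exp_log (partZ_pos hq p), partZ_eq]

theorem continuous_logPost {q : Measure (Vec d)} (p : Vec d × ℝ) : Continuous (logPost q p) :=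
  (continuous_expo.clm_apply continuous_const).sub continuous_const

/-- With ρ the posterior density, ρ e^{|log ρ|/4} equals ρ^{5/4} where ρ ≥ 1, and ρ^{3/4} ≤ 1/4 +
3ρ/4 where ρ ≤ 1. -/
theorem integral_exp_abs_logPost_le (hq : q (Metric.closedBall 0 R)ᶜ = 0) (p : Vec d × ℝ) :
    ∫ x, Real.exp (|logPost q p x| / 4) ∂(posterior q p) ≤ 1 + renyi q p := by
  have hc := continuous_logPost (q := q) p
  have hone : ∫ x, Real.exp (logPost q p x) ∂q = 1 := by
    have := isProbabilityMeasure_posterior hq p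
    have h := integral_posterior hq p (fun _ => (1 : ℝ))
    simpa using h.symm
  have hren : ∫ x, Real.exp (5 / 4 * logPost q p x) ∂q = renyi q p := by
    rw [renyi, partZ_eq, ← integral_mul_const]
    congr 1 with x
    rw [← Real.exp_add, map_smul, logPost, smul_eq_mul]
    congr 1
    ring
  rw [integral_posterior hq]
  have i1 : Integrable (fun x => 1 / 4 + 3 / 4 * Real.exp (logPost q p x)) q :=
    integrable_of_continuous hq (by fun_prop)
  have i2 : Integrable (fun x => Real.exp (5 / 4 * logPost q p x)) q :=
    integrable_of_continuous hq (by fun_prop)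
  calc _ ≤ ∫ x, ((1 / 4 + 3 / 4 * Real.exp (logPost q p x)) +
        Real.exp (5 / 4 * logPost q p x)) ∂q := by
        refine integral_mono (integrable_of_continuous hq (by fun_prop)) (i1.add i2) fun x => ?_
        simp only [smul_eq_mul]
        rw [← Real.exp_add]
        rcases le_total 0 (logPost q p x) with h | h
        · rw [abs_of_nonneg h, show logPost q p x + logPost q p x / 4 = 5 / 4 * logPost q p x by ring]
          have := Real.exp_pos (logPost q p x)
          linarith
        · rw [abs_of_nonpos h]
          have h3 := convexOn_exp.2 (mem_univ 0) (mem_univ (logPost q p x))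
            (by norm_num : (0 : ℝ) ≤ 1 / 4) (by norm_num : (0 : ℝ) ≤ 3 / 4) (by norm_num)
          simp only [smul_eq_mul, mul_zero, zero_add, Real.exp_zero, mul_one] at h3
          rw [show logPost q p x + -logPost q p x / 4 = 3 / 4 * logPost q p x by ring]
          have := Real.exp_pos (5 / 4 * logPost q p x)
          linarith
    _ = 1 + renyi q p := by
        rw [integral_add i1 i2, hren, integral_add (integrable_const _)
          ((integrable_of_continuous hq (by fun_prop)).const_mul _), integral_const_mul, hone]
        simp
        norm_num

end TailBounds

/-! ### The posterior mean at complex parameters and its Picard iteration. -/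

section Complexification

variable {d : ℕ}

/-- The complexification of `Vec d`. -/
abbrev CVec (d : ℕ) : Type := EuclideanSpace ℂ (Fin d)

/-- The inclusion of `Vec d` into its complexification. -/
def cvec : Vec d →L[ℝ] CVec d :=
  LinearMap.toContinuousLinearMap
    { toFun := fun x => WithLp.toLp 2 fun i => (x i : ℂ)
      map_add' := fun x y => by ext i; simp
      map_smul' := fun c x => by ext i; simp }

theorem cvec_apply (x : Vec d) (i : Fin d) : cvec x i = (x i : ℂ) := rfl

theorem norm_cvec (x : Vec d) : ‖cvec x‖ = ‖x‖ := by
  rw [EuclideanSpace.norm_eq, EuclideanSpace.norm_eq]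
  simp [cvec_apply]

theorem inner_cvec (x y : Vec d) : inner ℂ (cvec x) (cvec y) = ((inner ℝ y x : ℝ) : ℂ) := by
  rw [PiLp.inner_apply, PiLp.inner_apply]
  simp [cvec_apply, mul_comm]

/-- The change of the log-likelihood of `x` when the signal strength is multiplied by `1 + z.1` and
the observation is shifted by `z.2`, up to a constant. -/
def cphase (s : ℝ) (γ : Vec d → ℝ) (z : ℂ × CVec d) (x : Vec d) : ℂ :=
  z.1 * γ x + s * (1 + z.1) * (innerSL ℂ (cvec x) z.2 - s * z.1 * (‖x‖ ^ 2 / 2))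

/-- The derivative of `cphase` in its first argument. -/
def cphaseDeriv (s : ℝ) (γ : Vec d → ℝ) (z : ℂ × CVec d) (x : Vec d) : ℂ × CVec d →L[ℂ] ℂ :=
  (γ x + s * (innerSL ℂ (cvec x) z.2 - s * z.1 * (‖x‖ ^ 2 / 2)) -
    s * (1 + z.1) * (s * (‖x‖ ^ 2 / 2))) • ContinuousLinearMap.fst ℂ ℂ (CVec d) +
  (s * (1 + z.1)) • (innerSL ℂ (cvec x)).comp (ContinuousLinearMap.snd ℂ ℂ (CVec d))

theorem hasFDerivAt_cphase (s : ℝ) (γ : Vec d → ℝ) (z : ℂ × CVec d) (x : Vec d) :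
    HasFDerivAt (fun z => cphase s γ z x) (cphaseDeriv s γ z x) z := by
  have h1 : HasFDerivAt (fun z : ℂ × CVec d => z.1) (ContinuousLinearMap.fst ℂ ℂ (CVec d)) z :=
    hasFDerivAt_fst
  have h2 : HasFDerivAt (fun z : ℂ × CVec d => innerSL ℂ (cvec x) z.2)
      ((innerSL ℂ (cvec x)).comp (ContinuousLinearMap.snd ℂ ℂ (CVec d))) z :=
    ((innerSL ℂ (cvec x)).hasFDerivAt).comp z hasFDerivAt_snd
  refine ((h1.mul_const (γ x : ℂ)).add (((h1.const_add 1).const_mul (s : ℂ)).mul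
    (h2.sub ((h1.const_mul (s : ℂ)).mul_const ((‖x‖ : ℂ) ^ 2 / 2))))).congr_fderiv ?_
  refine ContinuousLinearMap.ext fun v => ?_
  simp [cphaseDeriv]
  ring

theorem continuous_innerSL_cvec : Continuous fun x : Vec d => innerSL ℂ (cvec x) :=
  (innerSL ℂ).continuous.comp cvec.continuous

theorem continuous_cphase (s : ℝ) {γ : Vec d → ℝ} (hγ : Continuous γ) :
    Continuous fun y : (ℂ × CVec d) × Vec d => cphase s γ y.1 y.2 := by
  have h : Continuous fun y : (ℂ × CVec d) × Vec d => innerSL ℂ (cvec y.2) y.1.2 :=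
    (continuous_innerSL_cvec.comp continuous_snd).clm_apply (by fun_prop)
  unfold cphase
  fun_prop

theorem continuous_cphaseDeriv (s : ℝ) {γ : Vec d → ℝ} (hγ : Continuous γ) :
    Continuous fun y : (ℂ × CVec d) × Vec d => cphaseDeriv s γ y.1 y.2 := by
  have h0 : Continuous fun y : (ℂ × CVec d) × Vec d => innerSL ℂ (cvec y.2) :=
    continuous_innerSL_cvec.comp continuous_snd
  have h : Continuous fun y : (ℂ × CVec d) × Vec d => innerSL ℂ (cvec y.2) y.1.2 :=
    h0.clm_apply (by fun_prop)
  have h' : Continuous fun y : (ℂ × CVec d) × Vec d =>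
      (innerSL ℂ (cvec y.2)).comp (ContinuousLinearMap.snd ℂ ℂ (CVec d)) :=
    h0.clm_comp continuous_const
  unfold cphaseDeriv
  fun_prop

variable {F : Type} [NormedAddCommGroup F] [NormedSpace ℂ F]

/-- The complexified exponential integral. -/
def cInt (P : Measure (Vec d)) (s : ℝ) (γ : Vec d → ℝ) (g : Vec d → F) (z : ℂ × CVec d) : F :=
  ∫ x, Complex.exp (cphase s γ z x) • g x ∂P

theorem hasFDerivAt_integral_of_continuous {H : Type} [NormedAddCommGroup H] [NormedSpace ℂ H]
    [ProperSpace H] {P : Measure (Vec d)} [IsFiniteMeasure P] {R : ℝ}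
    (hP : P (Metric.closedBall 0 R)ᶜ = 0) {f : H → Vec d → F} {f' : H → Vec d → H →L[ℂ] F}
    (hf : ∀ z, Continuous (f z)) (hf' : Continuous fun y : H × Vec d => f' y.1 y.2)
    (h : ∀ z x, HasFDerivAt (fun z => f z x) (f' z x) z) (z : H) :
    HasFDerivAt (fun z => ∫ x, f z x ∂P) (∫ x, f' z x ∂P) z := by
  let _ : NormedSpace ℝ F := NormedSpace.restrictScalars ℝ ℂ F
  obtain ⟨C, hC⟩ := ((isCompact_closedBall z 1).prod
    (isCompact_closedBall (0 : Vec d) R)).exists_bound_of_continuousOn hf'.continuousOn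
  refine hasFDerivAt_integral_of_dominated_of_fderiv_le (𝕜 := ℂ) (bound := fun _ => C)
    (Metric.ball_mem_nhds z one_pos)
    (Filter.Eventually.of_forall fun z => (hf z).aestronglyMeasurable)
    (integrable_of_continuous hP (hf z))
    (hf'.comp (by fun_prop : Continuous fun x : Vec d => (z, x))).aestronglyMeasurable ?_
    (integrable_const C) (Filter.Eventually.of_forall fun x z' _ => h z' x)
  filter_upwards [ae_norm_le hP] with x hx z' hz'
  exact hC (z', x) ⟨Metric.ball_subset_closedBall hz', by simpa using hx⟩

theorem contDiff_cInt {P : Measure (Vec d)} [IsFiniteMeasure P] {R : ℝ}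
    (hP : P (Metric.closedBall 0 R)ᶜ = 0) (s : ℝ) {γ : Vec d → ℝ} (hγ : Continuous γ)
    {g : Vec d → F} (hg : Continuous g) : ContDiff ℂ 1 (cInt P s γ g) := by
  have hcont : Continuous fun y : (ℂ × CVec d) × Vec d => Complex.exp (cphase s γ y.1 y.2) •
      (cphaseDeriv s γ y.1 y.2).smulRight (g y.2) := by
    have h1 : Continuous fun y : (ℂ × CVec d) × Vec d =>
        (ContinuousLinearMap.smulRightL ℂ (ℂ × CVec d) F (cphaseDeriv s γ y.1 y.2)) (g y.2) :=
      ((ContinuousLinearMap.smulRightL ℂ (ℂ × CVec d) F).continuous.comp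
        (continuous_cphaseDeriv s hγ)).clm_apply (hg.comp continuous_snd)
    exact (Complex.continuous_exp.comp (continuous_cphase s hγ)).smul h1
  rw [contDiff_one_iff_hasFDerivAt]
  refine ⟨fun z => ∫ x, Complex.exp (cphase s γ z x) •
    (cphaseDeriv s γ z x).smulRight (g x) ∂P, ?_, fun z =>
    hasFDerivAt_integral_of_continuous (f := fun z x => Complex.exp (cphase s γ z x) • g x)
      (f' := fun z x => Complex.exp (cphase s γ z x) • (cphaseDeriv s γ z x).smulRight (g x))
      hP (fun z => ?_) hcont (fun z x => ?_) z⟩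
  -- Replacing `P` by its restriction to the ball makes the parametric integral one over a compact
  -- set.
  · have hres : P = P.restrict (Metric.closedBall 0 R) :=
      (Measure.restrict_eq_self_of_ae_mem (by exact hP)).symm
    rw [hres]
    exact continuous_parametric_integral_of_continuous hcont (isCompact_closedBall _ _)
  · exact (Complex.continuous_exp.comp ((continuous_cphase s hγ).comp
      (by fun_prop : Continuous fun x : Vec d => (z, x)))).smul hg
  · refine ((hasFDerivAt_cphase s γ z x).cexp.smul_const (g x)).congr_fderiv ?_
    ext v <;> simp [mul_smul]

/-- Here 7/2 = 3 + 1/2: the shift, of size at most 3Rsκ₀ and paired with ‖x‖ ≤ R, gives 3, and the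
quadratic term gives 1/2. -/
theorem norm_cphase_le {s κ₀ R : ℝ} (hs : 0 ≤ s) (γ : Vec d → ℝ)
    {z : ℂ × CVec d} (hz1 : ‖z.1‖ ≤ κ₀) (hz2 : ‖z.2‖ ≤ 3 * R * (s * κ₀)) {x : Vec d}
    (hx : ‖x‖ ≤ R) :
    ‖cphase s γ z x‖ ≤ κ₀ * (|γ x| + 7 / 2 * (1 + κ₀) * (s ^ 2 * R ^ 2)) := by
  have hκ : 0 ≤ κ₀ := (norm_nonneg _).trans hz1
  have hR : 0 ≤ R := (norm_nonneg _).trans hx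
  have h1 : ‖z.1 * (γ x : ℂ)‖ ≤ κ₀ * |γ x| := by
    rw [norm_mul, Complex.norm_real, Real.norm_eq_abs]
    gcongr
  have h2 : ‖innerSL ℂ (cvec x) z.2‖ ≤ R * (3 * R * (s * κ₀)) := by
    refine ((innerSL ℂ (cvec x)).le_opNorm _).trans ?_
    rw [innerSL_apply_norm, norm_cvec]
    gcongr
  have h3 : ‖(s : ℂ) * z.1 * ((‖x‖ : ℂ) ^ 2 / 2)‖ ≤ s * κ₀ * (R ^ 2 / 2) := by
    rw [norm_mul, norm_mul, Complex.norm_real, Real.norm_of_nonneg hs, norm_div, norm_pow,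
      Complex.norm_real, norm_norm]
    simp only [Complex.norm_ofNat]
    gcongr
  have h4 : ‖(s : ℂ) * (1 + z.1)‖ ≤ s * (1 + κ₀) := by
    rw [norm_mul, Complex.norm_real, Real.norm_of_nonneg hs]
    gcongr
    refine (norm_add_le _ _).trans ?_
    rw [norm_one]
    gcongr
  calc ‖cphase s γ z x‖ ≤ κ₀ * |γ x| + s * (1 + κ₀) *
        (R * (3 * R * (s * κ₀)) + s * κ₀ * (R ^ 2 / 2)) := by
        refine (norm_add_le _ _).trans (add_le_add h1 ?_)
        rw [norm_mul]
        refine mul_le_mul h4 ((norm_sub_le _ _).trans (add_le_add h2 h3)) (norm_nonneg _) ?_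
        positivity
    _ = _ := by ring

/-- This is E X^{4κ₀} ≤ (E X)^{4κ₀} for X = e^{|γ|/4}, obtained pointwise from convexity of exp with
weights 1 - 4κ₀ and 4κ₀. -/
theorem integral_exp_mul_abs_le {P : Measure (Vec d)} [IsProbabilityMeasure P] {R κ₀ Λ : ℝ}
    (hP : P (Metric.closedBall 0 R)ᶜ = 0) {γ : Vec d → ℝ} (hγ : Continuous γ) (hκ : 0 ≤ κ₀)
    (hκ1 : κ₀ ≤ 1 / 4) (hΛ : ∫ x, Real.exp (|γ x| / 4) ∂P ≤ Real.exp (Λ / 4)) :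
    ∫ x, Real.exp (κ₀ * |γ x|) ∂P ≤ Real.exp (κ₀ * Λ) := by
  have hpt : ∀ x, Real.exp (κ₀ * |γ x|) ≤ Real.exp (κ₀ * Λ) *
      ((1 - 4 * κ₀) + 4 * κ₀ * Real.exp (-(Λ / 4)) * Real.exp (|γ x| / 4)) := by
    intro x
    have h3 := convexOn_exp.2 (mem_univ 0) (mem_univ (|γ x| / 4 - Λ / 4))
            (by linarith : (0 : ℝ) ≤ 1 - 4 * κ₀) (by linarith : (0 : ℝ) ≤ 4 * κ₀) (by ring)
    simp only [smul_eq_mul, mul_zero, zero_add, Real.exp_zero, mul_one] at h3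
    calc Real.exp (κ₀ * |γ x|) = Real.exp (κ₀ * Λ) * Real.exp (4 * κ₀ * (|γ x| / 4 - Λ / 4)) := by
          rw [← Real.exp_add]; congr 1; ring
      _ ≤ _ := by
          refine mul_le_mul_of_nonneg_left (h3.trans (le_of_eq ?_)) (Real.exp_pos _).le
          rw [mul_assoc (4 * κ₀), ← Real.exp_add]
          congr 3
          ring
  have hi : Integrable (fun x => Real.exp (|γ x| / 4)) P :=
    integrable_of_continuous hP (by fun_prop)
  calc _ ≤ ∫ x, Real.exp (κ₀ * Λ) *
      ((1 - 4 * κ₀) + 4 * κ₀ * Real.exp (-(Λ / 4)) * Real.exp (|γ x| / 4)) ∂P :=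
        integral_mono (integrable_of_continuous hP (by fun_prop))
          (integrable_of_continuous hP (by fun_prop)) hpt
    _ = Real.exp (κ₀ * Λ) * ((1 - 4 * κ₀) + 4 * κ₀ * Real.exp (-(Λ / 4)) *
          ∫ x, Real.exp (|γ x| / 4) ∂P) := by
        rw [integral_const_mul, integral_add (integrable_const _) (hi.const_mul _),
          integral_const_mul]
        simp
    _ ≤ Real.exp (κ₀ * Λ) * ((1 - 4 * κ₀) + 4 * κ₀ * Real.exp (-(Λ / 4)) *
          Real.exp (Λ / 4)) := by gcongr
    _ = _ := by
        rw [mul_assoc (4 * κ₀), ← Real.exp_add]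
        simp

/-- Explains the budget 2/5 in `CBound.small`: the complex partition function stays within e^{2/5} -
1 ≤ 1/2 of 1. -/
theorem exp_two_fifths_le : Real.exp (2 / 5) ≤ 3 / 2 := by
  have h := Real.exp_bound' (x := 2 / 5) (by norm_num) (by norm_num) (n := 4) (by norm_num)
  refine h.trans ?_
  norm_num [Finset.sum_range_succ, Nat.factorial]

/-- A quantitative hypothesis under which the complexified posterior mean is controlled on the
polydisc of radii `κ₀` and `3 R s κ₀`. -/
structure CBound (P : Measure (Vec d)) (s : ℝ) (γ : Vec d → ℝ) (R κ₀ Λ : ℝ) : Prop where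
  supp : P (Metric.closedBall 0 R)ᶜ = 0
  cont : Continuous γ
  s_nonneg : 0 ≤ s
  pos : 0 < κ₀
  le_quarter : κ₀ ≤ 1 / 4
  moment : ∫ x, Real.exp (|γ x| / 4) ∂P ≤ Real.exp (Λ / 4)
  small : κ₀ * (Λ + 7 / 2 * (1 + κ₀) * (s ^ 2 * R ^ 2)) ≤ 2 / 5

variable {P : Measure (Vec d)} [IsProbabilityMeasure P] {s R κ₀ Λ : ℝ} {γ : Vec d → ℝ}

theorem CBound.integral_exp_norm_le (h : CBound P s γ R κ₀ Λ)
    {z : ℂ × CVec d} (hz1 : ‖z.1‖ ≤ κ₀) (hz2 : ‖z.2‖ ≤ 3 * R * (s * κ₀)) :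
    ∫ x, Real.exp ‖cphase s γ z x‖ ∂P ≤ 3 / 2 := by
  have hc : Continuous fun x => cphase s γ z x :=
    (continuous_cphase s h.cont).comp (by fun_prop : Continuous fun x : Vec d => (z, x))
  have hcont := h.cont
  calc ∫ x, Real.exp ‖cphase s γ z x‖ ∂P
      ≤ ∫ x, Real.exp (κ₀ * |γ x|) * Real.exp (κ₀ * (7 / 2 * (1 + κ₀) * (s ^ 2 * R ^ 2))) ∂P := by
        refine integral_mono_ae (integrable_of_continuous h.supp (by fun_prop))
          (integrable_of_continuous h.supp (by fun_prop)) ?_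
        filter_upwards [ae_norm_le h.supp] with x hx
        rw [← Real.exp_add, ← mul_add]
        exact Real.exp_le_exp.2 (norm_cphase_le h.s_nonneg γ hz1 hz2 hx)
    _ ≤ Real.exp (κ₀ * Λ) * Real.exp (κ₀ * (7 / 2 * (1 + κ₀) * (s ^ 2 * R ^ 2))) := by
        rw [integral_mul_const]
        gcongr
        exact integral_exp_mul_abs_le h.supp h.cont h.pos.le h.le_quarter h.moment
    _ ≤ Real.exp (2 / 5) := by
        rw [← Real.exp_add, ← mul_add]
        exact Real.exp_le_exp.2 h.small
    _ ≤ 3 / 2 := exp_two_fifths_le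

theorem norm_exp_sub_one_le' (z : ℂ) : ‖Complex.exp z - 1‖ ≤ Real.exp ‖z‖ - 1 := by
  simpa using Complex.norm_exp_sub_sum_le_exp_norm_sub_sum z 1

/-- The complexified posterior mean. -/
def cMean (P : Measure (Vec d)) (s : ℝ) (γ : Vec d → ℝ) (z : ℂ × CVec d) : CVec d :=
  (cInt P s γ (fun _ => (1 : ℂ)) z)⁻¹ • cInt P s γ (fun x => cvec x) z

theorem CBound.half_le_norm_cInt (h : CBound P s γ R κ₀ Λ)
    {z : ℂ × CVec d} (hz1 : ‖z.1‖ ≤ κ₀) (hz2 : ‖z.2‖ ≤ 3 * R * (s * κ₀)) :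
    1 / 2 ≤ ‖cInt P s γ (fun _ => (1 : ℂ)) z‖ := by
  have hc : Continuous fun x => cphase s γ z x :=
    (continuous_cphase s h.cont).comp (by fun_prop : Continuous fun x : Vec d => (z, x))
  have h1 : cInt P s γ (fun _ => (1 : ℂ)) z - 1 = ∫ x, (Complex.exp (cphase s γ z x) - 1) ∂P := by
    rw [integral_sub (integrable_of_continuous h.supp (by fun_prop)) (integrable_const _), cInt]
    simp
  have h2 : ‖cInt P s γ (fun _ => (1 : ℂ)) z - 1‖ ≤ 1 / 2 := by
    rw [h1]
    calc _ ≤ ∫ x, (Real.exp ‖cphase s γ z x‖ - 1) ∂P :=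
          norm_integral_le_of_norm_le (integrable_of_continuous h.supp (by fun_prop))
            (Filter.Eventually.of_forall fun x => norm_exp_sub_one_le' _)
      _ = ∫ x, Real.exp ‖cphase s γ z x‖ ∂P - 1 := by
          rw [integral_sub (integrable_of_continuous h.supp (by fun_prop)) (integrable_const _)]
          simp
      _ ≤ 1 / 2 := by linarith [h.integral_exp_norm_le hz1 hz2]
  have h3 := norm_sub_norm_le (1 : ℂ) (cInt P s γ (fun _ => (1 : ℂ)) z)
  rw [norm_one, norm_sub_rev] at h3
  linarith

/-- A numerator of at most 3R/2 over a denominator of at least 1/2. The same 3R sets the shift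
radius 3Rsκ₀, which makes the Picard iteration preserve the polydisc. -/
theorem CBound.norm_cMean_le (h : CBound P s γ R κ₀ Λ)
    {z : ℂ × CVec d} (hz1 : ‖z.1‖ ≤ κ₀) (hz2 : ‖z.2‖ ≤ 3 * R * (s * κ₀)) (hR : 0 ≤ R) :
    ‖cMean P s γ z‖ ≤ 3 * R := by
  have hc : Continuous fun x => cphase s γ z x :=
    (continuous_cphase s h.cont).comp (by fun_prop : Continuous fun x : Vec d => (z, x))
  have hZ := h.half_le_norm_cInt hz1 hz2
  have hN : ‖cInt P s γ (fun x => cvec x) z‖ ≤ R * (3 / 2) := by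
    calc _ ≤ ∫ x, R * Real.exp ‖cphase s γ z x‖ ∂P := by
          refine norm_integral_le_of_norm_le (integrable_of_continuous h.supp (by fun_prop)) ?_
          filter_upwards [ae_norm_le h.supp] with x hx
          rw [norm_smul, norm_cvec, mul_comm]
          exact mul_le_mul hx (Complex.norm_exp_le_exp_norm _) (norm_nonneg _) hR
      _ ≤ R * (3 / 2) := by
          rw [integral_const_mul]
          exact mul_le_mul_of_nonneg_left (h.integral_exp_norm_le hz1 hz2) hR
  rw [cMean, norm_smul, norm_inv, inv_mul_le_iff₀ (by linarith)]
  nlinarith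

theorem CBound.exists_lipschitz (h : CBound P s γ R κ₀ Λ) :
    ∃ K : ℝ, 0 ≤ K ∧ ∀ κ : ℂ, ‖κ‖ ≤ κ₀ → ∀ v v' : CVec d, ‖v‖ ≤ 3 * R * (s * κ₀) →
      ‖v'‖ ≤ 3 * R * (s * κ₀) → ‖cMean P s γ (κ, v) - cMean P s γ (κ, v')‖ ≤ K * ‖v - v'‖ := by
  set S : Set (ℂ × CVec d) :=
    Metric.closedBall 0 κ₀ ×ˢ Metric.closedBall 0 (3 * R * (s * κ₀)) with hS
  have hC : ContDiffOn ℂ 1 (cMean P s γ) S := by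
    have hZ : ContDiffOn ℂ 1 (cInt P s γ (fun _ => (1 : ℂ))) S :=
      (contDiff_cInt h.supp s h.cont continuous_const).contDiffOn
    have hN : ContDiffOn ℂ 1 (cInt P s γ (fun x => cvec x)) S :=
      (contDiff_cInt h.supp s h.cont cvec.continuous).contDiffOn
    refine (hZ.inv fun z hz => ?_).smul hN
    have := h.half_le_norm_cInt (by simpa using hz.1) (by simpa using hz.2)
    exact norm_pos_iff.1 (by linarith)
  obtain ⟨K, hK⟩ := (hC.restrict_scalars ℝ).exists_lipschitzOnWith one_ne_zero
    ((convex_closedBall _ _).prod (convex_closedBall _ _))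
    ((isCompact_closedBall _ _).prod (isCompact_closedBall _ _))
  refine ⟨K, K.2, fun κ hκ v v' hv hv' => ?_⟩
  have := hK.dist_le_mul (κ, v) ⟨by simpa using hκ, by simpa using hv⟩
    (κ, v') ⟨by simpa using hκ, by simpa using hv'⟩
  rwa [dist_eq_norm, dist_prod_same_left, dist_eq_norm] at this

/-- Picard iterates of the complexified flow approximate a solution to any order. -/
theorem CBound.exists_holomorphic_approx (h : CBound P s γ R κ₀ Λ) (hR : 0 ≤ R)
    {S : Set ℝ} (hS : Convex ℝ S) {t₀ : ℝ} (ht₀ : t₀ ∈ S) {κ : ℝ → ℝ} {κ' : ℝ → ℝ}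
    {V : ℝ → CVec d} {K₁ : ℝ} (hK₁ : 0 ≤ K₁)
    (hκ : ∀ t ∈ S, HasDerivWithinAt κ (κ' t) S t) (hκ0 : κ t₀ = 0)
    (hκ1 : ∀ t ∈ S, |κ t| < κ₀) (hκ' : ∀ t ∈ S, |κ' t| ≤ K₁)
    (hV : ∀ t ∈ S, HasDerivWithinAt V ((κ' t : ℂ) • (s : ℂ) • cMean P s γ (κ t, V t)) S t)
    (hV0 : V t₀ = 0) (hV1 : ∀ t ∈ S, ‖V t‖ ≤ 3 * R * (s * κ₀)) (n : ℕ) :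
    ∃ U : ℂ → CVec d, DifferentiableOn ℂ U (Metric.ball 0 κ₀) ∧
      (∀ z ∈ Metric.ball (0 : ℂ) κ₀, ‖U z‖ ≤ 3 * R * (s * κ₀)) ∧
      ∃ C : ℝ, 0 ≤ C ∧ ∀ t ∈ S, ‖U (κ t) - V t‖ ≤ C * |t - t₀| ^ n := by
  have hs := h.s_nonneg
  have hκ₀ := h.pos
  obtain ⟨K, hK, hLip⟩ := h.exists_lipschitz
  induction n with
  | zero =>
    refine ⟨fun _ => 0, differentiableOn_const _, fun z _ => by simp; positivity,
      3 * R * (s * κ₀), by positivity, fun t ht => ?_⟩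
    simpa using hV1 t ht
  | succ n ih =>
    obtain ⟨U, hU, hUb, C, hC, hUV⟩ := ih
    have hMd : DifferentiableOn ℂ (fun z => (s : ℂ) • cMean P s γ (z, U z))
        (Metric.ball 0 κ₀) := by
      have hp : DifferentiableOn ℂ (fun z => (z, U z)) (Metric.ball 0 κ₀) :=
        differentiableOn_id.prodMk hU
      have hZ : DifferentiableOn ℂ (fun z => cInt P s γ (fun _ => (1 : ℂ)) (z, U z))
          (Metric.ball 0 κ₀) :=
        ((contDiff_cInt h.supp s h.cont continuous_const).differentiable
          one_ne_zero).comp_differentiableOn hp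
      have hN : DifferentiableOn ℂ (fun z => cInt P s γ (fun x => cvec x) (z, U z))
          (Metric.ball 0 κ₀) :=
        ((contDiff_cInt h.supp s h.cont cvec.continuous).differentiable
          one_ne_zero).comp_differentiableOn hp
      refine ((hZ.fun_inv fun z hz => ?_).fun_smul hN).fun_const_smul (s : ℂ)
      have := h.half_le_norm_cInt (z := (z, U z)) (mem_ball_zero_iff.1 hz).le (hUb z hz)
      exact norm_pos_iff.1 (by linarith)
    -- The next Picard iterate is the holomorphic primitive on the disc that vanishes at 0.
    obtain ⟨W, hW0, hW⟩ := hMd.isExactOn_ball.with_val_at 0 0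
    refine ⟨W, fun z hz => (hW z hz).differentiableAt.differentiableWithinAt, fun z hz => ?_,
      K₁ * (s * (K * C)), by positivity, fun t ht => ?_⟩
    · have h1 := (convex_ball (0 : ℂ) κ₀).norm_image_sub_le_of_norm_hasDerivWithin_le
        (C := s * (3 * R)) (fun z hz => (hW z hz).hasDerivWithinAt) (fun z hz => by
          rw [norm_smul, Complex.norm_real, Real.norm_of_nonneg hs]
          exact mul_le_mul_of_nonneg_left (h.norm_cMean_le (mem_ball_zero_iff.1 hz).le (hUb z hz) hR) hs)
        (Metric.mem_ball_self hκ₀) hz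
      rw [hW0, sub_zero, sub_zero] at h1
      have hz' : ‖z‖ ≤ κ₀ := by simpa using (Metric.mem_ball.1 hz).le
      calc ‖W z‖ ≤ s * (3 * R) * ‖z‖ := h1
        _ ≤ s * (3 * R) * κ₀ := by gcongr
        _ = _ := by ring
    -- Between `t₀` and `t` the previous error is at most C|t - t₀|^n; the mean value inequality
    -- there gains one more power.
    · set I := S ∩ uIcc t₀ t with hI
      have hIc : Convex ℝ I := hS.inter (convex_uIcc t₀ t)
      have hD : ∀ r ∈ I, HasDerivWithinAt (fun r => W (κ r) - V r)
          ((κ' r : ℂ) • ((s : ℂ) • cMean P s γ (κ r, U (κ r))) -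
            (κ' r : ℂ) • (s : ℂ) • cMean P s γ (κ r, V r)) I r := by
        intro r hr
        have hb : (κ r : ℂ) ∈ Metric.ball (0 : ℂ) κ₀ := by
          simpa using hκ1 r hr.1
        have hκr : HasDerivWithinAt (fun r => (κ r : ℂ)) (κ' r : ℂ) I r :=
          ((hκ r hr.1).ofReal_comp).mono inter_subset_left
        exact ((hW _ hb).scomp_hasDerivWithinAt r hκr).sub ((hV r hr.1).mono inter_subset_left)
      have hbound := hIc.norm_image_sub_le_of_norm_hasDerivWithin_le
        (C := K₁ * (s * (K * (C * |t - t₀| ^ n)))) hD (fun r hr => by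
          rw [← smul_sub, ← smul_sub, norm_smul, norm_smul, Complex.norm_real, Complex.norm_real,
            Real.norm_of_nonneg hs, Real.norm_eq_abs]
          have hb : (κ r : ℂ) ∈ Metric.ball (0 : ℂ) κ₀ := by
            simpa using hκ1 r hr.1
          have h1 := hLip (κ r) (by simpa using (hκ1 r hr.1).le) (U (κ r)) (V r) (hUb _ hb)
            (hV1 r hr.1)
          have h2 : |r - t₀| ≤ |t - t₀| := by
            have := abs_sub_left_of_mem_uIcc hr.2
            exact this
          have h3 : ‖U (κ r) - V r‖ ≤ C * |t - t₀| ^ n := by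
            refine (hUV r hr.1).trans ?_
            gcongr
          have := hκ' r hr.1
          calc _ ≤ K₁ * (s * (K * ‖U (κ r) - V r‖)) := by gcongr
            _ ≤ _ := by gcongr)
        ⟨ht₀, left_mem_uIcc⟩ ⟨ht, right_mem_uIcc⟩
      rw [hκ0, hV0, Complex.ofReal_zero, hW0, sub_zero, sub_zero] at hbound
      rw [Real.norm_eq_abs] at hbound
      calc _ ≤ _ := hbound
        _ = _ := by ring

end Complexification

/-! ### Reading derivatives off a holomorphic function that agrees to high order. -/

section HolomorphicJets

open Asymptotics

/-- By strong induction the Taylor polynomial of order m reduces to its top term. That term must be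
o((t - t₀)^m), so its coefficient vanishes. -/
theorem iteratedDerivWithin_eq_zero_of_isBigO {E : Type} [NormedAddCommGroup E] [NormedSpace ℝ E]
    {f : ℝ → E} {S : Set ℝ} (hS : Convex ℝ S) (hu : UniqueDiffOn ℝ S) {t₀ : ℝ} (ht₀ : t₀ ∈ S)
    {n : ℕ} (hf : ContDiffOn ℝ n f S)
    (hO : f =O[𝓝[S] t₀] fun t => (t - t₀) ^ (n + 1)) {m : ℕ} (hm : m ≤ n) :
    iteratedDerivWithin m f S t₀ = 0 := by
  have htend : Filter.Tendsto (fun t : ℝ => t - t₀) (𝓝[S] t₀) (𝓝 0) := by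
    have : ContinuousWithinAt (fun t : ℝ => t - t₀) S t₀ := by fun_prop
    simpa [ContinuousWithinAt] using this
  induction m using Nat.strong_induction_on with
  | _ m ih =>
    have h1 := taylor_isLittleO hS ht₀ (hf.of_le (by exact_mod_cast hm))
    have h2 : ∀ t, taylorWithinEval f m S t₀ t =
        (((m.factorial : ℝ))⁻¹ * (t - t₀) ^ m) • iteratedDerivWithin m f S t₀ := by
      intro t
      rw [taylor_within_apply, Finset.sum_range_succ, Finset.sum_eq_zero, zero_add]
      intro j hj
      rw [ih j (Finset.mem_range.1 hj) ((Finset.mem_range.1 hj).le.trans hm), smul_zero]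
    have h3 : f =o[𝓝[S] t₀] fun t => (t - t₀) ^ m := by
      refine hO.trans_isLittleO ?_
      have h4 : (fun t : ℝ => (t - t₀) ^ (n + 1 - m) * (t - t₀) ^ m) =o[𝓝[S] t₀]
          fun t => 1 * (t - t₀) ^ m := by
        refine IsLittleO.mul_isBigO ?_ (isBigO_refl _ _)
        rw [isLittleO_one_iff]
        simpa [Nat.sub_ne_zero_of_lt (Nat.lt_succ_of_le hm)] using htend.pow (n + 1 - m)
      simpa [← pow_add, Nat.sub_add_cancel (Nat.le_succ_of_le hm)] using h4
    have h5 : (fun t => (((m.factorial : ℝ))⁻¹ * (t - t₀) ^ m) • iteratedDerivWithin m f S t₀)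
        =o[𝓝[S] t₀] fun t => (t - t₀) ^ m := by
      simpa [h2] using h3.sub h1
    by_contra hne
    have hc : 0 < (m.factorial : ℝ)⁻¹ * ‖iteratedDerivWithin m f S t₀‖ := by
      have := norm_pos_iff.2 hne
      positivity
    have h6 := h5.def (half_pos hc)
    have h7 : (𝓝[S \ {t₀}] t₀).NeBot := by
      have := (hu t₀ ht₀).accPt
      rw [accPt_principal_iff_nhdsWithin] at this
      exact this
    have h8 := h6.filter_mono (nhdsWithin_mono t₀ (sdiff_subset : S \ {t₀} ⊆ S))
    obtain ⟨t, ht, ht'⟩ := (h8.and self_mem_nhdsWithin).exists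
    have hpos : 0 < ‖(t - t₀) ^ m‖ := by
      rw [norm_pos_iff]
      exact pow_ne_zero _ (sub_ne_zero.2 ht'.2)
    rw [norm_smul, norm_mul, norm_inv, Real.norm_natCast] at ht
    nlinarith [mul_pos hc hpos]

theorem iteratedDerivWithin_comp_ofReal {H : ℂ → ℂ} {S : Set ℝ} (hu : UniqueDiffOn ℝ S)
    {U : Set ℂ} (hU : IsOpen U) (hSU : ∀ t ∈ S, (t : ℂ) ∈ U) (hH : DifferentiableOn ℂ H U)
    (n : ℕ) {t : ℝ} (ht : t ∈ S) :
    iteratedDerivWithin n (fun t : ℝ => H t) S t = iteratedDeriv n H t := by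
  induction n generalizing t with
  | zero => simp
  | succ n ih =>
    rw [iteratedDerivWithin_succ, derivWithin_congr (fun t ht => ih ht) (ih ht)]
    have h2 : DifferentiableAt ℂ (iteratedDeriv n H) t := by
      rw [iteratedDeriv_eq_iterate]
      exact ((hH.analyticAt (hU.mem_nhds (hSU t ht))).iterated_deriv n).differentiableAt
    rw [iteratedDeriv_succ]
    exact (h2.hasDerivAt.comp_ofReal.hasDerivWithinAt).derivWithin (hu t ht)

/-- Makes an approximate holomorphic extension as good as an exact one for a single derivative:
agreement to order n + 1 at the base point suffices. -/
theorem iteratedDerivWithin_eq_iteratedDeriv_of_isBigO {f : ℝ → ℂ} {H : ℂ → ℂ} {S : Set ℝ}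
    (hS : Convex ℝ S) (hu : UniqueDiffOn ℝ S) {t₀ : ℝ} (ht₀ : t₀ ∈ S) {r : ℝ} (hr : 0 < r)
    (hH : DifferentiableOn ℂ H (Metric.ball (t₀ : ℂ) r)) {n : ℕ} (hf : ContDiffOn ℝ n f S)
    (hO : (fun t : ℝ => f t - H t) =O[𝓝[S] t₀] fun t => (t - t₀) ^ (n + 1)) :
    iteratedDerivWithin n f S t₀ = iteratedDeriv n H t₀ := by
  set S' := S ∩ Metric.ball t₀ r with hS'
  have hu' : UniqueDiffOn ℝ S' := hu.inter Metric.isOpen_ball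
  have ht₀' : t₀ ∈ S' := ⟨ht₀, Metric.mem_ball_self hr⟩
  have hmem : ∀ t ∈ S', (t : ℂ) ∈ Metric.ball (t₀ : ℂ) r := by
    intro t ht
    rw [Metric.mem_ball, Complex.dist_eq, ← Complex.ofReal_sub, Complex.norm_real]
    exact ht.2
  have h1 := iteratedDerivWithin_comp_ofReal hu' Metric.isOpen_ball hmem hH n ht₀'
  have hHc : ContDiffOn ℝ n (fun t : ℝ => H t) S' :=
    ((hH.contDiffOn Metric.isOpen_ball (n := n)).restrict_scalars ℝ).comp
      Complex.ofRealCLM.contDiff.contDiffOn hmem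
  have hf' := hf.mono (inter_subset_left : S' ⊆ S)
  have h2 : iteratedDerivWithin n (f - fun t : ℝ => H t) S' t₀ = 0 :=
    iteratedDerivWithin_eq_zero_of_isBigO (hS.inter (convex_ball t₀ r)) hu' ht₀' (hf'.sub hHc)
      (hO.mono (nhdsWithin_mono t₀ inter_subset_left)) le_rfl
  rw [iteratedDerivWithin_sub ht₀' hu' (hf' t₀ ht₀') (hHc t₀ ht₀'), h1, sub_eq_zero] at h2
  rw [← h2, iteratedDerivWithin, iteratedDerivWithin, hS',
    iteratedFDerivWithin_inter_open Metric.isOpen_ball (Metric.mem_ball_self hr)]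

theorem ContinuousLinearMap.iteratedDerivWithin_comp_left' {E F : Type} [NormedAddCommGroup E]
    [NormedSpace ℝ E] [NormedAddCommGroup F] [NormedSpace ℝ F] (L : E →L[ℝ] F) {f : ℝ → E}
    {S : Set ℝ} (hu : UniqueDiffOn ℝ S) {n : ℕ} (hf : ContDiffOn ℝ n f S) {t : ℝ} (ht : t ∈ S) :
    iteratedDerivWithin n (fun t => L (f t)) S t = L (iteratedDerivWithin n f S t) := by
  have h := L.iteratedFDerivWithin_comp_left (hf t ht) hu ht le_rfl
  simp only [iteratedDerivWithin]
  change iteratedFDerivWithin ℝ n (L ∘ f) S t _ = _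
  rw [h]
  rfl

end HolomorphicJets

/-! ### The noise schedule at complex times near the window. -/

section ComplexTime

/-- The noise schedule at complex times. -/
def csigma (T : ℝ) (z : ℂ) : ℂ := (1 - Complex.exp (-(T - z)) ^ 2) ^ (((1 / 2 : ℝ)) : ℂ)

theorem norm_csigma_sq (T : ℝ) (z : ℂ) :
    ‖csigma T z‖ ^ 2 = ‖1 - Complex.exp (-(T - z)) ^ 2‖ := by
  rw [csigma, Complex.norm_cpow_real, ← Real.sqrt_eq_rpow, Real.sq_sqrt (norm_nonneg _)]

theorem csigma_sq (T : ℝ) (z : ℂ) : csigma T z ^ 2 = 1 - Complex.exp (-(T - z)) ^ 2 := by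
  rw [csigma, ← Complex.cpow_nat_mul]
  norm_num

theorem csigma_ofReal {T t : ℝ} (ht : t < T) : csigma T t = sigma T t := by
  have h := sigma_radicand_pos ht
  rw [csigma, sigma, Real.sqrt_eq_rpow, Complex.ofReal_cpow h.le, exp_two_mul_sub]
  push_cast
  rfl

variable {T t : ℝ}

theorem norm_exp_sub_le {ρ : ℝ} {z : ℂ} (hz : ‖z - t‖ ≤ ρ) :
    ‖Complex.exp (-(T - z))‖ ≤ Real.exp (-(T - t)) * Real.exp ρ := by
  rw [Complex.norm_exp, ← Real.exp_add]
  refine Real.exp_le_exp.2 ?_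
  have h := (Complex.abs_re_le_norm (z - t)).trans hz
  have := (abs_le.1 h).2
  simp at this ⊢
  linarith

theorem norm_exp_sq_lt_one (ht : t ≤ T - 1) {z : ℂ} (hz : ‖z - t‖ < 1) :
    ‖Complex.exp (-(T - z)) ^ 2‖ < 1 := by
  rw [norm_pow, Complex.norm_exp]
  have h := (Complex.abs_re_le_norm (z - t)).trans_lt hz
  have := (abs_lt.1 h).2
  have h2 : (-((T : ℂ) - z)).re < 0 := by
    simp at this ⊢
    linarith
  exact pow_lt_one₀ (Real.exp_pos _).le (by simpa using h2) two_ne_zero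

/-- At distance less than 1 from t ≤ T - 1 the real part of z stays below T, so the radicand has
positive real part and the principal root is holomorphic. -/
theorem mem_slitPlane_radicand (ht : t ≤ T - 1) {z : ℂ} (hz : ‖z - t‖ < 1) :
    1 - Complex.exp (-(T - z)) ^ 2 ∈ Complex.slitPlane := by
  left
  have h := (Complex.abs_re_le_norm _).trans_lt (norm_exp_sq_lt_one ht hz)
  have := (abs_lt.1 h).2
  rw [Complex.sub_re, Complex.one_re]
  linarith

theorem csigma_ne_zero (ht : t ≤ T - 1) {z : ℂ} (hz : ‖z - t‖ < 1) : csigma T z ≠ 0 := by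
  intro h
  have h2 := csigma_sq T z
  rw [h] at h2
  refine Complex.slitPlane_ne_zero (mem_slitPlane_radicand ht hz) ?_
  rw [← h2]
  simp

theorem norm_csigma_le_two (ht : t ≤ T - 1) {z : ℂ} (hz : ‖z - t‖ < 1) : ‖csigma T z‖ ≤ 2 := by
  have h := norm_csigma_sq T z
  have h2 := norm_sub_le (1 : ℂ) (Complex.exp (-(T - z)) ^ 2)
  rw [norm_one] at h2
  have := norm_exp_sq_lt_one ht hz
  nlinarith [norm_nonneg (csigma T z)]

theorem hasDerivAt_cexp_sub (T : ℝ) (z : ℂ) :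
    HasDerivAt (fun z : ℂ => Complex.exp (-(T - z))) (Complex.exp (-(T - z))) z := by
  simpa using (((hasDerivAt_id z).const_sub (T : ℂ)).neg).cexp

theorem differentiableAt_csigma (ht : t ≤ T - 1) {z : ℂ} (hz : ‖z - t‖ < 1) :
    DifferentiableAt ℂ (csigma T) z :=
  (((hasDerivAt_cexp_sub T z).differentiableAt.pow 2).const_sub 1).cpow_const
    (mem_slitPlane_radicand ht hz)

/-- The signal-to-noise ratio at complex times. -/
def csnr (T : ℝ) (z : ℂ) : ℂ := Complex.exp (-(T - z)) / csigma T z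

theorem csnr_ofReal (ht : t < T) : csnr T t = snr T t := by
  rw [csnr, csigma_ofReal ht, snr]
  push_cast
  rfl

theorem hasDerivAt_csnr (ht : t ≤ T - 1) {z : ℂ} (hz : ‖z - t‖ < 1) :
    HasDerivAt (csnr T) (csnr T z / csigma T z ^ 2) z := by
  have h0 := csigma_ne_zero ht hz
  have h1 := (differentiableAt_csigma ht hz).hasDerivAt
  have h2 : HasDerivAt (fun z => csigma T z ^ 2) (2 * csigma T z * deriv (csigma T) z) z := by
    simpa using h1.fun_pow 2
  have h3 : HasDerivAt (fun z => csigma T z ^ 2) (-(2 * Complex.exp (-(T - z)) ^ 2)) z := by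
    simp_rw [csigma_sq]
    have := ((hasDerivAt_cexp_sub T z).fun_pow 2).const_sub 1
    refine this.congr_deriv ?_
    push_cast
    ring
  have h4 := h2.unique h3
  refine ((hasDerivAt_cexp_sub T z).div h1 h0).congr_deriv ?_
  have h5 := csigma_sq T z
  rw [csnr]
  field_simp
  linear_combination h5 - 1 / 2 * h4

/-- 17/125 lies just above e^{-2}. This is how the unit distance to the terminal time enters the
numerics. -/
theorem exp_neg_one_sub_sq_le (ht : t ≤ T - 1) : Real.exp (-(T - t)) ^ 2 ≤ 17 / 125 := by
  have h1 : Real.exp (-(T - t)) ≤ Real.exp (-1) := Real.exp_le_exp.2 (by linarith)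
  have h2 := Real.exp_neg_one_lt_d9
  nlinarith [Real.exp_pos (-(T - t))]

theorem exp_hundredth_le : Real.exp (1 / 100) ≤ 100 / 99 := by
  have h := Real.add_one_le_exp (-(1 / 100 : ℝ))
  rw [Real.exp_neg] at h
  rw [le_div_iff₀ (by norm_num)]
  have := Real.exp_pos (1 / 100)
  calc Real.exp (1 / 100) * 99 = Real.exp (1 / 100) * (-(1 / 100) + 1) * 100 := by ring
    _ ≤ Real.exp (1 / 100) * (Real.exp (1 / 100))⁻¹ * 100 := by gcongr
    _ = 100 := by rw [mul_inv_cancel₀ this.ne', one_mul]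

theorem norm_csigma_ge (ht : t ≤ T - 1) {z : ℂ} (hz : ‖z - t‖ ≤ 1 / 100) :
    99 / 100 * sigma T t ≤ ‖csigma T z‖ := by
  have hT : t < T := by linarith
  have hσ := sigma_pos hT
  refine le_of_sq_le_sq ?_ (norm_nonneg _)
  rw [mul_pow, sigma_sq hT, norm_csigma_sq]
  have h1 := norm_sub_norm_le (1 : ℂ) (Complex.exp (-(T - z)) ^ 2)
  rw [norm_one, norm_pow] at h1
  have h2 : ‖Complex.exp (-(T - z))‖ ≤ Real.exp (-(T - t)) * (100 / 99) :=
    (norm_exp_sub_le hz).trans (by gcongr; exact exp_hundredth_le)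
  have h3 := exp_neg_one_sub_sq_le ht
  have h4 : ‖Complex.exp (-(T - z))‖ ^ 2 ≤ (Real.exp (-(T - t)) * (100 / 99)) ^ 2 := by gcongr
  rw [mul_pow] at h4
  linarith

/-- The relative change of the signal-to-noise ratio from time `t` to the complex time `z`. -/
def csnrRatio (T t : ℝ) (z : ℂ) : ℂ := csnr T z / snr T t - 1

theorem hasDerivAt_csnrRatio (ht : t ≤ T - 1) {z : ℂ} (hz : ‖z - t‖ < 1) :
    HasDerivAt (csnrRatio T t) (csnr T z / csigma T z ^ 2 / snr T t) z :=
  ((hasDerivAt_csnr ht hz).div_const _).sub_const 1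

theorem norm_deriv_csnrRatio_le (ht : t ≤ T - 1) {z : ℂ} (hz : ‖z - t‖ ≤ 1 / 100) :
    ‖csnr T z / csigma T z ^ 2 / snr T t‖ ≤ 21 / 20 / sigma T t ^ 2 := by
  have hT : t < T := by linarith
  have hσ := sigma_pos hT
  have hw := snr_pos hT
  have h1 := norm_csigma_ge ht hz
  have h2 : ‖Complex.exp (-(T - z))‖ ≤ Real.exp (-(T - t)) * (100 / 99) :=
    (norm_exp_sub_le hz).trans (by gcongr; exact exp_hundredth_le)
  have ha := Real.exp_pos (-(T - t))
  have hpos : 0 < ‖csigma T z‖ := by nlinarith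
  rw [csnr, norm_div, norm_div, norm_div, norm_pow, Complex.norm_real, Real.norm_of_nonneg hw.le,
    snr]
  calc _ ≤ Real.exp (-(T - t)) * (100 / 99) / (99 / 100 * sigma T t) /
        (99 / 100 * sigma T t) ^ 2 / (Real.exp (-(T - t)) / sigma T t) := by gcongr
    _ = (100 / 99) ^ 4 / sigma T t ^ 2 := by field_simp
    _ ≤ _ := by gcongr; norm_num

theorem csnrRatio_ofReal_self (ht : t < T) : csnrRatio T t t = 0 := by
  rw [csnrRatio, csnr_ofReal ht, div_self (by exact_mod_cast (snr_pos ht).ne'), sub_self]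

/-- Ensures that times within κ₀σ²/(21/20) of `t` correspond to |κ| < κ₀. -/
theorem norm_csnrRatio_le (ht : t ≤ T - 1) {z : ℂ} (hz : ‖z - t‖ ≤ 1 / 100) :
    ‖csnrRatio T t z‖ ≤ 21 / 20 / sigma T t ^ 2 * ‖z - t‖ := by
  have hd : ∀ y ∈ Metric.closedBall (t : ℂ) (1 / 100), ‖y - t‖ ≤ 1 / 100 := fun y hy => by
    rwa [Metric.mem_closedBall, Complex.dist_eq] at hy
  have h := (convex_closedBall (t : ℂ) (1 / 100)).norm_image_sub_le_of_norm_hasDerivWithin_le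
    (C := 21 / 20 / sigma T t ^ 2)
    (fun y hy => (hasDerivAt_csnrRatio ht ((hd y hy).trans_lt (by norm_num))).hasDerivWithinAt)
    (fun y hy => norm_deriv_csnrRatio_le ht (hd y hy))
    (Metric.mem_closedBall_self (by norm_num))
    (by rwa [Metric.mem_closedBall, Complex.dist_eq] : z ∈ Metric.closedBall (t : ℂ) (1 / 100))
  rwa [csnrRatio_ofReal_self (by linarith), sub_zero] at h

theorem snr_div_sigma_sq_le (ht : t ≤ T - 1) : snr T t / sigma T t ^ 2 ≤ 1 / 2 := by
  have hT : t < T := by linarith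
  have hσ := sigma_pos hT
  have h1 := exp_neg_one_sub_sq_le ht
  have h2 := sigma_sq hT
  have h3 : 108 / 125 ≤ sigma T t ^ 2 := by linarith
  rw [snr, div_div, ← pow_succ', div_le_iff₀ (by positivity)]
  refine le_of_sq_le_sq ?_ (by positivity)
  have h4 : (108 / 125 : ℝ) ^ 3 ≤ (sigma T t ^ 2) ^ 3 := by gcongr
  calc Real.exp (-(T - t)) ^ 2 ≤ 1 / 4 * (sigma T t ^ 2) ^ 3 := by linarith
    _ = _ := by ring

end ComplexTime

/-! ### From the complexified mean to derivatives along the flow. -/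

section ComplexPosterior

variable {d : ℕ} {q : Measure (Vec d)} [IsProbabilityMeasure q] {R : ℝ}

/-- The exponent at the parameters s(1+κ), η+v is 1+κ times the exponent at s, η, plus the second
summand of `cphase`. The normaliser leaves a factor independent of x, which cancels in the mean. -/
theorem cInt_posterior {F : Type} [NormedAddCommGroup F] [NormedSpace ℂ F]
    (hq : q (Metric.closedBall 0 R)ᶜ = 0) (s κ : ℝ) (η v : Vec d)
    (g : Vec d → F) :
    cInt (posterior q (s • η, s ^ 2)) s (logPost q (s • η, s ^ 2)) g ((κ : ℂ), cvec v) =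
      Real.exp (-((1 + κ) * Real.log (partZ q (s • η, s ^ 2)))) •
        expInt q g ((s * (1 + κ)) • (η + v), (s * (1 + κ)) ^ 2) := by
  rw [cInt, integral_posterior hq, expInt, ← integral_smul]
  refine integral_congr_ae (Filter.Eventually.of_forall fun x => ?_)
  have h : cphase s (logPost q (s • η, s ^ 2)) ((κ : ℂ), cvec v) x =
      ((κ * logPost q (s • η, s ^ 2) x + s * (1 + κ) *
        (inner ℝ v x - s * κ * (‖x‖ ^ 2 / 2)) : ℝ) : ℂ) := by
    simp only [cphase, innerSL_apply_apply, inner_cvec]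
    push_cast
    ring
  simp only
  rw [h, ← Complex.ofReal_exp, Complex.coe_smul, smul_smul, smul_smul, ← Real.exp_add,
    ← Real.exp_add]
  congr 2
  simp only [logPost, expo_apply, inner_smul_left, inner_add_left, RCLike.conj_to_real]
  ring

theorem cMean_posterior (hq : q (Metric.closedBall 0 R)ᶜ = 0) (s κ : ℝ) (η v : Vec d) :
    cMean (posterior q (s • η, s ^ 2)) s (logPost q (s • η, s ^ 2)) ((κ : ℂ), cvec v) =
      cvec (postMean q (s * (1 + κ)) (η + v)) := by
  set p : Vec d × ℝ := ((s * (1 + κ)) • (η + v), (s * (1 + κ)) ^ 2) with hp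
  have h1 : expInt q (fun _ => (1 : ℂ)) p = (partZ q p : ℂ) := by
    have := expInt_clm hq (g := fun _ => (1 : ℝ)) continuous_const Complex.ofRealCLM p
    simpa [partZ] using this.symm
  have h2 : expInt q (fun x => cvec x) p = cvec (expInt q (fun x => x) p) :=
    (expInt_clm hq continuous_id cvec p).symm
  have hc : Real.exp (-((1 + κ) * Real.log (partZ q (s • η, s ^ 2)))) ≠ 0 := (Real.exp_pos _).ne'
  rw [cMean, cInt_posterior hq, cInt_posterior hq, ← hp, h1, h2, postMean, ← hp, map_smul]
  generalize Real.exp (-((1 + κ) * Real.log (partZ q (s • η, s ^ 2)))) = c at hc ⊢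
  rw [Complex.real_smul, mul_inv, ← Complex.coe_smul c, smul_smul, ← Complex.coe_smul (partZ q p)⁻¹]
  congr 1
  have : (c : ℂ) ≠ 0 := by exact_mod_cast hc
  push_cast
  field_simp

variable {T : ℝ}

/-- The relative change κ = w_r/w_t - 1 serves as time: since dη/dw = m, the increments of η solve
the equation of `CBound.exists_holomorphic_approx`. -/
theorem IsProbabilityFlow.exists_holomorphic_approx (hq : q (Metric.closedBall 0 R)ᶜ = 0)
    (hR : 0 ≤ R) {Φ : Vec d → ℝ → Vec d} (hΦ : IsProbabilityFlow q T Φ) (x : Vec d) {t : ℝ}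
    (ht : t ∈ Ico 0 T) (ht1 : t ≤ T - 1) {κ₀ Λ : ℝ} (hκ : κ₀ ≤ 1 / 100)
    (hB : CBound (posterior q (snr T t • normTraj T Φ x t, snr T t ^ 2)) (snr T t)
      (logPost q (snr T t • normTraj T Φ x t, snr T t ^ 2)) R κ₀ Λ) (n : ℕ) :
    ∃ U : ℂ → CVec d, DifferentiableOn ℂ U (Metric.ball 0 κ₀) ∧
      (∀ z ∈ Metric.ball (0 : ℂ) κ₀, ‖U z‖ ≤ 3 * R * (snr T t * κ₀)) ∧
      ∃ C : ℝ, 0 ≤ C ∧ ∀ r ∈ Ico 0 T, |r - t| < κ₀ * sigma T t ^ 2 / (21 / 20) →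
        ‖U (csnrRatio T t r) - cvec (normTraj T Φ x r - normTraj T Φ x t)‖ ≤ C * |r - t| ^ n := by
  have hT : t < T := ht.2
  have hσ := sigma_pos hT
  have hw := snr_pos hT
  have hκ₀ := hB.pos
  have hσ1 : sigma T t ^ 2 ≤ 1 := pow_le_one₀ hσ.le (sigma_le_one T t)
  set ρ := κ₀ * sigma T t ^ 2 / (21 / 20) with hρ
  have hρ0 : 0 < ρ := by positivity
  have hρ1 : ρ ≤ 1 / 100 := by
    rw [hρ, div_le_iff₀ (by norm_num)]
    nlinarith
  set S := Ico 0 T ∩ Metric.ball t ρ with hS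
  have hSc : Convex ℝ S := (convex_Ico 0 T).inter (convex_ball t ρ)
  have hnorm : ∀ r ∈ S, ‖(r : ℂ) - t‖ < ρ := fun r hr => by
    rw [← Complex.ofReal_sub, Complex.norm_real]
    exact hr.2
  have htS : t ∈ S := ⟨ht, Metric.mem_ball_self hρ0⟩
  set κ' : ℝ → ℝ := fun r => snr T r / sigma T r ^ 2 / snr T t with hκ'
  have hratio : ∀ r < T, csnrRatio T t r = ((snr T r / snr T t - 1 : ℝ) : ℂ) := fun r hr => by
    rw [csnrRatio, csnr_ofReal hr]
    push_cast
    rfl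
  have hκ'b : ∀ r ∈ S, |κ' r| ≤ 21 / 20 / sigma T t ^ 2 := fun r hr => by
    have h := norm_deriv_csnrRatio_le ht1 ((hnorm r hr).le.trans hρ1)
    rw [csnr_ofReal hr.1.2, csigma_ofReal hr.1.2] at h
    rw [← Real.norm_eq_abs, ← Complex.norm_real, hκ']
    push_cast
    exact h
  have hder : ∀ r ∈ S, HasDerivWithinAt (fun r => normTraj T Φ x r - normTraj T Φ x t)
      ((κ' r * snr T t) • postMean q (snr T r) (normTraj T Φ x r)) S r := fun r hr => by
    refine (((hΦ.hasDerivWithinAt_normTraj hq x hr.1).mono inter_subset_left).sub_const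
      (normTraj T Φ x t)).congr_deriv ?_
    rw [normField, hκ']
    simp only
    rw [div_mul_cancel₀ _ hw.ne']
  obtain ⟨U, hU, hUb, C, hC, hUV⟩ := by
    haveI := isProbabilityMeasure_posterior hq
      (snr T t • normTraj T Φ x t, snr T t ^ 2)
    refine hB.exists_holomorphic_approx hR hSc htS
      (κ := fun r => snr T r / snr T t - 1) (κ' := κ')
      (V := fun r => cvec (normTraj T Φ x r - normTraj T Φ x t))
      (K₁ := 21 / 20 / sigma T t ^ 2) (by positivity)
      (fun r hr => (((hasDerivAt_snr hr.1.2).div_const _).sub_const 1).hasDerivWithinAt)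
      (by simp [div_self hw.ne']) (fun r hr => ?_) hκ'b (fun r hr => ?_) (by simp)
      (fun r hr => ?_) n
    · have h := norm_csnrRatio_le ht1 ((hnorm r hr).le.trans hρ1)
      rw [hratio r hr.1.2, Complex.norm_real, Real.norm_eq_abs] at h
      refine h.trans_lt ?_
      calc 21 / 20 / sigma T t ^ 2 * ‖(r : ℂ) - t‖ < 21 / 20 / sigma T t ^ 2 * ρ := by
            gcongr
            exact hnorm r hr
        _ = κ₀ := by rw [hρ]; field_simp
    · have h1 := cvec.hasFDerivAt.comp_hasDerivWithinAt r (hder r hr)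
      rw [cMean_posterior hq, add_sub_cancel, add_sub_cancel, mul_div_cancel₀ _ hw.ne']
      refine h1.congr_deriv ?_
      rw [map_smul, ← Complex.coe_smul, smul_smul]
      push_cast
      rfl
    · rw [norm_cvec]
      have h2 := hSc.norm_image_sub_le_of_norm_hasDerivWithin_le
        (C := 21 / 20 / sigma T t ^ 2 * snr T t * R) hder (fun r hr => by
          rw [norm_smul, norm_mul, Real.norm_eq_abs, Real.norm_of_nonneg hw.le]
          have := hκ'b r hr
          have := norm_postMean_le hq (snr T r) (normTraj T Φ x r)
          gcongr) htS hr
      rw [sub_self, sub_zero] at h2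
      have h3 : ‖r - t‖ ≤ ρ := hr.2.le
      calc _ ≤ _ := h2
        _ ≤ 21 / 20 / sigma T t ^ 2 * snr T t * R * ρ := by gcongr
        _ = R * (snr T t * κ₀) := by rw [hρ]; field_simp
        _ ≤ 3 * R * (snr T t * κ₀) := by
            have : 0 ≤ R * (snr T t * κ₀) := by positivity
            linarith
  refine ⟨U, hU, hUb, C, hC, fun r hr hrt => ?_⟩
  rw [hratio r hr.2]
  exact hUV r ⟨hr, by rwa [Metric.mem_ball, Real.dist_eq]⟩

/-- Split y_r = σ_r η_t + σ_r(η_r - η_t). The first term is holomorphic on the unit disc; the second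
is replaced by an iterate on a disc of radius of order κ₀σ². The k-th derivative of the field is the
(k+1)-st of the trajectory, and the surplus factor 1/κ₀ from Cauchy's estimate is cancelled by the
size 3Rwκ₀ of the iterate. -/
theorem IsProbabilityFlow.abs_iteratedDerivWithin_fieldAlong_le
    (hq : q (Metric.closedBall 0 R)ᶜ = 0)
    (hR : 0 ≤ R) {Φ : Vec d → ℝ → Vec d} (hΦ : IsProbabilityFlow q T Φ) (x : Vec d) {t : ℝ}
    (ht : t ∈ Ico 0 T) (ht1 : t ≤ T - 1) {κ₀ Λ : ℝ} (hκ : κ₀ ≤ 1 / 100)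
    (hB : CBound (posterior q (snr T t • normTraj T Φ x t, snr T t ^ 2)) (snr T t)
      (logPost q (snr T t • normTraj T Φ x t, snr T t ^ 2)) R κ₀ Λ) (k : ℕ) (i : Fin d) :
    |iteratedDerivWithin k (fieldAlong q T Φ x) (Ico 0 T) t i| ≤
      (k + 1).factorial * (4 * R * (11 / 10 / (κ₀ * sigma T t ^ 2)) ^ k +
        |normTraj T Φ x t i| * 2 ^ (k + 2)) := by
  have hT : t < T := ht.2
  have hσ := sigma_pos hT
  have hw := snr_pos hT
  have hκ₀ := hB.pos
  have hσ1 : sigma T t ^ 2 ≤ 1 := pow_le_one₀ hσ.le (sigma_le_one T t)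
  -- Order k + 2, one more than the k + 1 derivatives of the trajectory to be matched.
  obtain ⟨U, hU, hUb, C, hC, hUV⟩ :=
    hΦ.exists_holomorphic_approx hq hR x ht ht1 hκ hB (k + 2)
  set ρ := κ₀ * sigma T t ^ 2 / (21 / 20) with hρ
  have hρ0 : 0 < ρ := by positivity
  have hρ1 : ρ ≤ 1 / 100 := by
    rw [hρ, div_le_iff₀ (by norm_num)]
    nlinarith
  have hball : ∀ z ∈ Metric.ball (t : ℂ) ρ, ‖z - t‖ < ρ := fun z hz => by
    rwa [Metric.mem_ball, Complex.dist_eq] at hz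
  have hratio : ∀ z ∈ Metric.ball (t : ℂ) ρ, csnrRatio T t z ∈ Metric.ball (0 : ℂ) κ₀ := by
    intro z hz
    rw [mem_ball_zero_iff]
    refine (norm_csnrRatio_le ht1 ((hball z hz).le.trans hρ1)).trans_lt ?_
    calc 21 / 20 / sigma T t ^ 2 * ‖z - t‖ < 21 / 20 / sigma T t ^ 2 * ρ := by
          gcongr
          exact hball z hz
      _ = κ₀ := by rw [hρ]; field_simp
  set A : ℂ → ℂ := fun z => csigma T z * (normTraj T Φ x t i : ℂ) with hA
  set B : ℂ → ℂ := fun z => csigma T z * U (csnrRatio T t z) i with hBdef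
  have hsig : ∀ r : ℝ, r ≤ 1 → DifferentiableOn ℂ (csigma T) (Metric.ball (t : ℂ) r) :=
    fun r hr z hz => (differentiableAt_csigma ht1 (by
      rw [Metric.mem_ball, Complex.dist_eq] at hz
      linarith)).differentiableWithinAt
  have hAd : DifferentiableOn ℂ A (Metric.ball (t : ℂ) 1) := (hsig 1 le_rfl).mul_const _
  have hBd : DifferentiableOn ℂ B (Metric.ball (t : ℂ) ρ) := by
    refine (hsig ρ (by linarith)).mul ?_
    have hr : DifferentiableOn ℂ (csnrRatio T t) (Metric.ball (t : ℂ) ρ) := fun z hz =>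
      (hasDerivAt_csnrRatio ht1
        ((hball z hz).trans (by linarith))).differentiableAt.differentiableWithinAt
    exact (EuclideanSpace.proj (𝕜 := ℂ) i).differentiable.comp_differentiableOn
      (hU.comp hr hratio)
  have hAb : ‖iteratedDeriv (k + 1) A t‖ ≤
      (k + 1).factorial * (2 * |normTraj T Φ x t i|) / (1 / 2) ^ (k + 1) := by
    refine Complex.norm_iteratedDeriv_le_of_forall_mem_sphere_norm_le (k + 1) (by norm_num)
      (hAd.mono ?_).diffContOnCl fun z hz => ?_
    · exact Metric.closure_ball_subset_closedBall.trans
        (Metric.closedBall_subset_ball (by norm_num))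
    · rw [hA, norm_mul, Complex.norm_real, Real.norm_eq_abs]
      gcongr
      refine norm_csigma_le_two ht1 ?_
      rw [mem_sphere_iff_norm] at hz
      rw [hz]
      norm_num
  have hBb : ‖iteratedDeriv (k + 1) B t‖ ≤
      (k + 1).factorial * (2 * (3 * R * (snr T t * κ₀))) /
        (κ₀ * sigma T t ^ 2 / (11 / 10)) ^ (k + 1) := by
    -- With 11/10 in place of 21/20, the Cauchy circle lies strictly inside the disc on which `B` is
    -- holomorphic.
    have hlt : κ₀ * sigma T t ^ 2 / (11 / 10) < ρ := by
      rw [hρ]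
      exact div_lt_div_of_pos_left (by positivity) (by norm_num) (by norm_num)
    refine Complex.norm_iteratedDeriv_le_of_forall_mem_sphere_norm_le (k + 1) (by positivity)
      (hBd.mono ?_).diffContOnCl fun z hz => ?_
    · exact Metric.closure_ball_subset_closedBall.trans (Metric.closedBall_subset_ball hlt)
    · rw [mem_sphere_iff_norm] at hz
      have hz' : z ∈ Metric.ball (t : ℂ) ρ := by
        rw [Metric.mem_ball, Complex.dist_eq, hz]
        exact hlt
      rw [hBdef, norm_mul]
      gcongr
      · exact norm_csigma_le_two ht1 (by linarith)
      · exact (PiLp.norm_apply_le _ i).trans (hUb _ (hratio z hz'))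
  have hΦc := hΦ.contDiffOn hq x (k + 1)
  have hu : UniqueDiffOn ℝ (Ico 0 T) := uniqueDiffOn_Ico 0 T
  set L : Vec d →L[ℝ] ℂ := Complex.ofRealCLM.comp (EuclideanSpace.proj (𝕜 := ℝ) i) with hL
  have hkey : iteratedDerivWithin (k + 1) (fun r => L (Φ x r)) (Ico 0 T) t =
      iteratedDeriv (k + 1) (fun z => A z + B z) t := by
    refine iteratedDerivWithin_eq_iteratedDeriv_of_isBigO (convex_Ico 0 T) hu ht hρ0
      ((hAd.mono (Metric.ball_subset_ball (by linarith))).add hBd) (L.contDiff.comp_contDiffOn hΦc)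
      (Asymptotics.IsBigO.of_bound C ?_)
    have hn : Metric.ball t ρ ∈ 𝓝[Ico 0 T] t :=
      mem_nhdsWithin_of_mem_nhds (Metric.ball_mem_nhds t hρ0)
    filter_upwards [hn, self_mem_nhdsWithin] with r hr hrT
    rw [Metric.mem_ball, Real.dist_eq] at hr
    have hσr := sigma_pos hrT.2
    have h1 : L (Φ x r) - (A r + B r) =
        -((sigma T r : ℂ) * ((U (csnrRatio T t r) -
          cvec (normTraj T Φ x r - normTraj T Φ x t)) i)) := by
      have h2 : L (Φ x r) = (sigma T r : ℂ) * (normTraj T Φ x r i : ℂ) := by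
        rw [hL, normTraj]
        simp
        rw [mul_inv_cancel_left₀]
        exact_mod_cast hσr.ne'
      rw [h2, hA, hBdef]
      simp only [csigma_ofReal hrT.2, PiLp.sub_apply, cvec_apply]
      push_cast
      ring
    change ‖L (Φ x r) - (A r + B r)‖ ≤ _
    rw [h1, norm_neg, norm_mul, Complex.norm_real, Real.norm_of_nonneg hσr.le, norm_pow,
      Real.norm_eq_abs]
    calc _ ≤ 1 * (C * |r - t| ^ (k + 2)) := by
          gcongr
          · exact sigma_le_one T r
          · exact (PiLp.norm_apply_le _ i).trans (hUV r hrT hr)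
      _ = _ := one_mul _
  have hAc : ContDiffAt ℂ (k + 1 : ℕ) A t :=
    (hAd.contDiffOn Metric.isOpen_ball).contDiffAt (Metric.ball_mem_nhds _ one_pos)
  have hBc : ContDiffAt ℂ (k + 1 : ℕ) B t :=
    (hBd.contDiffOn Metric.isOpen_ball).contDiffAt (Metric.ball_mem_nhds _ hρ0)
  rw [ContinuousLinearMap.iteratedDerivWithin_comp_left' L hu hΦc ht,
    iteratedDeriv_fun_add hAc hBc] at hkey
  have hnorm : |iteratedDerivWithin (k + 1) (Φ x) (Ico 0 T) t i| ≤
      ‖iteratedDeriv (k + 1) A t‖ + ‖iteratedDeriv (k + 1) B t‖ := by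
    refine le_trans (le_of_eq ?_) (norm_add_le _ _)
    rw [← hkey, hL]
    simp
  rw [hΦ.iteratedDerivWithin_fieldAlong x k ht]
  refine hnorm.trans ((add_le_add hAb hBb).trans ?_)
  have hsw := snr_div_sigma_sq_le ht1
  have e1 : (k + 1).factorial * (2 * |normTraj T Φ x t i|) / (1 / 2) ^ (k + 1) =
      (k + 1).factorial * (|normTraj T Φ x t i| * 2 ^ (k + 2)) := by
    rw [one_div, inv_pow, div_inv_eq_mul]
    ring
  have e2 : (k + 1).factorial * (2 * (3 * R * (snr T t * κ₀))) /
        (κ₀ * sigma T t ^ 2 / (11 / 10)) ^ (k + 1) =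
      (k + 1).factorial * (R * (33 / 5 * (snr T t / sigma T t ^ 2)) *
        (11 / 10 / (κ₀ * sigma T t ^ 2)) ^ k) := by
    rw [pow_succ, ← inv_div (11 / 10 : ℝ) (κ₀ * sigma T t ^ 2), inv_pow]
    field_simp
    ring
  have e3 : R * (33 / 5 * (snr T t / sigma T t ^ 2)) ≤ 4 * R := by nlinarith
  rw [e1, e2, mul_add, add_comm]
  exact add_le_add (mul_le_mul_of_nonneg_left (mul_le_mul_of_nonneg_right e3 (by positivity))
    (by positivity)) le_rfl

end ComplexPosterior

/-! ### Good initial values: a net of times, its probability, its stability. -/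

section GoodEvent

variable {d : ℕ} {q : Measure (Vec d)} [IsProbabilityMeasure q] {R T : ℝ}
  {Φ : Vec d → ℝ → Vec d}

theorem snr_le {t : ℝ} (ht : t ≤ T - 1) : snr T t ≤ 2 / 5 := by
  have hT : t < T := by linarith
  have hσ := sigma_pos hT
  have h1 := exp_neg_one_sub_sq_le ht
  have h2 := sigma_sq hT
  rw [snr, div_le_iff₀ hσ]
  refine le_of_sq_le_sq ?_ (by positivity)
  rw [mul_pow]
  linarith

theorem nine_tenths_le_sigma {t : ℝ} (ht : t ≤ T - 1) : 9 / 10 ≤ sigma T t := by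
  have hT : t < T := by linarith
  have h1 := exp_neg_one_sub_sq_le ht
  have h2 := sigma_sq hT
  refine le_of_sq_le_sq ?_ (sigma_pos hT).le
  linarith

theorem abs_snr_sub_le {r t : ℝ} (hr : r ≤ T - 1) (ht : t ≤ T - 1) :
    |snr T t - snr T r| ≤ 1 / 2 * |t - r| := by
  have h := (convex_Iic (T - 1)).norm_image_sub_le_of_norm_hasDerivWithin_le
    (f := snr T) (C := 1 / 2)
    (fun y hy => (hasDerivAt_snr (by linarith [mem_Iic.1 hy])).hasDerivWithinAt)
    (fun y hy => by
      have hT : y < T := by linarith [mem_Iic.1 hy]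
      have := snr_pos hT
      rw [Real.norm_of_nonneg (by positivity)]
      exact snr_div_sigma_sq_le hy) (mem_Iic.2 hr) (mem_Iic.2 ht)
  simpa [Real.norm_eq_abs] using h

theorem IsProbabilityFlow.norm_normTraj_sub_le (hq : q (Metric.closedBall 0 R)ᶜ = 0)
    (hΦ : IsProbabilityFlow q T Φ) (x : Vec d) {r t : ℝ}
    (hr : r ∈ Icc 0 (T - 1)) (ht : t ∈ Icc 0 (T - 1)) :
    ‖normTraj T Φ x t - normTraj T Φ x r‖ ≤ R / 2 * |t - r| := by
  have h := (convex_Icc 0 (T - 1)).norm_image_sub_le_of_norm_hasDerivWithin_le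
    (C := R / 2) (fun y hy => hΦ.hasDerivWithinAt_Icc hq (by linarith : T - 1 < T) x hy)
    (fun y hy => by
      have hT : y < T := by linarith [hy.2]
      have := snr_pos hT
      have h1 := snr_div_sigma_sq_le hy.2
      have h2 := norm_postMean_le hq (snr T y) (normTraj T Φ x y)
      rw [normField, norm_smul, Real.norm_of_nonneg (by positivity)]
      calc _ ≤ 1 / 2 * R := by gcongr
        _ = R / 2 := by ring) hr ht
  simpa [Real.norm_eq_abs] using h

/-- The parameter of the posterior at time `t` along the trajectory started from `x`. -/
def trajParam (T : ℝ) (Φ : Vec d → ℝ → Vec d) (x : Vec d) (t : ℝ) : Vec d × ℝ :=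
  (snr T t • normTraj T Φ x t, snr T t ^ 2)

theorem abs_expo_sub_le {x θ θ' : Vec d} {s s' : ℝ} (hx : ‖x‖ ≤ R) :
    |expo x (θ', s') - expo x (θ, s)| ≤ R * (‖θ' - θ‖ + |s' - s| * R / 2) := by
  have hR : 0 ≤ R := (norm_nonneg _).trans hx
  have h1 : |inner ℝ (θ' - θ) x| ≤ ‖θ' - θ‖ * R :=
    (abs_real_inner_le_norm _ _).trans (by gcongr)
  have h2 : |(s' - s) * (‖x‖ ^ 2 / 2)| ≤ |s' - s| * (R ^ 2 / 2) := by
    rw [abs_mul, abs_of_nonneg (by positivity : 0 ≤ ‖x‖ ^ 2 / 2)]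
    gcongr
  have h3 : expo x (θ', s') - expo x (θ, s) =
      inner ℝ (θ' - θ) x - (s' - s) * (‖x‖ ^ 2 / 2) := by
    simp only [expo_apply, inner_sub_left]
    ring
  rw [h3]
  calc _ ≤ |inner ℝ (θ' - θ) x| + |(s' - s) * (‖x‖ ^ 2 / 2)| := abs_sub _ _
    _ ≤ ‖θ' - θ‖ * R + |s' - s| * (R ^ 2 / 2) := add_le_add h1 h2
    _ = _ := by ring

theorem renyi_trajParam_le_of_norm_sub_le (hq : q (Metric.closedBall 0 R)ᶜ = 0) {x y : Vec d}
    {t : ℝ} (ht : t ≤ T - 1) (h : ‖Φ x t - Φ y t‖ ≤ 1) :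
    renyi q (trajParam T Φ y t) ≤ Real.exp (5 / 4 * R) * renyi q (trajParam T Φ x t) := by
  have hT : t < T := by linarith
  have hσ := sigma_pos hT
  have hw := snr_pos hT
  have h1 := renyi_le_exp_mul hq (p := trajParam T Φ x t) (p' := trajParam T Φ y t) (b := R / 2)
    fun z hz => by
      have hR : 0 ≤ R := (norm_nonneg _).trans hz
      refine (abs_expo_sub_le hz).trans ?_
      rw [sub_self, abs_zero, zero_mul, zero_div, add_zero, ← smul_sub, normTraj, normTraj,
        ← smul_sub, smul_smul, norm_smul, norm_mul, norm_inv, Real.norm_of_nonneg hw.le,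
        Real.norm_of_nonneg hσ.le, norm_sub_rev]
      have h2 : snr T t * (sigma T t)⁻¹ ≤ 1 / 2 := by
        refine le_trans ?_ (snr_div_sigma_sq_le ht)
        rw [div_eq_mul_inv]
        gcongr
        nlinarith [sigma_le_one T t]
      calc _ ≤ R * (1 / 2 * 1) := by gcongr
        _ = R / 2 := by ring
  refine h1.trans (le_of_eq ?_)
  congr 2
  ring

/-- In time, w moves at speed at most 1/2 and η at speed at most R/2, which bounds the drift of the
posterior parameter between net times. -/
theorem IsProbabilityFlow.renyi_trajParam_le (hq : q (Metric.closedBall 0 R)ᶜ = 0) (hR : 0 ≤ R)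
    (hΦ : IsProbabilityFlow q T Φ) (x : Vec d) {r t b : ℝ}
    (hr : r ∈ Icc 0 (T - 1)) (ht : t ∈ Icc 0 (T - 1))
    (hb : |t - r| * (R * (2 / 5 * R + ‖normTraj T Φ x r‖ / 2)) ≤ b) :
    renyi q (trajParam T Φ x t) ≤ Real.exp (5 / 2 * b) * renyi q (trajParam T Φ x r) := by
  refine renyi_le_exp_mul hq fun z hz => (abs_expo_sub_le hz).trans (le_trans ?_ hb)
  have hwt := snr_pos (T := T) (t := t) (by linarith [ht.2])
  have hwr := snr_pos (T := T) (t := r) (by linarith [hr.2])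
  have hwt' := snr_le ht.2
  have hwr' := snr_le hr.2
  have h1 := abs_snr_sub_le hr.2 ht.2
  have h2 := hΦ.norm_normTraj_sub_le hq x hr ht
  have h3 : ‖snr T t • normTraj T Φ x t - snr T r • normTraj T Φ x r‖ ≤
      2 / 5 * (R / 2 * |t - r|) + 1 / 2 * |t - r| * ‖normTraj T Φ x r‖ := by
    have : snr T t • normTraj T Φ x t - snr T r • normTraj T Φ x r =
        snr T t • (normTraj T Φ x t - normTraj T Φ x r) +
          (snr T t - snr T r) • normTraj T Φ x r := by
      rw [smul_sub, sub_smul]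
      abel
    rw [this]
    refine (norm_add_le _ _).trans ?_
    rw [norm_smul, norm_smul, Real.norm_of_nonneg hwt.le, Real.norm_eq_abs]
    gcongr
  have h4 : |snr T t ^ 2 - snr T r ^ 2| ≤ 1 / 2 * |t - r| * (4 / 5) := by
    rw [sq_sub_sq, mul_comm, abs_mul, abs_of_nonneg (by positivity : 0 ≤ snr T t + snr T r)]
    gcongr
    linarith
  calc _ ≤ R * (2 / 5 * (R / 2 * |t - r|) + 1 / 2 * |t - r| * ‖normTraj T Φ x r‖ +
        1 / 2 * |t - r| * (4 / 5) * R / 2) := by gcongr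
    _ = _ := by ring

/-- Initial values for which the posterior is controlled at the `N + 1` equidistant times of the
window `[t₀, t₀ + h]`, and the normalised trajectory has bounded coordinates at time `t₀`. -/
def goodSet (q : Measure (Vec d)) (T : ℝ) (Φ : Vec d → ℝ → Vec d) (R t₀ h : ℝ) (N : ℕ)
    (ρ B : ℝ) : Set (Vec d) :=
  {x | (∀ i, |normTraj T Φ x t₀ i| ≤ ρ) ∧ ∀ j ∈ Finset.range (N + 1),
    renyi q (trajParam T Φ x (t₀ + j * (h / N))) ≤
      Real.exp (5 / 8 * (snr T (t₀ + j * (h / N)) ^ 2 * R ^ 2)) * B}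

theorem IsProbabilityFlow.continuous_normTraj (hq : q (Metric.closedBall 0 R)ᶜ = 0)
    (hΦ : IsProbabilityFlow q T Φ) {τ : ℝ} (hτ0 : 0 ≤ τ) (hτ : τ < T) :
    Continuous fun x => normTraj T Φ x τ :=
  continuous_iff_continuousAt.2 fun x => by
    obtain ⟨J, hJ, -⟩ := hΦ.exists_hasFDerivAt hq hτ0 hτ x
    exact hJ.continuousAt

theorem net_mem (t₀ : ℝ) {h : ℝ} (hh : 0 ≤ h) {N j : ℕ} (hj : j ≤ N) :
    t₀ + j * (h / N) ∈ Icc t₀ (t₀ + h) := by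
  constructor
  · have : 0 ≤ (j : ℝ) * (h / N) := by positivity
    linarith
  · rcases Nat.eq_zero_or_pos N with rfl | hN
    · simpa using hh
    · have h1 : (j : ℝ) ≤ N := by exact_mod_cast hj
      have h2 : (0 : ℝ) < N := by exact_mod_cast hN
      have : (j : ℝ) * (h / N) ≤ h := by
        calc (j : ℝ) * (h / N) ≤ N * (h / N) := by gcongr
          _ = h := by field_simp
      linarith

theorem exists_net_near {t₀ h t : ℝ} (ht : t ∈ Icc t₀ (t₀ + h)) (h1 : h ≤ 1) {N : ℕ}
    (hN : 0 < N) : ∃ j ≤ N, |t - (t₀ + j * (h / N))| ≤ 1 / N := by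
  have hN' : (0 : ℝ) < N := by exact_mod_cast hN
  have hu : 0 ≤ t - t₀ := by linarith [ht.1]
  have huh : t - t₀ ≤ h := by linarith [ht.2]
  rcases (hu.trans huh).eq_or_lt with h0 | h0
  · refine ⟨0, by simp, ?_⟩
    have : t = t₀ := by linarith
    rw [this]
    simp
  · have hfl := Nat.floor_le (by positivity : 0 ≤ (t - t₀) * N / h)
    have hfl' := Nat.lt_floor_add_one ((t - t₀) * N / h)
    refine ⟨⌊(t - t₀) * N / h⌋₊, ?_, ?_⟩
    · refine Nat.floor_le_of_le ?_
      rw [div_le_iff₀ h0, mul_comm]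
      gcongr
    · have e : t - t₀ = (t - t₀) * N / h * (h / N) := by field_simp
      have hhN : 0 < h / N := by positivity
      have hhN1 : h / N ≤ 1 / N := by gcongr
      rw [abs_le]
      constructor <;> nlinarith

theorem IsProbabilityFlow.measurableSet_goodSet (hq : q (Metric.closedBall 0 R)ᶜ = 0)
    (hΦ : IsProbabilityFlow q T Φ) {t₀ h : ℝ} (ht₀ : 0 ≤ t₀) (hh : 0 ≤ h) (hT : t₀ + h ≤ T - 1)
    (N : ℕ) (ρ B : ℝ) : MeasurableSet (goodSet q T Φ R t₀ h N ρ B) := by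
  have hc : ∀ j ∈ Finset.range (N + 1),
      Continuous fun x => normTraj T Φ x (t₀ + j * (h / N)) := fun j hj => by
    have := net_mem t₀ hh (Nat.lt_succ_iff.1 (Finset.mem_range.1 hj))
    exact hΦ.continuous_normTraj hq (ht₀.trans this.1) (by linarith [this.2])
  have hc0 := hΦ.continuous_normTraj hq ht₀ (by linarith : t₀ < T)
  have hcr := continuous_renyi hq
  refine MeasurableSet.inter (s₁ := {x | ∀ i, |normTraj T Φ x t₀ i| ≤ ρ})
    (s₂ := {x | ∀ j ∈ Finset.range (N + 1), _}) ?_ ?_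
  · simp only [ofPred_forall]
    refine MeasurableSet.iInter fun i => measurableSet_le ?_ measurable_const
    have : Continuous fun x => |normTraj T Φ x t₀ i| :=
      ((EuclideanSpace.proj (𝕜 := ℝ) i).continuous.comp hc0).abs
    exact this.measurable
  · simp only [ofPred_forall]
    refine Finset.measurableSet_biInter _ fun j hj => measurableSet_le ?_ measurable_const
    have : Continuous fun x => renyi q (trajParam T Φ x (t₀ + j * (h / N))) :=
      hcr.comp (((hc j hj).const_smul (snr T (t₀ + j * (h / N)))).prodMk
        (continuous_const (y := snr T (t₀ + j * (h / N)) ^ 2)))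
    exact this.measurable

/-- Union bound: d coordinate tails at time `t₀`, and one Markov inequality of size 1/B at each of
the N + 1 net times. -/
theorem IsProbabilityFlow.marginal_compl_goodSet_le (hq : q (Metric.closedBall 0 R)ᶜ = 0)
    (hR : 0 ≤ R) (hΦ : IsProbabilityFlow q T Φ) {t₀ h : ℝ} (ht₀ : 0 ≤ t₀) (hh : 0 ≤ h)
    (hT : t₀ + h ≤ T - 1) (N : ℕ) (ρ : ℝ) {B : ℝ} (hB : 0 < B) :
    marginal q T 0 (goodSet q T Φ R t₀ h N ρ B)ᶜ ≤
      ENNReal.ofReal (d * (2 * Real.exp (1 / 2 + 2 / 5 * R - ρ)) + (N + 1) / B) := by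
  have hsub : (goodSet q T Φ R t₀ h N ρ B)ᶜ ⊆
      (⋃ i : Fin d, {x | normTraj T Φ x t₀ ∈ {η : Vec d | ρ < |η i|}}) ∪
      ⋃ j ∈ Finset.range (N + 1), {x | normTraj T Φ x (t₀ + j * (h / N)) ∈
        {η : Vec d | Real.exp (5 / 8 * (snr T (t₀ + j * (h / N)) ^ 2 * R ^ 2)) / (1 / B) <
          renyi q (snr T (t₀ + j * (h / N)) • η, snr T (t₀ + j * (h / N)) ^ 2)}} := by
    intro x hx
    rw [mem_compl_iff, goodSet, mem_ofPred_eq, not_and_or] at hx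
    rcases hx with hx | hx
    · left
      push Not at hx
      simpa using hx
    · right
      push Not at hx
      obtain ⟨j, hj, hx⟩ := hx
      refine mem_biUnion hj ?_
      rw [mem_ofPred_eq, mem_ofPred_eq, div_div_eq_mul_div, div_one]
      exact hx
  have hcoord : ∀ i : Fin d, marginal q T 0 {x | normTraj T Φ x t₀ ∈ {η : Vec d | ρ < |η i|}} ≤
      ENNReal.ofReal (2 * Real.exp (1 / 2 + 2 / 5 * R - ρ)) := fun i => by
    refine (hΦ.marginal_preimage_le hq ht₀ (by linarith) ?_).trans
      ((setLIntegral_coord_le hq (snr_pos (by linarith)).le i ρ).trans ?_)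
    · exact measurableSet_lt measurable_const
        ((EuclideanSpace.proj (𝕜 := ℝ) i).continuous.abs).measurable
    · have := snr_le (T := T) (t := t₀) (by linarith)
      gcongr
  have hnet : ∀ j ∈ Finset.range (N + 1),
      marginal q T 0 {x | normTraj T Φ x (t₀ + j * (h / N)) ∈
        {η : Vec d | Real.exp (5 / 8 * (snr T (t₀ + j * (h / N)) ^ 2 * R ^ 2)) / (1 / B) <
          renyi q (snr T (t₀ + j * (h / N)) • η, snr T (t₀ + j * (h / N)) ^ 2)}} ≤
      ENNReal.ofReal (1 / B) := fun j hj => by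
    have hm := net_mem t₀ hh (Nat.lt_succ_iff.1 (Finset.mem_range.1 hj))
    refine (hΦ.marginal_preimage_le hq (ht₀.trans hm.1) (by linarith [hm.2]) ?_).trans
      (setLIntegral_renyi_le hq _ (by positivity))
    have : Continuous fun η : Vec d =>
        renyi q (snr T (t₀ + j * (h / N)) • η, snr T (t₀ + j * (h / N)) ^ 2) :=
      (continuous_renyi hq).comp ((continuous_id.const_smul (snr T (t₀ + j * (h / N)))).prodMk
        (continuous_const (y := snr T (t₀ + j * (h / N)) ^ 2)))
    exact measurableSet_lt measurable_const this.measurable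
  refine (measure_mono hsub).trans ((measure_union_le _ _).trans ?_)
  rw [ENNReal.ofReal_add (by positivity) (by positivity)]
  refine add_le_add ?_ ?_
  · refine (measure_iUnion_fintype_le _ _).trans ((Finset.sum_le_sum fun i _ => hcoord i).trans ?_)
    rw [Finset.sum_const, Finset.card_univ, Fintype.card_fin, nsmul_eq_mul,
      ENNReal.ofReal_mul (p := (d : ℝ)) (by positivity), ENNReal.ofReal_natCast]
  · refine (measure_biUnion_finset_le _ _).trans ((Finset.sum_le_sum hnet).trans ?_)
    rw [Finset.sum_const, Finset.card_range, nsmul_eq_mul,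
      div_eq_mul_one_div ((N : ℝ) + 1),
      ENNReal.ofReal_mul (by positivity), ← Nat.cast_add_one, ENNReal.ofReal_natCast]

/-- Transfers goodness from a start under q_0 to a coupled start under ν. The price is an additive
constant in the coordinates and a factor e^{5R/4}, whose logarithm is harmless. -/
theorem goodSet_of_norm_sub_le (hq : q (Metric.closedBall 0 R)ᶜ = 0) {t₀ h : ℝ}
    (hh : 0 ≤ h) (hT : t₀ + h ≤ T - 1) {N : ℕ} {ρ B : ℝ}
    {x y : Vec d} (hx : x ∈ goodSet q T Φ R t₀ h N ρ B)
    (hxy : ∀ j ≤ N, ‖Φ x (t₀ + j * (h / N)) - Φ y (t₀ + j * (h / N))‖ ≤ 1) :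
    y ∈ goodSet q T Φ R t₀ h N (ρ + 2) (Real.exp (5 / 4 * R) * B) := by
  refine ⟨fun i => ?_, fun j hj => ?_⟩
  · have h0 : ‖Φ x t₀ - Φ y t₀‖ ≤ 1 := by simpa using hxy 0 (Nat.zero_le _)
    have hσ := nine_tenths_le_sigma (T := T) (t := t₀) (by linarith)
    have h1 : |normTraj T Φ y t₀ i - normTraj T Φ x t₀ i| ≤ 2 := by
      have h2 : normTraj T Φ y t₀ i - normTraj T Φ x t₀ i =
          ((sigma T t₀)⁻¹ • (Φ y t₀ - Φ x t₀)) i := by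
        simp [normTraj, mul_sub]
      rw [h2, ← Real.norm_eq_abs]
      refine (PiLp.norm_apply_le _ i).trans ?_
      rw [norm_smul, norm_inv, Real.norm_of_nonneg (by linarith), norm_sub_rev,
        inv_mul_le_iff₀ (by linarith)]
      linarith
    have h3 := hx.1 i
    rw [abs_le] at h1 h3 ⊢
    constructor <;> linarith [h1.1, h1.2, h3.1, h3.2]
  · have hj' := Nat.lt_succ_iff.1 (Finset.mem_range.1 hj)
    have hm := net_mem t₀ hh hj'
    refine (renyi_trajParam_le_of_norm_sub_le hq (by linarith [hm.2]) (hxy j hj')).trans ?_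
    rw [mul_left_comm]
    exact mul_le_mul_of_nonneg_left (hx.2 j hj) (Real.exp_pos _).le

theorem norm_le_card_mul {v : Vec d} {ρ : ℝ} (hv : ∀ i, |v i| ≤ ρ) : ‖v‖ ≤ d * ρ := by
  have h : v = ∑ i, v i • EuclideanSpace.single i (1 : ℝ) := by
    ext j
    simp [Finset.sum_apply, Pi.single_apply]
  calc ‖v‖ = ‖∑ i, v i • EuclideanSpace.single i (1 : ℝ)‖ := by rw [← h]
    _ ≤ ∑ i : Fin d, ‖v i • EuclideanSpace.single i (1 : ℝ)‖ := norm_sum_le _ _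
    _ ≤ ∑ _i : Fin d, ρ := Finset.sum_le_sum fun i _ => by
        rw [norm_smul]
        simpa using hv i
    _ = d * ρ := by simp

/-- Here 25/8 = 5/2 + 5/8. With mesh at most 1/N, the log-likelihood moves by at most 1 from a net
time to t, costing e^{5/2}, and w²R² moves by at most 1, costing e^{5/8}. -/
theorem IsProbabilityFlow.goodSet_window (hq : q (Metric.closedBall 0 R)ᶜ = 0) (hR : 0 ≤ R)
    (hΦ : IsProbabilityFlow q T Φ) {t₀ h : ℝ} (ht₀ : 0 ≤ t₀) (hh : 0 ≤ h) (hh1 : h ≤ 1)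
    (hT : t₀ + h ≤ T - 1) {N : ℕ} (hN : 0 < N) {ρ B : ℝ} (hB : 0 ≤ B)
    (hNR : R * (R + d * ρ / 2) ≤ N) {x : Vec d} (hx : x ∈ goodSet q T Φ R t₀ h N ρ B)
    {t : ℝ} (ht : t ∈ Icc t₀ (t₀ + h)) :
    (∀ i, |normTraj T Φ x t i| ≤ ρ + R / 2) ∧
      renyi q (trajParam T Φ x t) ≤ Real.exp (25 / 8 + 5 / 8 * (snr T t ^ 2 * R ^ 2)) * B := by
  have hmem : ∀ r ∈ Icc t₀ (t₀ + h), r ∈ Icc 0 (T - 1) := fun r hr =>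
    ⟨ht₀.trans hr.1, hr.2.trans hT⟩
  have hnear : ∀ r ∈ Icc t₀ (t₀ + h),
      ‖normTraj T Φ x r - normTraj T Φ x t₀‖ ≤ R / 2 := fun r hr => by
    refine (hΦ.norm_normTraj_sub_le hq x (hmem t₀ ⟨le_rfl, by linarith⟩) (hmem r hr)).trans ?_
    have : |r - t₀| ≤ 1 := by
      rw [abs_le]
      constructor <;> linarith [hr.1, hr.2]
    nlinarith
  refine ⟨fun i => ?_, ?_⟩
  · have h1 := (PiLp.norm_apply_le (normTraj T Φ x t - normTraj T Φ x t₀) i).trans (hnear t ht)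
    have h2 := hx.1 i
    rw [Real.norm_eq_abs, PiLp.sub_apply] at h1
    rw [abs_le] at h1 h2 ⊢
    constructor <;> linarith [h1.1, h1.2, h2.1, h2.2]
  · obtain ⟨j, hj, hjt⟩ := exists_net_near ht hh1 hN
    have hm := net_mem t₀ hh hj
    have hgood := hx.2 j (Finset.mem_range.2 (Nat.lt_succ_of_le hj))
    set r := t₀ + j * (h / N) with hr
    have hN' : (0 : ℝ) < N := by exact_mod_cast hN
    have hYr : ‖normTraj T Φ x r‖ ≤ d * ρ + R / 2 := by
      have h1 := norm_le_card_mul hx.1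
      have h2 := norm_sub_norm_le (normTraj T Φ x r) (normTraj T Φ x t₀)
      linarith [hnear r hm]
    have hdρ : 0 ≤ (d : ℝ) * ρ := (norm_nonneg _).trans (norm_le_card_mul hx.1)
    have hb : |t - r| * (R * (2 / 5 * R + ‖normTraj T Φ x r‖ / 2)) ≤ 1 := by
      have e : 2 / 5 * R + ‖normTraj T Φ x r‖ / 2 ≤ R + d * ρ / 2 := by linarith
      calc _ ≤ 1 / N * (R * (R + d * ρ / 2)) :=
            mul_le_mul hjt (mul_le_mul_of_nonneg_left e hR) (by positivity) (by positivity)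
        _ ≤ 1 / N * N := by gcongr
        _ = 1 := by field_simp
    have hw : snr T r ^ 2 * R ^ 2 ≤ snr T t ^ 2 * R ^ 2 + 1 := by
      have h1 := abs_snr_sub_le (hmem t ht).2 (hmem r hm).2
      have h2 := snr_le (hmem r hm).2
      have h3 := snr_le (hmem t ht).2
      have hwt := snr_pos (T := T) (t := t) (by linarith [(hmem t ht).2])
      have hwr := snr_pos (T := T) (t := r) (by linarith [(hmem r hm).2])
      rw [abs_sub_comm r t] at h1
      have h4 : snr T r ^ 2 - snr T t ^ 2 ≤ |t - r| := by
        have h5 := (abs_le.1 h1).2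
        nlinarith [abs_nonneg (t - r)]
      have h6 : |t - r| * R ^ 2 ≤ 1 := by
        calc _ ≤ 1 / N * (R * (R + d * ρ / 2)) := by
              rw [sq]
              gcongr
              linarith
          _ ≤ 1 / N * N := by gcongr
          _ = 1 := by field_simp
      nlinarith [sq_nonneg R]
    calc renyi q (trajParam T Φ x t) ≤ Real.exp (5 / 2 * 1) * renyi q (trajParam T Φ x r) :=
          hΦ.renyi_trajParam_le hq hR x (hmem r hm) (hmem t ht) hb
      _ ≤ Real.exp (5 / 2 * 1) * (Real.exp (5 / 8 * (snr T r ^ 2 * R ^ 2)) * B) := by gcongr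
      _ = Real.exp (5 / 2 * 1 + 5 / 8 * (snr T r ^ 2 * R ^ 2)) * B := by
          rw [Real.exp_add, mul_assoc]
      _ ≤ _ := mul_le_mul_of_nonneg_right (Real.exp_le_exp.2 (by linarith)) hB

theorem IsProbabilityFlow.abs_iteratedDerivWithin_fieldAlong_le_of_goodSet
    (hq : q (Metric.closedBall 0 R)ᶜ = 0) (hR : 0 ≤ R)
    (hΦ : IsProbabilityFlow q T Φ) {t₀ h : ℝ} (ht₀ : 0 ≤ t₀) (hh : 0 ≤ h) (hh1 : h ≤ 1)
    (hT : t₀ + h ≤ T - 1) {N : ℕ} (hN : 0 < N) {ρ B : ℝ} (hB : 1 ≤ B)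
    (hNR : R * (R + d * ρ / 2) ≤ N) {x : Vec d} (hx : x ∈ goodSet q T Φ R t₀ h N ρ B)
    {t : ℝ} (ht : t ∈ Icc t₀ (t₀ + h)) (k : ℕ) (i : Fin d) :
    |iteratedDerivWithin k (fieldAlong q T Φ x) (Ico 0 T) t i| ≤
      (k + 1).factorial * (4 * R * (11 / 4 * (151 / 25 * (snr T t ^ 2 * R ^ 2) +
        4 * Real.log B + 56) / sigma T t ^ 2) ^ k + (ρ + R / 2) * 2 ^ (k + 2)) := by
  have hTt : t < T := by linarith [ht.2]
  have hσ := sigma_pos hTt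
  have hlog := Real.log_nonneg hB
  obtain ⟨h1, h2⟩ := hΦ.goodSet_window hq hR ht₀ hh hh1 hT hN (by linarith) hNR hx ht
  set s := snr T t ^ 2 * R ^ 2 with hs
  have hs0 : 0 ≤ s := by positivity
  -- The radius will be κ₀ = (2/5)/D. `D` dominates Λ + (7/2)(1 + κ₀)s because 5/2 + (7/2)(101/100)
  -- ≤ 151/25, and D ≥ 56 gives κ₀ ≤ 1/100.
  set D := 151 / 25 * s + 4 * Real.log B + 56 with hD
  have hD0 : 56 ≤ D := by linarith
  -- 16 = 4(25/8 + 7/8), where e^{7/8} ≥ 2 absorbs the summand 1 of 1 + `renyi`.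
  set Λ := 5 / 2 * s + 4 * Real.log B + 16 with hΛ
  have hκ : 2 / 5 / D ≤ 1 / 100 := by
    rw [div_le_iff₀ (by linarith)]
    linarith
  have hCB : CBound (posterior q (snr T t • normTraj T Φ x t, snr T t ^ 2)) (snr T t)
      (logPost q (snr T t • normTraj T Φ x t, snr T t ^ 2)) R (2 / 5 / D) Λ := by
    refine ⟨posterior_compl_eq_zero hq _, continuous_logPost _, (snr_pos hTt).le, by positivity,
      by linarith, ?_, ?_⟩
    · refine (integral_exp_abs_logPost_le hq _).trans ?_
      have h3 : Real.exp (25 / 8 + 5 / 8 * s) * B =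
          Real.exp (25 / 8 + 5 / 8 * s + Real.log B) := by
        rw [Real.exp_add _ (Real.log B), Real.exp_log (by linarith)]
      have h4 : (1 : ℝ) ≤ Real.exp (25 / 8 + 5 / 8 * s + Real.log B) :=
        Real.one_le_exp (by positivity)
      have h5 : (2 : ℝ) ≤ Real.exp (7 / 8) := by
        have h6 := Real.quadratic_le_exp_of_nonneg (x := 7 / 8) (by norm_num)
        norm_num at h6
        linarith
      calc 1 + renyi q (trajParam T Φ x t)
          ≤ 2 * Real.exp (25 / 8 + 5 / 8 * s + Real.log B) := by rw [h3] at h2; linarith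
        _ ≤ Real.exp (7 / 8) * Real.exp (25 / 8 + 5 / 8 * s + Real.log B) := by gcongr
        _ = Real.exp (Λ / 4) := by
            rw [← Real.exp_add, hΛ]
            congr 1
            ring
    · rw [← hs]
      calc 2 / 5 / D * (Λ + 7 / 2 * (1 + 2 / 5 / D) * s) ≤ 2 / 5 / D * D := by
            gcongr
            rw [hΛ, hD]
            nlinarith
        _ = 2 / 5 := by field_simp
  refine (hΦ.abs_iteratedDerivWithin_fieldAlong_le hq hR x ⟨ht₀.trans ht.1, hTt⟩
    (by linarith [ht.2]) hκ hCB k i).trans ?_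
  have e : 11 / 10 / (2 / 5 / D * sigma T t ^ 2) = 11 / 4 * D / sigma T t ^ 2 := by
    field_simp
    norm_num
  rw [e]
  gcongr
  exact h1 i

end GoodEvent

/-! ### Factorials against powers; the absolute constant. -/

section Numerics

theorem factorial_le_pow_mul_exp {k : ℕ} (hk : 1 ≤ k) :
    (k.factorial : ℝ) ≤ (k : ℝ) ^ (k + 1) * Real.exp (1 - k) := by
  induction k, hk using Nat.le_induction with
  | base => simp
  | succ k hk ih =>
    have hk0 : (0 : ℝ) < k := by exact_mod_cast hk
    have h1 : Real.exp 1 * (k : ℝ) ^ (k + 1) ≤ ((k : ℝ) + 1) ^ (k + 1) := by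
      have h2 : (k : ℝ) / (k + 1) ≤ Real.exp (-(1 / (k + 1))) := by
        have := Real.add_one_le_exp (-(1 / ((k : ℝ) + 1)))
        refine le_trans (le_of_eq ?_) this
        field_simp
        ring
      have h3 : ((k : ℝ) / (k + 1)) ^ (k + 1) ≤ Real.exp (-1) := by
        calc _ ≤ Real.exp (-(1 / (k + 1))) ^ (k + 1) := by gcongr
          _ = Real.exp (-1) := by
            rw [← Real.exp_nat_mul]
            congr 1
            push_cast
            field_simp
      rw [div_pow, div_le_iff₀ (by positivity), Real.exp_neg, inv_mul_eq_div,
        le_div_iff₀ (Real.exp_pos 1)] at h3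
      linarith
    rw [Nat.factorial_succ]
    push_cast
    calc ((k : ℝ) + 1) * k.factorial ≤ (k + 1) * ((k : ℝ) ^ (k + 1) * Real.exp (1 - k)) := by
          gcongr
      _ = (k + 1) * Real.exp (1 - (k + 1)) * (Real.exp 1 * (k : ℝ) ^ (k + 1)) := by
          have : (1 : ℝ) - k = 1 - (k + 1) + 1 := by ring
          rw [this, Real.exp_add]
          ring_nf
      _ ≤ (k + 1) * Real.exp (1 - (k + 1)) * ((k : ℝ) + 1) ^ (k + 1) := by gcongr
      _ = _ := by ring

/-- From k! ≤ ek(k/e)^k the quotient is of order k²(A/e)^k, which is bounded exactly because A < e.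
-/
theorem exists_factorial_mul_pow_le_pow {A : ℝ} (hA : 0 ≤ A) (hAe : A < Real.exp 1) :
    ∃ C : ℝ, 0 < C ∧ ∀ k : ℕ, 1 ≤ k → ((k + 1).factorial : ℝ) * A ^ k ≤ C * (k : ℝ) ^ k := by
  have hr : |A / Real.exp 1| < 1 := by
    rw [abs_of_nonneg (by positivity), div_lt_one (Real.exp_pos 1)]
    exact hAe
  obtain ⟨C, hC⟩ := (tendsto_pow_const_mul_const_pow_of_abs_lt_one 2 hr).bddAbove_range
  refine ⟨2 * Real.exp 1 * (|C| + 1), by positivity, fun k hk => ?_⟩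
  have hk1 : (1 : ℝ) ≤ k := by exact_mod_cast hk
  have h1 : (k : ℝ) ^ 2 * (A / Real.exp 1) ^ k ≤ |C| + 1 := by
    have h2 : (k : ℝ) ^ 2 * (A / Real.exp 1) ^ k ≤ C := hC ⟨k, rfl⟩
    linarith [le_abs_self C]
  rw [Nat.factorial_succ]
  push_cast
  calc ((k : ℝ) + 1) * k.factorial * A ^ k
      ≤ (k + k) * ((k : ℝ) ^ (k + 1) * Real.exp (1 - k)) * A ^ k := by
        gcongr
        exact factorial_le_pow_mul_exp hk
    _ = 2 * Real.exp 1 * ((k : ℝ) ^ 2 * (A / Real.exp 1) ^ k) * (k : ℝ) ^ k := by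
        rw [Real.exp_sub, div_pow, ← Real.exp_nat_mul, mul_one]
        ring
    _ ≤ _ := by gcongr

/-- Any `A` is allowed here, since k^{2k} leaves a spare k^k that eventually beats (2A)^k. -/
theorem exists_factorial_mul_pow_le_pow_two_mul {A : ℝ} (hA : 1 ≤ A) :
    ∃ C : ℝ, 0 < C ∧ ∀ k : ℕ, 1 ≤ k →
      ((k + 1).factorial : ℝ) * A ^ k ≤ C * (k : ℝ) ^ (2 * k) := by
  refine ⟨(2 * A) ^ ⌈2 * A⌉₊, by positivity, fun k hk => ?_⟩
  have hk1 : (1 : ℝ) ≤ k := by exact_mod_cast hk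
  have h1 : (2 * A) ^ k ≤ (2 * A) ^ ⌈2 * A⌉₊ * (k : ℝ) ^ k := by
    rcases le_total (2 * A) k with h | h
    · calc (2 * A) ^ k ≤ (k : ℝ) ^ k := by gcongr
        _ ≤ (2 * A) ^ ⌈2 * A⌉₊ * (k : ℝ) ^ k :=
          le_mul_of_one_le_left (by positivity) (one_le_pow₀ (by linarith))
    · have h2 : k ≤ ⌈2 * A⌉₊ := by exact_mod_cast h.trans (Nat.le_ceil _)
      calc (2 * A) ^ k ≤ (2 * A) ^ ⌈2 * A⌉₊ := pow_le_pow_right₀ (by linarith) h2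
        _ ≤ _ := le_mul_of_one_le_right (by positivity) (one_le_pow₀ hk1)
  have h3 : ((k : ℝ) + 1) ≤ 2 ^ k := by exact_mod_cast Nat.lt_two_pow_self
  have h4 : (k.factorial : ℝ) ≤ (k : ℝ) ^ k := by exact_mod_cast Nat.factorial_le_pow k
  rw [Nat.factorial_succ]
  push_cast
  calc ((k : ℝ) + 1) * k.factorial * A ^ k ≤ 2 ^ k * (k : ℝ) ^ k * A ^ k := by gcongr
    _ = (2 * A) ^ k * (k : ℝ) ^ k := by rw [mul_pow]; ring
    _ ≤ (2 * A) ^ ⌈2 * A⌉₊ * (k : ℝ) ^ k * (k : ℝ) ^ k := by gcongr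
    _ = _ := by rw [two_mul k, pow_add]; ring

/-- 11/4 · 151/25 · 17/125 is about 2.26. The gap up to 12/5 absorbs the terms linear in R and L
once R² ≥ 150000 L. -/
theorem bracket_le_of_large {R L σ s D : ℝ} (hR : 0 < R) (hL : 4 ≤ L) (hσ : 9 / 10 ≤ σ)
    (hσ1 : σ ≤ 1) (hs : s ≤ 17 / 125 * R ^ 2 / σ ^ 2)
    (hD : D ≤ 151 / 25 * s + 13 * R + 12 * L + 72) (hRL : 150000 * L ≤ R ^ 2) :
    11 / 4 * D / σ ^ 2 ≤ 12 / 5 * (R ^ 2 / σ ^ 4) := by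
  have hσ0 : 0 < σ := by linarith
  have hσ2 : σ ^ 2 ≤ 1 := pow_le_one₀ hσ0.le hσ1
  have h1 : R ^ 2 ≤ R ^ 2 / σ ^ 2 := by
    rw [le_div_iff₀ (by positivity)]
    nlinarith [sq_nonneg R]
  have h2 : 750 ≤ R := by nlinarith
  have h3 : 11 / 4 * D ≤ 12 / 5 * (R ^ 2 / σ ^ 2) := by
    have h4 : 17 / 125 * R ^ 2 / σ ^ 2 = 17 / 125 * (R ^ 2 / σ ^ 2) := by ring
    rw [h4] at hs
    nlinarith
  calc 11 / 4 * D / σ ^ 2 ≤ 12 / 5 * (R ^ 2 / σ ^ 2) / σ ^ 2 := by gcongr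
    _ = _ := by field_simp

theorem bracket_le_of_small {R L σ s D : ℝ} (hR : 0 < R) (hL : 4 ≤ L) (hσ : 9 / 10 ≤ σ)
    (hs : s ≤ 17 / 125 * R ^ 2 / σ ^ 2)
    (hD : D ≤ 151 / 25 * s + 13 * R + 12 * L + 72) (hRL : R ^ 2 ≤ 150000 * L) :
    R ≤ 400 * L ∧ 11 / 4 * D / σ ^ 2 ≤ 550000 * L := by
  have h1 : R ≤ 400 * L := by nlinarith
  have hσ2 : 81 / 100 ≤ σ ^ 2 := by nlinarith
  have h2 : 17 / 125 * R ^ 2 / σ ^ 2 ≤ 25200 * L := by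
    rw [div_le_iff₀ (by linarith)]
    nlinarith
  refine ⟨h1, ?_⟩
  rw [div_le_iff₀ (by linarith)]
  nlinarith

theorem exists_numeric_bound : ∃ C : ℝ, 0 < C ∧ ∀ (k : ℕ) (R L σ s D : ℝ), 1 ≤ k → 0 < R →
    4 ≤ L → 9 / 10 ≤ σ → σ ≤ 1 → s ≤ 17 / 125 * R ^ 2 / σ ^ 2 → 0 ≤ D →
    D ≤ 151 / 25 * s + 13 * R + 12 * L + 72 →
    ((k + 1).factorial : ℝ) * (4 * R * (11 / 4 * D / σ ^ 2) ^ k +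
      (5 / 2 + 9 / 10 * R + L) * 2 ^ (k + 2)) ≤
      C * (R * (k / σ ^ 2) ^ k * (R / σ) ^ (2 * k) + (k * L) ^ (2 * k)) := by
  obtain ⟨C₁, hC₁, h₁⟩ := exists_factorial_mul_pow_le_pow (A := 12 / 5) (by norm_num)
    (by linarith [Real.exp_one_gt_d9])
  obtain ⟨C₂, hC₂, h₂⟩ := exists_factorial_mul_pow_le_pow_two_mul (A := 550000) (by norm_num)
  refine ⟨8 * C₁ + 3200 * C₂, by positivity, fun k R L σ s D hk hR hL hσ hσ1 hs hD0 hD => ?_⟩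
  have hσ0 : 0 < σ := by linarith
  have hk1 : (1 : ℝ) ≤ k := by exact_mod_cast hk
  set P := R * (k / σ ^ 2) ^ k * (R / σ) ^ (2 * k) with hP
  set Q := (k * L) ^ (2 * k) with hQ
  have hP0 : 0 ≤ P := by positivity
  have hQ0 : 0 ≤ Q := by positivity
  have hPe : P = R * ((k : ℝ) ^ k * (R ^ 2 / σ ^ 4) ^ k) := by
    rw [hP, pow_mul, mul_assoc, ← mul_pow, ← mul_pow]
    congr 2
    field_simp
  have hL2k : L ≤ L ^ (2 * k) := le_self_pow₀ (by linarith) (by omega)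
  have hQL : (k : ℝ) ^ (2 * k) * L ≤ Q := by
    rw [hQ, mul_pow]
    gcongr
  have h22 : ((k + 1).factorial : ℝ) * 2 ^ k ≤ C₂ * (k : ℝ) ^ (2 * k) := by
    refine le_trans ?_ (h₂ k hk)
    gcongr
    norm_num
  have h21 : ((k + 1).factorial : ℝ) * 2 ^ k ≤ C₁ * (k : ℝ) ^ k := by
    refine le_trans ?_ (h₁ k hk)
    gcongr
    norm_num
  have hconst : ((k + 1).factorial : ℝ) * ((5 / 2 + L) * 2 ^ (k + 2)) ≤ 8 * (C₂ * Q) := by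
    calc _ = 4 * ((k + 1).factorial * 2 ^ k) * (5 / 2 + L) := by ring
      _ ≤ 4 * (C₂ * (k : ℝ) ^ (2 * k)) * (2 * L) := by
          gcongr
          linarith
      _ = 8 * (C₂ * ((k : ℝ) ^ (2 * k) * L)) := by ring
      _ ≤ _ := by gcongr
  have hsplit : ((k + 1).factorial : ℝ) * (4 * R * (11 / 4 * D / σ ^ 2) ^ k +
      (5 / 2 + 9 / 10 * R + L) * 2 ^ (k + 2)) =
      4 * R * ((k + 1).factorial * (11 / 4 * D / σ ^ 2) ^ k) +
      (k + 1).factorial * ((5 / 2 + L) * 2 ^ (k + 2)) +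
      18 / 5 * R * ((k + 1).factorial * 2 ^ k) := by
    ring
  rw [hsplit]
  -- For large R the first term of the bound dominates, with base 12/5 < e. Otherwise R and the
  -- bracket are at most multiples of L, and (kL)^{2k} takes over.
  rcases le_total (150000 * L) (R ^ 2) with hRL | hRL
  · have hbr := bracket_le_of_large hR hL hσ hσ1 hs hD hRL
    have t1 : 4 * R * ((k + 1).factorial * (11 / 4 * D / σ ^ 2) ^ k) ≤ 4 * (C₁ * P) := by
      calc _ ≤ 4 * R * ((k + 1).factorial * (12 / 5 * (R ^ 2 / σ ^ 4)) ^ k) := by gcongr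
        _ = 4 * R * ((k + 1).factorial * (12 / 5) ^ k * (R ^ 2 / σ ^ 4) ^ k) := by
            rw [mul_pow]; ring
        _ ≤ 4 * R * (C₁ * (k : ℝ) ^ k * (R ^ 2 / σ ^ 4) ^ k) :=
            mul_le_mul_of_nonneg_left (mul_le_mul_of_nonneg_right (h₁ k hk) (by positivity))
              (by positivity)
        _ = _ := by rw [hPe]; ring
    have t2 : 18 / 5 * R * ((k + 1).factorial * 2 ^ k) ≤ 4 * (C₁ * P) := by
      have h1 : 1 ≤ R ^ 2 / σ ^ 4 := by
        rw [one_le_div (by positivity)]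
        have : σ ^ 4 ≤ 1 := pow_le_one₀ hσ0.le hσ1
        nlinarith
      calc _ ≤ 4 * R * (C₁ * (k : ℝ) ^ k) := by
            gcongr
            norm_num
        _ ≤ 4 * R * (C₁ * (k : ℝ) ^ k) * (R ^ 2 / σ ^ 4) ^ k :=
            le_mul_of_one_le_right (by positivity) (one_le_pow₀ h1)
        _ = _ := by rw [hPe]; ring
    nlinarith [mul_nonneg hC₂.le hQ0, mul_nonneg hC₁.le hQ0, mul_nonneg hC₂.le hP0]
  · obtain ⟨hRL', hbr⟩ := bracket_le_of_small hR hL hσ hs hD hRL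
    have hLk : L * L ^ k ≤ L ^ (2 * k) := by
      rw [← pow_succ']
      exact pow_le_pow_right₀ (by linarith) (by omega)
    have t1 : 4 * R * ((k + 1).factorial * (11 / 4 * D / σ ^ 2) ^ k) ≤ 1600 * (C₂ * Q) := by
      calc _ ≤ 4 * (400 * L) * ((k + 1).factorial * (550000 * L) ^ k) := by gcongr
        _ = 1600 * ((k + 1).factorial * 550000 ^ k * (L * L ^ k)) := by
            rw [mul_pow]; ring
        _ ≤ 1600 * (C₂ * (k : ℝ) ^ (2 * k) * L ^ (2 * k)) := by
            refine mul_le_mul_of_nonneg_left ?_ (by norm_num)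
            exact mul_le_mul (h₂ k hk) hLk (by positivity) (by positivity)
        _ = _ := by rw [hQ, mul_pow]; ring
    have t2 : 18 / 5 * R * ((k + 1).factorial * 2 ^ k) ≤ 1440 * (C₂ * Q) := by
      calc _ ≤ 18 / 5 * (400 * L) * (C₂ * (k : ℝ) ^ (2 * k)) := by gcongr
        _ = 1440 * (C₂ * ((k : ℝ) ^ (2 * k) * L)) := by ring
        _ ≤ _ := by gcongr
    nlinarith [mul_nonneg hC₁.le hQ0, mul_nonneg hC₁.le hP0, mul_nonneg hC₂.le hP0,
      mul_nonneg hC₂.le hQ0]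

end Numerics

/-! ### Dependence on the initial value, uniformly in T; couplings. -/

section Stability

variable {d : ℕ} {q : Measure (Vec d)} [IsProbabilityMeasure q] {R T : ℝ}
  {Φ : Vec d → ℝ → Vec d}

/-- The squared distance of two trajectories grows at rate at most 2R²(w²)', so e^{-2R²w²} times it
decreases. As w < 1 up to time T - 1, the constant depends on R alone and not on the elapsed time.
-/
theorem IsProbabilityFlow.norm_normTraj_sub_normTraj_le (hq : q (Metric.closedBall 0 R)ᶜ = 0)
    (hΦ : IsProbabilityFlow q T Φ) (x y : Vec d) {t : ℝ} (ht : t ∈ Icc 0 (T - 1)) :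
    ‖normTraj T Φ x t - normTraj T Φ y t‖ ≤
      Real.exp (R ^ 2) * ‖normTraj T Φ x 0 - normTraj T Φ y 0‖ := by
  set Δ : ℝ → Vec d := fun r => normTraj T Φ x r - normTraj T Φ y r with hΔ
  have htT : t < T := by linarith [ht.2]
  have hd : ∀ r ∈ Icc 0 t, HasDerivWithinAt
      (fun r => Real.exp (-(2 * R ^ 2) * snr T r ^ 2) * ‖Δ r‖ ^ 2)
      (Real.exp (-(2 * R ^ 2) * snr T r ^ 2) *
          (-(2 * R ^ 2) * (2 * snr T r * (snr T r / sigma T r ^ 2))) * ‖Δ r‖ ^ 2 +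
        Real.exp (-(2 * R ^ 2) * snr T r ^ 2) * (2 * inner ℝ (Δ r)
          (normField q T r (normTraj T Φ x r) - normField q T r (normTraj T Φ y r))))
      (Icc 0 t) r := fun r hr => by
    have h1 := (hasDerivAt_snr (T := T) (t := r) (by linarith [hr.2])).hasDerivWithinAt
      (s := Icc 0 t)
    have h2 := ((h1.fun_pow 2).const_mul (-(2 * R ^ 2))).exp
    have h3 := ((hΦ.hasDerivWithinAt_Icc hq htT x hr).sub
      (hΦ.hasDerivWithinAt_Icc hq htT y hr)).norm_sq
    refine (h2.mul h3).congr_deriv ?_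
    simp only [hΔ, Pi.sub_apply, Nat.cast_ofNat, Nat.add_one_sub_one, pow_one]
  have hanti : AntitoneOn (fun r => Real.exp (-(2 * R ^ 2) * snr T r ^ 2) * ‖Δ r‖ ^ 2)
      (Icc 0 t) := by
    refine antitoneOn_of_hasDerivWithinAt_nonpos (convex_Icc 0 t)
      (fun r hr => (hd r hr).continuousWithinAt)
      (fun r hr => (hd r (interior_subset hr)).mono interior_subset) fun r hr => ?_
    have hrT : r < T := by linarith [(interior_subset hr).2]
    have hw := snr_pos hrT
    have hσ := sigma_pos hrT
    have h1 : inner ℝ (Δ r)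
        (normField q T r (normTraj T Φ x r) - normField q T r (normTraj T Φ y r)) ≤
        snr T r / sigma T r ^ 2 * (snr T r * (2 * R ^ 2)) * ‖Δ r‖ ^ 2 := by
      refine (real_inner_le_norm _ _).trans ?_
      have h2 := norm_postMean_sub_le hq (snr T r) (normTraj T Φ x r) (normTraj T Φ y r)
      rw [abs_of_pos hw] at h2
      rw [normField, normField, ← smul_sub, norm_smul, Real.norm_of_nonneg (by positivity)]
      calc _ ≤ ‖Δ r‖ * (snr T r / sigma T r ^ 2 * (snr T r * (2 * R ^ 2) * ‖Δ r‖)) := by gcongr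
        _ = _ := by ring
    rw [mul_assoc, ← mul_add]
    refine mul_nonpos_of_nonneg_of_nonpos (Real.exp_pos _).le ?_
    calc _ ≤ -(2 * R ^ 2) * (2 * snr T r * (snr T r / sigma T r ^ 2)) * ‖Δ r‖ ^ 2 +
          2 * (snr T r / sigma T r ^ 2 * (snr T r * (2 * R ^ 2)) * ‖Δ r‖ ^ 2) := by gcongr
      _ = 0 := by ring
      _ ≤ 0 := le_rfl
  have h := hanti (left_mem_Icc.2 ht.1) (right_mem_Icc.2 ht.1) ht.1
  simp only at h
  have hw := snr_pos htT
  have hw' := snr_le ht.2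
  have h1 : Real.exp (-(2 * R ^ 2)) ≤ Real.exp (-(2 * R ^ 2) * snr T t ^ 2) := by
    refine Real.exp_le_exp.2 ?_
    have : snr T t ^ 2 ≤ 1 := by nlinarith
    nlinarith [sq_nonneg R]
  have h2 : Real.exp (-(2 * R ^ 2) * snr T 0 ^ 2) ≤ 1 :=
    Real.exp_le_one_iff.2 (by nlinarith [mul_nonneg (sq_nonneg R) (sq_nonneg (snr T 0))])
  have h3 : Real.exp (-(2 * R ^ 2)) * ‖Δ t‖ ^ 2 ≤ ‖Δ 0‖ ^ 2 := by
    calc _ ≤ Real.exp (-(2 * R ^ 2) * snr T t ^ 2) * ‖Δ t‖ ^ 2 := by gcongr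
      _ ≤ _ := h
      _ ≤ 1 * ‖Δ 0‖ ^ 2 := by gcongr
      _ = _ := one_mul _
  refine le_of_sq_le_sq ?_ (by positivity)
  rw [Real.exp_neg, inv_mul_le_iff₀ (Real.exp_pos _)] at h3
  refine h3.trans (le_of_eq ?_)
  rw [mul_pow, ← Real.exp_nat_mul]
  push_cast
  rfl

theorem IsProbabilityFlow.norm_sub_le (hq : q (Metric.closedBall 0 R)ᶜ = 0)
    (hΦ : IsProbabilityFlow q T Φ) (x y : Vec d) {t : ℝ} (ht : t ∈ Icc 0 (T - 1)) :
    ‖Φ x t - Φ y t‖ ≤ 2 * Real.exp (R ^ 2) * ‖x - y‖ := by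
  have h := hΦ.norm_normTraj_sub_normTraj_le hq x y ht
  have hσ := sigma_pos (T := T) (t := t) (by linarith [ht.2])
  have hσ0 := nine_tenths_le_sigma (T := T) (t := 0) (by linarith [ht.1, ht.2])
  rw [hΦ.normTraj_zero, hΦ.normTraj_zero, normTraj, normTraj, ← smul_sub, ← smul_sub, norm_smul,
    norm_smul, norm_inv, norm_inv, Real.norm_of_nonneg hσ.le,
    Real.norm_of_nonneg (by linarith), inv_mul_le_iff₀ hσ] at h
  have h1 : (sigma T 0)⁻¹ ≤ 2 := by
    rw [inv_le_comm₀ (by linarith) (by norm_num)]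
    linarith
  calc _ ≤ _ := h
    _ ≤ 1 * (Real.exp (R ^ 2) * (2 * ‖x - y‖)) := by
        gcongr
        exact sigma_le_one T t
    _ = _ := by ring

/-- The factor 4 is slack, so that the infimum need not be attained. -/
theorem exists_coupling_of_wassersteinTwo_le {μ ν : Measure (Vec d)} {δ : ℝ} (hδ : 0 < δ)
    (h : wassersteinTwo μ ν ≤ ENNReal.ofReal δ) :
    ∃ π, IsCoupling μ ν π ∧ ∫⁻ p, edist p.1 p.2 ^ 2 ∂π ≤ ENNReal.ofReal (4 * δ ^ 2) := by
  have h1 : (⨅ (π : Measure (Vec d × Vec d)) (_ : IsCoupling μ ν π),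
      ∫⁻ p, edist p.1 p.2 ^ 2 ∂π) < ENNReal.ofReal (4 * δ ^ 2) := by
    have h2 := ENNReal.rpow_le_rpow h (by norm_num : (0 : ℝ) ≤ 2)
    rw [wassersteinTwo, ← ENNReal.rpow_mul] at h2
    norm_num at h2
    refine h2.trans_lt ?_
    rw [← ENNReal.ofReal_pow hδ.le, ENNReal.ofReal_lt_ofReal_iff (by positivity)]
    nlinarith
  simp only [iInf_lt_iff] at h1
  obtain ⟨π, hπ, hlt⟩ := h1
  exact ⟨π, hπ, hlt.le⟩

theorem IsCoupling.swap {μ ν : Measure (Vec d)} {π : Measure (Vec d × Vec d)}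
    (h : IsCoupling μ ν π) : IsCoupling ν μ (π.map Prod.swap) := by
  constructor
  · rw [Measure.map_map measurable_fst measurable_swap]
    exact h.2
  · rw [Measure.map_map measurable_snd measurable_swap]
    exact h.1

end Stability

/-! ### Choice of parameters and the failure probability. -/

section Probability

/-- The net size is polynomial in R, d and log(8d/δ₂). Its factor d is absorbed into log(8d/δ₂), and
log x ≤ x - 1 makes the rest linear in R and L. -/
theorem log_net_le {d : ℕ} {R δ L : ℝ} (hd : 1 ≤ d) (hR : 0 < R) (hδ : 0 < δ) (hδ1 : δ < 1)
    (hL : Real.log (8 * d / δ) ≤ L) (hL4 : 4 ≤ L) {N : ℕ}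
    (hN : (N : ℝ) ≤ R * (R + d * (5 / 2 + 2 / 5 * R + Real.log (8 * d / δ)) / 2) + 2) :
    0 ≤ Real.log (4 * (N + 1) / δ) ∧
      Real.log (4 * (N + 1) / δ) ≤ 2 * R + 3 * L + 4 := by
  have hd1 : (1 : ℝ) ≤ d := by exact_mod_cast hd
  constructor
  · refine Real.log_nonneg ?_
    rw [one_le_div hδ]
    have : (0 : ℝ) ≤ N := by positivity
    linarith
  · have h1 : (N : ℝ) + 1 ≤ 2 * d * (R + L + 3) ^ 2 := by
      have h2 : R * (R + d * (5 / 2 + 2 / 5 * R + Real.log (8 * d / δ)) / 2) ≤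
          d * (R * (R + (5 / 2 + 2 / 5 * R + L) / 2)) := by
        calc _ ≤ R * (d * R + d * (5 / 2 + 2 / 5 * R + L) / 2) := by
              gcongr
              nlinarith
          _ = _ := by ring
      have h3 : R * (R + (5 / 2 + 2 / 5 * R + L) / 2) + 3 ≤ 2 * (R + L + 3) ^ 2 := by nlinarith
      nlinarith
    have h4 : 4 * ((N : ℝ) + 1) / δ ≤ 8 * d / δ * (R + L + 3) ^ 2 := by
      rw [div_mul_eq_mul_div]
      exact div_le_div_of_nonneg_right (by linarith) hδ.le
    calc _ ≤ Real.log (8 * d / δ * (R + L + 3) ^ 2) := Real.log_le_log (by positivity) h4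
      _ = Real.log (8 * d / δ) + 2 * Real.log (R + L + 3) := by
          rw [Real.log_mul (by positivity) (by positivity), Real.log_pow]
          norm_num
      _ ≤ L + 2 * (R + L + 3 - 1) := by
          gcongr
          exact Real.log_le_sub_one_of_pos (by positivity)
      _ = _ := by ring

/-- Common core of both parts: δ₂/2 pays for bad starts under q_0, and the other term is the
probability that the coupled trajectories separate by more than 1. -/
theorem exists_const_measure_not_derivBoundOn_le :
    ∃ C : ℝ, 0 < C ∧ ∀ (d k : ℕ) (R δ₂ : ℝ), 1 ≤ d → 1 ≤ k → 0 < R → 0 < δ₂ → δ₂ < 1 →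
      ∀ (q : Measure (Vec d)) [IsProbabilityMeasure q], q (Metric.closedBall 0 R)ᶜ = 0 →
      ∀ T t₀ h : ℝ, 0 ≤ t₀ → 0 ≤ h → h ≤ 1 → t₀ + h ≤ T - 1 →
      ∀ Φ : Vec d → ℝ → Vec d, IsProbabilityFlow q T Φ →
      ∀ (ν : Measure (Vec d)) (π : Measure (Vec d × Vec d)), IsCoupling (marginal q T 0) ν π →
        ν {x | ¬ DerivBoundOn q T Φ C k R δ₂ t₀ h x} ≤ ENNReal.ofReal (δ₂ / 2) +
          π {p | ¬ ∀ t ∈ Icc t₀ (t₀ + h), ‖Φ p.1 t - Φ p.2 t‖ ≤ 1} := by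
  obtain ⟨C, hC, hnum⟩ := exists_numeric_bound
  refine ⟨C, hC, fun d k R δ₂ hd hk hR hδ hδ1 q _ hq T t₀ h ht₀ hh hh1 hT Φ hΦ ν π hπ => ?_⟩
  have hd1 : (1 : ℝ) ≤ d := by exact_mod_cast hd
  have hk1 : (1 : ℝ) ≤ k := by exact_mod_cast hk
  set L := Real.log (74 * k * d / δ₂) with hLdef
  set l := Real.log (8 * d / δ₂) with hl
  have hlL : l ≤ L := by
    refine Real.log_le_log (by positivity) ?_
    gcongr
    nlinarith
  have hL4 : 4 ≤ L := by
    rw [hLdef, Real.le_log_iff_exp_le (by positivity)]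
    have h1 : Real.exp 4 ≤ 74 := by
      have h2 := Real.exp_one_lt_d9
      have h3 : Real.exp 4 = Real.exp 1 ^ 4 := by
        rw [← Real.exp_nat_mul]
        norm_num
      rw [h3]
      calc Real.exp 1 ^ 4 ≤ (2.7182818286 : ℝ) ^ 4 := by gcongr
        _ ≤ 74 := by norm_num
    rw [le_div_iff₀ hδ]
    have : (1 : ℝ) ≤ k * d := by nlinarith
    nlinarith [Real.exp_pos 4]
  -- Each coordinate tail is then 2δ₂/(8d), in total δ₂/4.
  set ρ := 1 / 2 + 2 / 5 * R + l with hρ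
  -- ρ + 2 rather than ρ: the net must be fine enough for the enlarged good set that serves ν.
  set X := R * (R + d * (ρ + 2) / 2) with hX
  set N := ⌈X⌉₊ + 1 with hN
  have hl0 : 0 ≤ l := Real.log_nonneg (by rw [one_le_div hδ]; linarith)
  have hX0 : 0 ≤ X := by positivity
  have hNX : X ≤ N := by
    rw [hN]
    push_cast
    linarith [Nat.le_ceil X]
  have hNX' : (N : ℝ) ≤ X + 2 := by
    rw [hN]
    push_cast
    linarith [Nat.ceil_lt_add_one hX0]
  -- Makes the Markov bounds over the net sum to (N + 1)/B₀ = δ₂/4.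
  set B₀ := 4 * ((N : ℝ) + 1) / δ₂ with hB₀
  have hB₀pos : 0 < B₀ := by positivity
  obtain ⟨hlog0, hlog⟩ := log_net_le (N := N) hd hR hδ hδ1 hlL hL4 (by
    refine hNX'.trans (le_of_eq ?_)
    rw [hX, hρ]
    ring)
  rw [← hB₀] at hlog0 hlog
  have hB₀1 : 1 ≤ B₀ := by
    rw [hB₀, one_le_div hδ]
    have : (0 : ℝ) ≤ N := by positivity
    linarith
  have hB1 : 1 ≤ Real.exp (5 / 4 * R) * B₀ :=
    one_le_mul_of_one_le_of_one_le (Real.one_le_exp (by positivity)) hB₀1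
  have hlogB : Real.log (Real.exp (5 / 4 * R) * B₀) = 5 / 4 * R + Real.log B₀ := by
    rw [Real.log_mul (Real.exp_pos _).ne' hB₀pos.ne', Real.log_exp]
  set G := goodSet q T Φ R t₀ h N ρ B₀ with hG
  set G' := goodSet q T Φ R t₀ h N (ρ + 2) (Real.exp (5 / 4 * R) * B₀) with hG'
  have hGm : MeasurableSet G := hΦ.measurableSet_goodSet hq ht₀ hh hT N ρ B₀
  have hGm' : MeasurableSet G' := hΦ.measurableSet_goodSet hq ht₀ hh hT N _ _
  have hgood : ∀ x ∈ G', DerivBoundOn q T Φ C k R δ₂ t₀ h x := by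
    refine fun x hx => ⟨hΦ.contDiffOn_fieldAlong hq x k, fun t ht => ?_⟩
    have htT : t ≤ T - 1 := ht.2.trans hT
    have hσ := sigma_pos (T := T) (t := t) (by linarith)
    have hs : snr T t ^ 2 * R ^ 2 ≤ 17 / 125 * R ^ 2 / sigma T t ^ 2 := by
      rw [snr, div_pow, div_mul_eq_mul_div]
      have := exp_neg_one_sub_sq_le htT
      gcongr
    have hbound := hnum k R L (sigma T t) (snr T t ^ 2 * R ^ 2)
      (151 / 25 * (snr T t ^ 2 * R ^ 2) + 4 * Real.log (Real.exp (5 / 4 * R) * B₀) + 56) hk hR hL4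
      (nine_tenths_le_sigma htT) (sigma_le_one T t) hs (by rw [hlogB]; positivity)
      (by rw [hlogB]; linarith)
    have hcoord : ∀ i, |iteratedDerivWithin k (fieldAlong q T Φ x) (Ico 0 T) t i| ≤
        C * derivBound d k R δ₂ (sigma T t) := fun i => by
      refine (hΦ.abs_iteratedDerivWithin_fieldAlong_le_of_goodSet hq hR.le ht₀ hh hh1 hT
        (Nat.succ_pos _) hB1 hNX hx ht k i).trans (le_trans ?_ hbound)
      have hρL : ρ + 2 + R / 2 ≤ 5 / 2 + 9 / 10 * R + L := by
        rw [hρ]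
        linarith
      refine mul_le_mul_of_nonneg_left (add_le_add le_rfl ?_) (by positivity)
      exact mul_le_mul_of_nonneg_right hρL (by positivity)
    exact (pi_norm_le_iff_of_nonneg ((abs_nonneg _).trans (hcoord ⟨0, hd⟩))).2 hcoord
  have hbad : marginal q T 0 Gᶜ ≤ ENNReal.ofReal (δ₂ / 2) := by
    refine (hΦ.marginal_compl_goodSet_le hq hR.le ht₀ hh hT N ρ hB₀pos).trans
      (ENNReal.ofReal_le_ofReal (le_of_eq ?_))
    have h1 : Real.exp (1 / 2 + 2 / 5 * R - ρ) = δ₂ / (8 * d) := by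
      have : 1 / 2 + 2 / 5 * R - ρ = -l := by rw [hρ]; ring
      rw [this, Real.exp_neg, hl, Real.exp_log (by positivity), inv_div]
    rw [h1, hB₀]
    field_simp
    norm_num
  calc ν {x | ¬ DerivBoundOn q T Φ C k R δ₂ t₀ h x} ≤ ν G'ᶜ :=
        measure_mono fun x hx hxG => hx (hgood x hxG)
    _ = π (Prod.snd ⁻¹' G'ᶜ) := by rw [← hπ.2, Measure.map_apply measurable_snd hGm'.compl]
    _ ≤ π (Prod.fst ⁻¹' Gᶜ ∪ {p | ¬ ∀ t ∈ Icc t₀ (t₀ + h), ‖Φ p.1 t - Φ p.2 t‖ ≤ 1}) := by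
        refine measure_mono fun p hp => ?_
        by_contra hcon
        rw [mem_union, not_or] at hcon
        obtain ⟨h1, h2⟩ := hcon
        rw [mem_ofPred_eq, not_not] at h2
        exact hp (goodSet_of_norm_sub_le hq hh hT (not_not.1 h1)
          fun j hj => h2 _ (net_mem t₀ hh hj))
    _ ≤ π (Prod.fst ⁻¹' Gᶜ) + _ := measure_union_le _ _
    _ = marginal q T 0 Gᶜ + _ := by rw [← hπ.1, Measure.map_apply measurable_fst hGm.compl]
    _ ≤ _ := by gcongr

theorem closeness_le_one {d k : ℕ} {R ε : ℝ} (hd : 1 ≤ d) (hR : 0 < R) (hε : 0 < ε)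
    (hε1 : ε ≤ 1) : closeness d k R ε ≤ 1 := by
  have hl : 0 ≤ Real.log (1 / ε) := Real.log_nonneg (by rwa [one_le_div hε])
  have h1 : 1 ≤ √(d : ℝ) := Real.one_le_sqrt.2 (by exact_mod_cast hd)
  have h2 : 1 ≤ (√(2 * Real.log (1 / ε) * d) / (R * √k) + 1) ^ (Real.log (1 / ε) / k) := by
    refine Real.one_le_rpow ?_ (by positivity)
    have : 0 ≤ √(2 * Real.log (1 / ε) * d) / (R * √k) := by positivity
    linarith
  refine (min_le_right _ _).trans ?_
  have h3 : 1 ≤ (√d + √(Real.log (1 / ε))) *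
      (√(2 * Real.log (1 / ε) * d) / (R * √k) + 1) ^ (Real.log (1 / ε) / k) :=
    one_le_mul_of_one_le_of_one_le (h1.trans (le_add_of_nonneg_right (Real.sqrt_nonneg _))) h2
  exact (div_le_one (by linarith)).2 h3

/-- Separation by more than 1 forces initial distance at least 1/M with M = 2e^{R²}; Markov's
inequality for the squared distance gives 4δ²M². -/
theorem measure_not_close_le {d : ℕ} {R T t₀ h δ : ℝ} {q : Measure (Vec d)}
    [IsProbabilityMeasure q] (hq : q (Metric.closedBall 0 R)ᶜ = 0) (ht₀ : 0 ≤ t₀)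
    (hT : t₀ + h ≤ T - 1) {Φ : Vec d → ℝ → Vec d} (hΦ : IsProbabilityFlow q T Φ)
    {π : Measure (Vec d × Vec d)}
    (hπ : ∫⁻ p, edist p.1 p.2 ^ 2 ∂π ≤ ENNReal.ofReal (4 * δ ^ 2)) :
    π {p | ¬ ∀ t ∈ Icc t₀ (t₀ + h), ‖Φ p.1 t - Φ p.2 t‖ ≤ 1} ≤
      ENNReal.ofReal (16 * δ ^ 2 * Real.exp (R ^ 2) ^ 2) := by
  set M := 2 * Real.exp (R ^ 2) with hM
  have hM0 : 0 < M := by positivity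
  have hsub : {p : Vec d × Vec d | ¬ ∀ t ∈ Icc t₀ (t₀ + h), ‖Φ p.1 t - Φ p.2 t‖ ≤ 1} ⊆
      {p | ENNReal.ofReal (1 / M) ^ 2 ≤ edist p.1 p.2 ^ 2} := by
    intro p hp
    by_contra hcon
    refine hp fun t ht => ?_
    rw [mem_ofPred_eq, not_le] at hcon
    have h1 : edist p.1 p.2 < ENNReal.ofReal (1 / M) := 
      lt_of_not_ge fun hle => hcon.not_ge (pow_le_pow_left' hle 2)
    rw [edist_dist, ENNReal.ofReal_lt_ofReal_iff (by positivity), dist_eq_norm] at h1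
    calc _ ≤ M * ‖p.1 - p.2‖ := hΦ.norm_sub_le hq p.1 p.2 ⟨ht₀.trans ht.1, ht.2.trans hT⟩
      _ ≤ M * (1 / M) := by gcongr
      _ = 1 := by field_simp
  refine (measure_mono hsub).trans ((meas_ge_le_lintegral_div (by fun_prop) ?_ ?_).trans ?_)
  · simpa using hM0
  · simp
  · calc _ ≤ ENNReal.ofReal (4 * δ ^ 2) / ENNReal.ofReal (1 / M) ^ 2 := by gcongr
      _ = ENNReal.ofReal (4 * δ ^ 2 / (1 / M) ^ 2) := by
          rw [← ENNReal.ofReal_pow (by positivity), ENNReal.ofReal_div_of_pos (by positivity)]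
      _ = _ := by
          congr 1
          rw [hM]
          field_simp
          ring

end Probability

end ProbabilityFlow

end

theorem mainTheorem3 :
    ∃ C : ℝ, 0 < C ∧ ∀ (d k : ℕ) (R δ₂ : ℝ), 1 ≤ d → 1 ≤ k → 0 < R → 0 < δ₂ → δ₂ < 1 →
      -- the initializations are close in Wasserstein distance
      (∃ δ₀ : ℝ, 0 < δ₀ ∧
        ∀ (qpre : Measure (Vec d)) [IsProbabilityMeasure qpre],
          qpre (Metric.closedBall 0 R)ᶜ = 0 →
        ∀ T t₀ h : ℝ, 0 ≤ t₀ → 0 ≤ h → h ≤ 1 → t₀ + h ≤ T - 1 →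
        ∀ Φ : Vec d → ℝ → Vec d,
          IsProbabilityFlow qpre T Φ →
        ∀ (δ : ℝ), 0 < δ → δ < 1 → δ ≤ δ₀ →
        ∀ (ν : Measure (Vec d)) [IsProbabilityMeasure ν],
          wassersteinTwo ν (marginal qpre T 0)
            ≤ ENNReal.ofReal δ →
          ν {x | ¬ DerivBoundOn qpre T Φ C k R δ₂ t₀ h x}
            ≤ ENNReal.ofReal δ₂) ∧
      -- explicit version: the coupled trajectories are close on the window
      (∀ (qpre : Measure (Vec d)) [IsProbabilityMeasure qpre],
          qpre (Metric.closedBall 0 R)ᶜ = 0 →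
        ∀ T t₀ h : ℝ, 0 ≤ t₀ → 0 ≤ h → h ≤ 1 → t₀ + h ≤ T - 1 →
        ∀ Φ : Vec d → ℝ → Vec d,
          IsProbabilityFlow qpre T Φ →
        ∀ (ν : Measure (Vec d)) [IsProbabilityMeasure ν]
          (π : Measure (Vec d × Vec d)),
          IsCoupling (marginal qpre T 0) ν π →
          (∀ᵐ p ∂π, ∀ t ∈ Set.Icc t₀ (t₀ + h),
            ‖Φ p.1 t - Φ p.2 t‖
              ≤ closeness d k R (δ₂ / (d * (60 * k) ^ k))) →
          ν {x | ¬ DerivBoundOn qpre T Φ C k R δ₂ t₀ h x}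
            ≤ ENNReal.ofReal δ₂) := by
  obtain ⟨C, hC, hmain⟩ := exists_const_measure_not_derivBoundOn_le
  -- For this δ₀ the separation probability 16δ²e^{2R²} is at most δ₂²/4, hence at most δ₂/2.
  refine ⟨C, hC, fun d k R δ₂ hd hk hR hδ hδ1 => ⟨⟨δ₂ * Real.exp (-R ^ 2) / 8, by positivity, ?_⟩,
    ?_⟩⟩
  · intro q _ hq T t₀ h ht₀ hh hh1 hT Φ hΦ δ hδ0 _ hδδ₀ ν _ hW
    obtain ⟨π, hπ, hint⟩ := exists_coupling_of_wassersteinTwo_le hδ0 hW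
    have hint' : ∫⁻ p, edist p.1 p.2 ^ 2 ∂(π.map Prod.swap) ≤ ENNReal.ofReal (4 * δ ^ 2) := by
      rw [lintegral_map (by fun_prop) measurable_swap]
      simpa only [Prod.fst_swap, Prod.snd_swap, edist_comm] using hint
    refine (hmain d k R δ₂ hd hk hR hδ hδ1 q hq T t₀ h ht₀ hh hh1 hT Φ hΦ ν _ hπ.swap).trans ?_
    have h1 : 16 * δ ^ 2 * Real.exp (R ^ 2) ^ 2 ≤ δ₂ / 2 := by
      have h2 : δ * Real.exp (R ^ 2) ≤ δ₂ / 8 := by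
        calc δ * Real.exp (R ^ 2) ≤ δ₂ * Real.exp (-R ^ 2) / 8 * Real.exp (R ^ 2) := by gcongr
          _ = δ₂ / 8 * (Real.exp (-R ^ 2) * Real.exp (R ^ 2)) := by ring
          _ = δ₂ / 8 := by rw [← Real.exp_add, neg_add_cancel, Real.exp_zero, mul_one]
      have h3 : 0 ≤ δ * Real.exp (R ^ 2) := by positivity
      nlinarith
    calc _ ≤ ENNReal.ofReal (δ₂ / 2) + ENNReal.ofReal (δ₂ / 2) := by
          gcongr
          exact (measure_not_close_le hq ht₀ hT hΦ hint').trans (ENNReal.ofReal_le_ofReal h1)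
      _ = ENNReal.ofReal δ₂ := by
          rw [← ENNReal.ofReal_add (by positivity) (by positivity), add_halves]
  · intro q _ hq T t₀ h ht₀ hh hh1 hT Φ hΦ ν _ π hπ hclose
    refine (hmain d k R δ₂ hd hk hR hδ hδ1 q hq T t₀ h ht₀ hh hh1 hT Φ hΦ ν π hπ).trans ?_
    have hd1 : (1 : ℝ) ≤ d := by exact_mod_cast hd
    have hk1 : (1 : ℝ) ≤ k := by exact_mod_cast hk
    have hle : closeness d k R (δ₂ / (d * (60 * k) ^ k)) ≤ 1 := by
      refine closeness_le_one hd hR (by positivity) ?_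
      rw [div_le_one (by positivity)]
      have h1 : (1 : ℝ) ≤ (60 * k) ^ k := one_le_pow₀ (by linarith)
      nlinarith
    have h0 : π {p | ¬ ∀ t ∈ Icc t₀ (t₀ + h), ‖Φ p.1 t - Φ p.2 t‖ ≤ 1} = 0 :=
      ae_iff.1 (hclose.mono fun p hp t ht => (hp t ht).trans hle)
    rw [h0, add_zero]
    exact ENNReal.ofReal_le_ofReal (by linarith)
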